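/- Let $n\ge 2$, let $\Omega\subset\mathbb R^n$ be a bounded Lipschitz domain and let $1<p\le q<\infty$. For $0\le a\in L^\infty(\Omega)$ put $$W^{1,p,q}_a(\Omega)=\{u\in W^{1,p}(\Omega): a|\nabla u|^q\in L^1(\Omega)\},\qquad W^{1,p,q}_{a,0}(\Omega)=W^{1,p}_0(\Omega)\cap W^{1,p,q}_a(\Omega),$$ where $W^{1,p}_0(\Omega)$ is the closure of $C_c^\infty(\Omega)$ in $W^{1,p}(\Omega)$, and $$\|u\|_{W^{1,p}(\Omega)}=\big(\|u\|_{L^p(\Omega)}^p+\|\nabla u\|_{L^p(\Omega)}^p\big)^{1/p},\qquad \|u\|_{W^{1,p,q}_a(\Omega)}=\|u\|_{W^{1,p}(\Omega)}+\Big(\int_\Omega a|\nabla u|^q\,dx\Big)^{1/q}.$$ **Theorem (well-posedness).** There is an increasing function $C:[0,\infty)\to(0,\infty)$, depending only on $n,\Omega,p,q$, such that for every $a\in L^\infty(\Omega)$ with $a\ge 0$ a.e. and every $f\in W^{1,q}(\Omega)$ the following holds. 1. There is a unique $u\in W^{1,p,q}_a(\Omega)$ that solves $$\operatorname{div}\big(|\nabla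 u|^{p-2}\nabla u+a|\nabla u|^{q-2}\nabla u\big)=0\ \text{ in }\Omega,\qquad u=f\ \text{ on }\partial\Omega,$$ that is, $$\int_\Omega\big(|\nabla u|^{p-2}\nabla u+a|\nabla u|^{q-2}\nabla u\big)\cdot\nabla\varphi\,dx=0\qquad\text{for all }\varphi\in W^{1,p,q}_{a,0}(\Omega),$$ and $u$ and $f$ have the same trace on $\partial\Omega$. 2. This $u$ is the unique minimizer of $$\mathcal F(v;\Omega)=\int_\Omega\Big(|\nabla v|^p+\frac pq\,a|\nabla v|^q\Big)\,dx\in[0,\infty]$$ over $M_f=f+W^{1,p}_0(\Omega)$. 3. With $C=C(\|a\|_{L^\infty(\Omega)})$ and $f|_{\partial\Omega}$ understood as the trace of $f$, $$\|u\|_{W^{1,p}(\Omega)}\le C\big(\|\nabla f\|_{L^q(\Omega)}+\|\nabla f\|_{L^q(\Omega)}^{q/p}+\|f\|_{L^p(\partial\Omega)}\big)$$ and $$\|u\|_{W^{1,p,q}_a(\Omega)}\le C\big(\|\nabla f\|_{L^q(\Omega)}+\|\nabla f\|_{L^q(\Omega)}^{p/q}+\|\nabla f\|_{L^q(\Omega)}^{q/p}+\|f\|_{L^q(\partial\Omega)}\big).$$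 -/

import Mathlib

open MeasureTheory Filter Topology
open scoped ENNReal NNReal ContDiff

noncomputable section

namespace DoublePhase

variable {n : ℕ}

/-- A bounded Lipschitz domain in `ℝⁿ`: a nonempty, bounded, connected open set which, near every
boundary point and with respect to a suitable unit direction `e`, is the region strictly above the
graph of a Lipschitz function of the component of `x` orthogonal to `e`. (`γ` is only evaluated on
the hyperplane orthogonal to `e`.) -/
structure IsBoundedLipschitzDomain (Ω : Set (EuclideanSpace ℝ (Fin n))) : Prop where
  isOpen : IsOpen Ω
  isConnected : IsConnected Ω
  isBounded : Bornology.IsBounded Ω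
  lipschitz_boundary : ∀ x₀ ∈ frontier Ω,
    ∃ (e : EuclideanSpace ℝ (Fin n)) (γ : EuclideanSpace ℝ (Fin n) → ℝ) (L : ℝ≥0) (r : ℝ),
      ‖e‖ = 1 ∧ LipschitzWith L γ ∧ 0 < r ∧
        ∀ x ∈ Metric.ball x₀ r, x ∈ Ω ↔ γ (x - inner ℝ e x • e) < inner ℝ e x

/-- `φ ∈ C_c^∞(Ω)`. -/
structure IsTestFunction (Ω : Set (EuclideanSpace ℝ (Fin n)))
    (φ : EuclideanSpace ℝ (Fin n) → ℝ) : Prop where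
  contDiff : ContDiff ℝ ∞ φ
  hasCompactSupport : HasCompactSupport φ
  tsupport_subset : tsupport φ ⊆ Ω

/-- `G` is the distributional gradient of `u` in `Ω`:
`∫_Ω u ∂ᵢφ = - ∫_Ω Gᵢ φ` for all `φ ∈ C_c^∞(Ω)` and all `i`. -/
structure HasWeakGradient (Ω : Set (EuclideanSpace ℝ (Fin n)))
    (u : EuclideanSpace ℝ (Fin n) → ℝ)
    (G : EuclideanSpace ℝ (Fin n) → EuclideanSpace ℝ (Fin n)) : Prop where
  locallyIntegrableOn : LocallyIntegrableOn u Ω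
  locallyIntegrableOn_grad : LocallyIntegrableOn G Ω
  integral_eq : ∀ φ, IsTestFunction Ω φ → ∀ i : Fin n,
    ∫ x in Ω, u x * fderiv ℝ φ x (EuclideanSpace.single i 1) = - ∫ x in Ω, G x i * φ x

open Classical in
/-- The distributional gradient `∇u` in `Ω` (determined up to null sets); the value is `0` if there
is none that is locally integrable. -/
def weakGrad (Ω : Set (EuclideanSpace ℝ (Fin n))) (u : EuclideanSpace ℝ (Fin n) → ℝ) :
    EuclideanSpace ℝ (Fin n) → EuclideanSpace ℝ (Fin n) :=
  if h : ∃ G, HasWeakGradient Ω u G then h.choose else 0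

/-- `u ∈ W^{1,p}(Ω)`. -/
structure MemW1 (p : ℝ) (Ω : Set (EuclideanSpace ℝ (Fin n)))
    (u : EuclideanSpace ℝ (Fin n) → ℝ) : Prop where
  memLp : MemLp u (ENNReal.ofReal p) (volume.restrict Ω)
  exists_weakGradient : ∃ G, HasWeakGradient Ω u G
  memLp_grad : MemLp (weakGrad Ω u) (ENNReal.ofReal p) (volume.restrict Ω)

/-- `‖u‖_{L^p(Ω)}`, for scalar or vector valued `u`. -/
def lpNorm {F : Type*} [NormedAddCommGroup F] (p : ℝ) (Ω : Set (EuclideanSpace ℝ (Fin n)))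
    (u : EuclideanSpace ℝ (Fin n) → F) : ℝ≥0∞ :=
  eLpNorm u (ENNReal.ofReal p) (volume.restrict Ω)

/-- `‖u‖_{W^{1,p}(Ω)} = (‖u‖_{L^p(Ω)}^p + ‖∇u‖_{L^p(Ω)}^p)^{1/p}`. -/
def w1Norm (p : ℝ) (Ω : Set (EuclideanSpace ℝ (Fin n)))
    (u : EuclideanSpace ℝ (Fin n) → ℝ) : ℝ≥0∞ :=
  (lpNorm p Ω u ^ p + lpNorm p Ω (weakGrad Ω u) ^ p) ^ (1 / p)

/-- `u ∈ W^{1,p}_0(Ω)`, the closure of `C_c^∞(Ω)` in `W^{1,p}(Ω)`. -/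
def MemW10 (p : ℝ) (Ω : Set (EuclideanSpace ℝ (Fin n)))
    (u : EuclideanSpace ℝ (Fin n) → ℝ) : Prop :=
  MemW1 p Ω u ∧ ∃ φ : ℕ → EuclideanSpace ℝ (Fin n) → ℝ,
    (∀ k, IsTestFunction Ω (φ k)) ∧
    Tendsto (fun k => w1Norm p Ω (fun x => u x - φ k x)) atTop (𝓝 0)

/-- The surface measure on `∂Ω`: the (normalized) `(n-1)`-dimensional Hausdorff measure. -/
def surfaceMeasure (Ω : Set (EuclideanSpace ℝ (Fin n))) : Measure (EuclideanSpace ℝ (Fin n)) :=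
  (μHE[n - 1]).restrict (frontier Ω)

/-- `‖g‖_{L^p(∂Ω)}`. -/
def boundaryNorm (p : ℝ) (Ω : Set (EuclideanSpace ℝ (Fin n)))
    (g : EuclideanSpace ℝ (Fin n) → ℝ) : ℝ≥0∞ :=
  eLpNorm g (ENNReal.ofReal p) (surfaceMeasure Ω)

/-- `g ∈ L^p(∂Ω)` is the trace of `u ∈ W^{1,p}(Ω)`: the trace operator
`W^{1,p}(Ω) → L^p(∂Ω)` is the continuous extension of the restriction `v ↦ v|_{∂Ω}` of functions
that are smooth up to the boundary. -/
def HasTrace (p : ℝ) (Ω : Set (EuclideanSpace ℝ (Fin n)))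
    (u g : EuclideanSpace ℝ (Fin n) → ℝ) : Prop :=
  MemW1 p Ω u ∧ MemLp g (ENNReal.ofReal p) (surfaceMeasure Ω) ∧
    ∃ v : ℕ → EuclideanSpace ℝ (Fin n) → ℝ,
      (∀ k, ContDiff ℝ ∞ (v k)) ∧
      Tendsto (fun k => w1Norm p Ω (fun x => u x - v k x)) atTop (𝓝 0) ∧
      Tendsto (fun k => boundaryNorm p Ω (fun x => v k x - g x)) atTop (𝓝 0)

/-- `u ∈ W^{1,p,q}_a(Ω)`: `u ∈ W^{1,p}(Ω)` and `a |∇u|^q ∈ L^1(Ω)`. -/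
def MemW1a (p q : ℝ) (a : EuclideanSpace ℝ (Fin n) → ℝ) (Ω : Set (EuclideanSpace ℝ (Fin n)))
    (u : EuclideanSpace ℝ (Fin n) → ℝ) : Prop :=
  MemW1 p Ω u ∧ IntegrableOn (fun x => a x * ‖weakGrad Ω u x‖ ^ q) Ω

/-- `W^{1,p,q}_{a,0}(Ω) = W^{1,p}_0(Ω) ∩ W^{1,p,q}_a(Ω)`. -/
def MemW1a0 (p q : ℝ) (a : EuclideanSpace ℝ (Fin n) → ℝ) (Ω : Set (EuclideanSpace ℝ (Fin n)))
    (u : EuclideanSpace ℝ (Fin n) → ℝ) : Prop :=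
  MemW10 p Ω u ∧ MemW1a p q a Ω u

/-- `‖v‖_{L^q(Ω;a)} = (∫_Ω a |v|^q)^{1/q}`. -/
def weightedNorm (q : ℝ) (a : EuclideanSpace ℝ (Fin n) → ℝ) (Ω : Set (EuclideanSpace ℝ (Fin n)))
    (v : EuclideanSpace ℝ (Fin n) → EuclideanSpace ℝ (Fin n)) : ℝ≥0∞ :=
  (∫⁻ x in Ω, ENNReal.ofReal (a x * ‖v x‖ ^ q)) ^ (1 / q)

/-- `‖u‖_{W^{1,p,q}_a(Ω)} = ‖u‖_{W^{1,p}(Ω)} + ‖∇u‖_{L^q(Ω;a)}`. -/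
def w1aNorm (p q : ℝ) (a : EuclideanSpace ℝ (Fin n) → ℝ) (Ω : Set (EuclideanSpace ℝ (Fin n)))
    (u : EuclideanSpace ℝ (Fin n) → ℝ) : ℝ≥0∞ :=
  w1Norm p Ω u + weightedNorm q a Ω (weakGrad Ω u)

/-- `u ∈ W^{1,p,q}_a(Ω)` solves `div (|∇u|^{p-2}∇u + a|∇u|^{q-2}∇u) = 0` in `Ω`, `u = f` on `∂Ω`:
the weak formulation holds for all `φ ∈ W^{1,p,q}_{a,0}(Ω)`, and the trace of `u ∈ W^{1,p}(Ω)`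
coincides with the trace of `f ∈ W^{1,q}(Ω)`. -/
structure IsWeakSolution (p q : ℝ) (a : EuclideanSpace ℝ (Fin n) → ℝ)
    (Ω : Set (EuclideanSpace ℝ (Fin n))) (f u : EuclideanSpace ℝ (Fin n) → ℝ) : Prop where
  mem : MemW1a p q a Ω u
  weak_eq : ∀ φ, MemW1a0 p q a Ω φ →
    ∫ x in Ω, inner ℝ
      (‖weakGrad Ω u x‖ ^ (p - 2) • weakGrad Ω u x +
        (a x * ‖weakGrad Ω u x‖ ^ (q - 2)) • weakGrad Ω u x)
      (weakGrad Ω φ x) = 0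
  boundary : ∃ g, HasTrace q Ω f g ∧ HasTrace p Ω u g

/-- `𝓕(v;Ω) = ∫_Ω (|∇v|^p + (p/q) a |∇v|^q)`, with values in `[0,∞]`. -/
def energy (p q : ℝ) (a : EuclideanSpace ℝ (Fin n) → ℝ) (Ω : Set (EuclideanSpace ℝ (Fin n)))
    (v : EuclideanSpace ℝ (Fin n) → ℝ) : ℝ≥0∞ :=
  ∫⁻ x in Ω, ENNReal.ofReal
    (‖weakGrad Ω v x‖ ^ p + p / q * a x * ‖weakGrad Ω v x‖ ^ q)

/-- `M_f = f + W^{1,p}_0(Ω)`. -/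
def admissible (p : ℝ) (Ω : Set (EuclideanSpace ℝ (Fin n)))
    (f : EuclideanSpace ℝ (Fin n) → ℝ) : Set (EuclideanSpace ℝ (Fin n) → ℝ) :=
  {v | MemW10 p Ω (fun x => v x - f x)}

/-- `u` minimizes `𝓕(·;Ω)` over `M_f`. -/
def IsMinimizer (p q : ℝ) (a : EuclideanSpace ℝ (Fin n) → ℝ)
    (Ω : Set (EuclideanSpace ℝ (Fin n))) (f u : EuclideanSpace ℝ (Fin n) → ℝ) : Prop :=
  u ∈ admissible p Ω f ∧ IsMinOn (energy p q a Ω) (admissible p Ω f) u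

end DoublePhase

end

/-!
The functional `𝓕` depends on `v` only through `∇v`, is strictly convex in `∇v`, and its Euler
equation is the weak formulation. So the theorem is an instance of the direct method, once the
Sobolev space theory of a bounded Lipschitz domain is available.

*Variational part.* For `p > 1` the power `|·|^p` is uniformly convex (`exists_norm_sub_rpow_le`):
two competitors with energy close to the infimum have gradients close in `L^p`
(`exists_lpNorm_sub_le_of_gradEnergy_le`), since their mean is again a competitor. Hence gradients
of minimizing sequences are Cauchy, Poincaré's inequality makes the sequences themselves Cauchy, and
Fatou's lemma shows that the limit is a minimizer (`exists_isMinimizer`). The same estimate gives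
uniqueness (`IsMinimizer.ae_eq`). Differentiating `t ↦ 𝓕(u + tφ)` shows that minimizers are weak
solutions, and convexity gives the converse (`IsMinimizer.isWeakSolution`,
`IsWeakSolution.isMinimizer`).

*Traces.* Boundary values are prescribed by a trace for weak solutions and by `f + W^{1,p}_0` for
minimizers. The two agree because `f` has a trace (`MemW1.exists_hasTrace`) and because functions
with vanishing trace belong to `W^{1,p}_0` (`HasTrace.memW10`).

All boundary estimates rest on one elementary fact: a set `A` swept along a segment of length `δ`
has volume at most `C δ` times the `(n-1)`-dimensional Hausdorff measure of `A`
(`exists_volume_tube_le`), with a reverse inequality if `A` is a Lipschitz graph over the orthogonal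
hyperplane (`ofReal_mul_surface_le_volume_tube`). The first inequality controls `u` on the set of
points from which `Ω` is left within distance `δ` in a fixed direction, by the boundary values and
the gradient (`exists_eLpNorm_exitStrip_le`). With `δ` the diameter this is Friedrichs' inequality
`‖u‖_p ≤ C (‖u‖_{L^p(∂Ω)} + ‖∇u‖_p)` (`exists_lpNorm_le_of_hasTrace`), which contains Poincaré's
inequality. With small `δ` and zero trace it gives the bound `‖u‖_p ≤ C δ ‖∇u‖_p` on boundary strips
that makes cutting off near the boundary harmless. The second inequality gives the trace inequality
for smooth functions (`exists_boundaryNorm_le`). Density of smooth functions is obtained by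
mollifying with a shift into the domain, using that a Lipschitz domain satisfies a cone condition
(`exists_smooth_approx`).

*Estimates.* Comparing the energy of `u` with that of `f` bounds `∇u`, and Friedrichs' inequality,
applied to `u` with the trace of `f`, bounds `u`.
-/

namespace DoublePhase

variable {n : ℕ} {Ω : Set (EuclideanSpace ℝ (Fin n))}

local notation "𝔼" => EuclideanSpace ℝ (Fin n)

/-! ### Weak gradients -/

theorem gradient_apply (v : 𝔼 → ℝ) (x : 𝔼) (i : Fin n) :
    gradient v x i = fderiv ℝ v x (EuclideanSpace.single i 1) := by
  have h : inner ℝ (gradient v x) (EuclideanSpace.single i (1 : ℝ))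
      = fderiv ℝ v x (EuclideanSpace.single i 1) := by
    simp [gradient]
  rw [← h, EuclideanSpace.inner_single_right]
  simp

theorem norm_gradient (v : 𝔼 → ℝ) (x : 𝔼) : ‖gradient v x‖ = ‖fderiv ℝ v x‖ := by
  simp [gradient]

theorem continuous_gradient {v : 𝔼 → ℝ} (hv : ContDiff ℝ 1 v) : Continuous (gradient v) :=
  (InnerProductSpace.toDual ℝ 𝔼).symm.continuous.comp (hv.continuous_fderiv one_ne_zero)

theorem gradient_sub {v w : 𝔼 → ℝ} (hv : ContDiff ℝ 1 v) (hw : ContDiff ℝ 1 w) :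
    gradient (fun x => v x - w x) = fun x => gradient v x - gradient w x := by
  funext x
  have := fderiv_fun_sub (hv.differentiable one_ne_zero x) (hw.differentiable one_ne_zero x)
  simp [gradient, this]

theorem gradient_add {v w : 𝔼 → ℝ} (hv : ContDiff ℝ 1 v) (hw : ContDiff ℝ 1 w) :
    gradient (fun x => v x + w x) = fun x => gradient v x + gradient w x := by
  funext x
  have := fderiv_fun_add (hv.differentiable one_ne_zero x) (hw.differentiable one_ne_zero x)
  simp [gradient, this]

theorem integrableOn_mul_of_tsupport_subset {g φ : 𝔼 → ℝ} (hg : LocallyIntegrableOn g Ω)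
    (hφ : Continuous φ) (hc : HasCompactSupport φ) (hs : tsupport φ ⊆ Ω) :
    IntegrableOn (fun x => g x * φ x) Ω := by
  have h1 : IntegrableOn (fun x => g x * φ x) (tsupport φ) :=
    (hg.integrableOn_compact_subset hs hc.isCompact).mul_continuousOn hφ.continuousOn hc.isCompact
  refine IntegrableOn.of_forall_sdiff_eq_zero h1 ?_ ?_ |>.mono_set (Set.subset_univ Ω)
  · exact MeasurableSet.univ
  · intro x hx
    simp [image_eq_zero_of_notMem_tsupport hx.2]

theorem IsTestFunction.fderiv_apply {φ : 𝔼 → ℝ} (hφ : IsTestFunction Ω φ) (w : 𝔼) :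
    IsTestFunction Ω (fun x => fderiv ℝ φ x w) := by
  have hs : tsupport (fun x => fderiv ℝ φ x w) ⊆ tsupport φ :=
    (closure_mono fun x hx => by
      contrapose! hx
      simp [Function.notMem_support.1 hx]).trans (tsupport_fderiv_subset ℝ)
  exact ⟨(hφ.contDiff.fderiv_right (by simp)).clm_apply contDiff_const,
    hφ.hasCompactSupport.of_isClosed_subset (isClosed_tsupport _) hs, hs.trans hφ.tsupport_subset⟩

theorem locallyIntegrableOn_apply {G : 𝔼 → 𝔼} (h : LocallyIntegrableOn G Ω) (i : Fin n) :
    LocallyIntegrableOn (fun x => G x i) Ω := by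
  intro x hx
  obtain ⟨s, hs, hG⟩ := h x hx
  exact ⟨s, hs, (EuclideanSpace.proj (𝕜 := ℝ) i).integrable_comp hG⟩

theorem IsTestFunction.integrableOn_mul {φ g : 𝔼 → ℝ} (hφ : IsTestFunction Ω φ)
    (hg : LocallyIntegrableOn g Ω) : IntegrableOn (fun x => g x * φ x) Ω :=
  integrableOn_mul_of_tsupport_subset hg hφ.contDiff.continuous hφ.hasCompactSupport
    hφ.tsupport_subset

/-- The weak gradient is unique up to null sets. -/
theorem HasWeakGradient.ae_eq (hΩ : IsOpen Ω) {u : 𝔼 → ℝ} {G H : 𝔼 → 𝔼}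
    (hG : HasWeakGradient Ω u G) (hH : HasWeakGradient Ω u H) :
    G =ᵐ[volume.restrict Ω] H := by
  have key : ∀ i : Fin n, ∀ᵐ x ∂(volume : Measure 𝔼), x ∈ Ω → G x i - H x i = 0 := by
    intro i
    have h1 := locallyIntegrableOn_apply hG.locallyIntegrableOn_grad i
    have h2 := locallyIntegrableOn_apply hH.locallyIntegrableOn_grad i
    refine hΩ.ae_eq_zero_of_integral_contDiff_smul_eq_zero (h1.sub h2) ?_
    intro φ hsm hc hs
    have ht : IsTestFunction Ω φ := ⟨hsm, hc, hs⟩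
    have e := (hG.integral_eq φ ht i).symm.trans (hH.integral_eq φ ht i)
    have e2 : ∫ x in Ω, (G x i * φ x - H x i * φ x) = 0 := by
      rw [integral_sub (ht.integrableOn_mul h1) (ht.integrableOn_mul h2)]
      linarith
    rw [← e2, ← setIntegral_eq_integral_of_forall_compl_eq_zero (s := Ω)]
    · congr 1 with x
      simp
      ring
    · intro x hx
      have : φ x = 0 := image_eq_zero_of_notMem_tsupport fun h => hx (hs h)
      simp [this]
  rw [EventuallyEq, ae_restrict_iff' hΩ.measurableSet]
  filter_upwards [ae_all_iff.2 key] with x hx hxΩ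
  ext i
  exact sub_eq_zero.1 (hx i hxΩ)

theorem hasWeakGradient_weakGrad {u : 𝔼 → ℝ} (h : ∃ G, HasWeakGradient Ω u G) :
    HasWeakGradient Ω u (weakGrad Ω u) := by
  rw [weakGrad, dif_pos h]
  exact h.choose_spec

theorem HasWeakGradient.weakGrad_ae_eq (hΩ : IsOpen Ω) {u : 𝔼 → ℝ} {G : 𝔼 → 𝔼}
    (hG : HasWeakGradient Ω u G) : weakGrad Ω u =ᵐ[volume.restrict Ω] G :=
  (hasWeakGradient_weakGrad ⟨G, hG⟩).ae_eq hΩ hG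

theorem HasWeakGradient.add {u v : 𝔼 → ℝ} {G H : 𝔼 → 𝔼} (hu : HasWeakGradient Ω u G)
    (hv : HasWeakGradient Ω v H) :
    HasWeakGradient Ω (fun x => u x + v x) (fun x => G x + H x) where
  locallyIntegrableOn := hu.locallyIntegrableOn.add hv.locallyIntegrableOn
  locallyIntegrableOn_grad := hu.locallyIntegrableOn_grad.add hv.locallyIntegrableOn_grad
  integral_eq φ hφ i := by
    have hd := hφ.fderiv_apply (EuclideanSpace.single i 1)
    simp only [add_mul, PiLp.add_apply]
    rw [integral_add (hd.integrableOn_mul hu.locallyIntegrableOn)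
        (hd.integrableOn_mul hv.locallyIntegrableOn),
      integral_add
        (hφ.integrableOn_mul (locallyIntegrableOn_apply hu.locallyIntegrableOn_grad i))
        (hφ.integrableOn_mul (locallyIntegrableOn_apply hv.locallyIntegrableOn_grad i)),
      hu.integral_eq φ hφ i, hv.integral_eq φ hφ i]
    ring

theorem HasWeakGradient.const_smul {u : 𝔼 → ℝ} {G : 𝔼 → 𝔼} (hu : HasWeakGradient Ω u G)
    (c : ℝ) : HasWeakGradient Ω (fun x => c * u x) (fun x => c • G x) where
  locallyIntegrableOn := fun x hx => by
    obtain ⟨s, hs, h⟩ := hu.locallyIntegrableOn x hx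
    exact ⟨s, hs, h.const_mul c⟩
  locallyIntegrableOn_grad := fun x hx => by
    obtain ⟨s, hs, h⟩ := hu.locallyIntegrableOn_grad x hx
    exact ⟨s, hs, h.smul c⟩
  integral_eq φ hφ i := by
    simp only [PiLp.smul_apply, smul_eq_mul, mul_assoc]
    rw [integral_const_mul, integral_const_mul, hu.integral_eq φ hφ i]
    ring

theorem HasWeakGradient.sub {u v : 𝔼 → ℝ} {G H : 𝔼 → 𝔼} (hu : HasWeakGradient Ω u G)
    (hv : HasWeakGradient Ω v H) :
    HasWeakGradient Ω (fun x => u x - v x) (fun x => G x - H x) := by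
  simpa [sub_eq_add_neg] using hu.add (hv.const_smul (-1))

theorem hasWeakGradient_gradient {v : 𝔼 → ℝ} (hv : ContDiff ℝ ∞ v) :
    HasWeakGradient Ω v (gradient v) where
  locallyIntegrableOn := hv.continuous.locallyIntegrable.locallyIntegrableOn Ω
  locallyIntegrableOn_grad :=
    (continuous_gradient (hv.of_le (by simp))).locallyIntegrable.locallyIntegrableOn Ω
  integral_eq φ hφ i := by
    have hd := hφ.fderiv_apply (EuclideanSpace.single i 1)
    have z : ∀ ψ : 𝔼 → ℝ, IsTestFunction Ω ψ → ∀ g : 𝔼 → ℝ,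
        ∫ x in Ω, g x * ψ x = ∫ x, g x * ψ x := by
      intro ψ hψ g
      refine setIntegral_eq_integral_of_forall_compl_eq_zero fun x hx => ?_
      simp [image_eq_zero_of_notMem_tsupport fun h => hx (hψ.tsupport_subset h)]
    have hi : ∀ ψ : 𝔼 → ℝ, IsTestFunction Ω ψ → ∀ g : 𝔼 → ℝ, Continuous g →
        Integrable (fun x => g x * ψ x) := fun ψ hψ g hg =>
      (hg.mul hψ.contDiff.continuous).integrable_of_hasCompactSupport hψ.hasCompactSupport.mul_left
    have hcg : Continuous fun x => fderiv ℝ v x (EuclideanSpace.single i 1) :=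
      (hv.continuous_fderiv (by simp)).clm_apply continuous_const
    simp only [gradient_apply]
    rw [z _ hd, z _ hφ]
    exact integral_mul_fderiv_eq_neg_fderiv_mul_of_integrable (hi _ hφ _ hcg)
      (hi _ hd _ hv.continuous) (hi _ hφ _ hv.continuous)
      (fun x _ => hv.differentiable (by simp) x)
      (fun x _ => hφ.contDiff.differentiable (by simp) x)

theorem memLp_of_continuous (hb : Bornology.IsBounded Ω) {F : Type*} [NormedAddCommGroup F]
    {v : 𝔼 → F} (hv : Continuous v) (P : ℝ≥0∞) :
    MemLp v P (volume.restrict Ω) := by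
  have hK : IsCompact (closure Ω) := hb.isCompact_closure
  obtain ⟨C, hC⟩ := hK.exists_bound_of_continuousOn hv.continuousOn
  have : IsFiniteMeasure (volume.restrict (closure Ω)) :=
    ⟨by simpa using hK.measure_lt_top⟩
  refine (MemLp.of_bound (μ := volume.restrict (closure Ω)) hv.aestronglyMeasurable C
    ?_).mono_measure (Measure.restrict_mono subset_closure le_rfl)
  exact (ae_restrict_iff' isClosed_closure.measurableSet).2 (.of_forall hC)

theorem isFiniteMeasure_restrict_of_isBounded (hb : Bornology.IsBounded Ω) :
    IsFiniteMeasure ((volume : Measure 𝔼).restrict Ω) :=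
  ⟨by simpa using hb.measure_lt_top⟩

theorem one_le_ofReal {p : ℝ} (hp : 1 ≤ p) : 1 ≤ ENNReal.ofReal p := by
  simpa using hp

theorem locallyIntegrableOn_of_memLp {F : Type*} [NormedAddCommGroup F] {p : ℝ} (hp : 1 ≤ p)
    (hb : Bornology.IsBounded Ω) {v : 𝔼 → F}
    (hv : MemLp v (ENNReal.ofReal p) (volume.restrict Ω)) : LocallyIntegrableOn v Ω := by
  have := isFiniteMeasure_restrict_of_isBounded hb
  have : IntegrableOn v Ω := hv.integrable (one_le_ofReal hp)
  exact this.locallyIntegrableOn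

/-- Weak gradients are closed under convergence in `L^p`. -/
theorem hasWeakGradient_of_tendsto (hb : Bornology.IsBounded Ω) {p : ℝ} (hp : 1 ≤ p)
    {u : ℕ → 𝔼 → ℝ} {G : ℕ → 𝔼 → 𝔼} {v : 𝔼 → ℝ} {H : 𝔼 → 𝔼}
    (hu : ∀ k, HasWeakGradient Ω (u k) (G k))
    (hul : ∀ k, MemLp (u k) (ENNReal.ofReal p) (volume.restrict Ω))
    (hGl : ∀ k, MemLp (G k) (ENNReal.ofReal p) (volume.restrict Ω))
    (hv : MemLp v (ENNReal.ofReal p) (volume.restrict Ω))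
    (hH : MemLp H (ENNReal.ofReal p) (volume.restrict Ω))
    (h1 : Tendsto (fun k => lpNorm p Ω (fun x => u k x - v x)) atTop (𝓝 0))
    (h2 : Tendsto (fun k => lpNorm p Ω (fun x => G k x - H x)) atTop (𝓝 0)) :
    HasWeakGradient Ω v H where
  locallyIntegrableOn := locallyIntegrableOn_of_memLp hp hb hv
  locallyIntegrableOn_grad := locallyIntegrableOn_of_memLp hp hb hH
  integral_eq φ hφ i := by
    have := isFiniteMeasure_restrict_of_isBounded hb
    -- integrals against test functions converge, because on the bounded set `Ω` convergence in
    -- `L^p` implies convergence in `L^1`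
    have lim : ∀ (w : ℕ → 𝔼 → ℝ) (w' : 𝔼 → ℝ) (ψ : 𝔼 → ℝ), IsTestFunction Ω ψ →
        (∀ k, MemLp (w k) (ENNReal.ofReal p) (volume.restrict Ω)) →
        MemLp w' (ENNReal.ofReal p) (volume.restrict Ω) →
        Tendsto (fun k => lpNorm p Ω (fun x => w k x - w' x)) atTop (𝓝 0) →
        Tendsto (fun k => ∫ x in Ω, w k x * ψ x) atTop (𝓝 (∫ x in Ω, w' x * ψ x)) := by
      intro w w' ψ hψ hw hw' hlim
      have hint : ∀ g : 𝔼 → ℝ, MemLp g (ENNReal.ofReal p) (volume.restrict Ω) →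
          IntegrableOn (fun x => g x * ψ x) Ω := fun g hg =>
        hψ.integrableOn_mul (locallyIntegrableOn_of_memLp hp hb hg)
      obtain ⟨C, hC⟩ := hψ.hasCompactSupport.exists_bound_of_continuous hψ.contDiff.continuous
      refine tendsto_integral_of_L1' _ (hint _ hw').aestronglyMeasurable
        (.of_forall fun k => hint _ (hw k)) ?_
      have hbd : ∀ k, eLpNorm ((fun x => w k x * ψ x) - fun x => w' x * ψ x) 1
          (volume.restrict Ω) ≤ ENNReal.ofReal C * (lpNorm p Ω (fun x => w k x - w' x) *
            (volume.restrict Ω) Set.univ ^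
              (1 / (1 : ℝ≥0∞).toReal - 1 / (ENNReal.ofReal p).toReal)) := by
        intro k
        refine (eLpNorm_le_mul_eLpNorm_of_ae_le_mul (g := fun x => w k x - w' x)
          (c := C) (.of_forall fun x => ?_) 1).trans ?_
        · have : ((fun x => w k x * ψ x) - fun x => w' x * ψ x) x = (w k x - w' x) * ψ x := by
            simp; ring
          rw [this, norm_mul, mul_comm]
          exact mul_le_mul_of_nonneg_right (hC x) (norm_nonneg _)
        · gcongr
          exact eLpNorm_le_eLpNorm_mul_rpow_measure_univ (one_le_ofReal hp)
            ((hw k).sub hw').aestronglyMeasurable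
      refine tendsto_of_tendsto_of_tendsto_of_le_of_le tendsto_const_nhds ?_
        (fun k => zero_le) hbd
      have hexp : (volume.restrict Ω) (Set.univ : Set 𝔼) ^
          (1 / (1 : ℝ≥0∞).toReal - 1 / (ENNReal.ofReal p).toReal) ≠ ⊤ := by
        refine ENNReal.rpow_ne_top_of_nonneg ?_ (measure_ne_top _ _)
        rw [ENNReal.toReal_ofReal (by linarith), ENNReal.toReal_one, div_one, sub_nonneg]
        exact div_le_one_of_le₀ hp (by linarith)
      have := ENNReal.Tendsto.const_mul (a := ENNReal.ofReal C)
        (ENNReal.Tendsto.mul_const hlim (.inr hexp)) (.inr ENNReal.ofReal_ne_top)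
      simpa using this
    have hproj : ∀ g : 𝔼 → 𝔼, MemLp g (ENNReal.ofReal p) (volume.restrict Ω) →
        MemLp (fun x => g x i) (ENNReal.ofReal p) (volume.restrict Ω) := fun g hg =>
      (EuclideanSpace.proj (𝕜 := ℝ) i).comp_memLp' hg
    have l1 := lim u v _ (hφ.fderiv_apply (EuclideanSpace.single i 1)) hul hv h1
    have l2 := lim (fun k x => G k x i) (fun x => H x i) φ hφ (fun k => hproj _ (hGl k))
      (hproj _ hH) (tendsto_of_tendsto_of_tendsto_of_le_of_le tendsto_const_nhds h2
        (fun k => zero_le) fun k => eLpNorm_mono fun x => by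
          simpa using PiLp.norm_apply_le (G k x - H x) i)
    refine tendsto_nhds_unique l1 ?_
    simp only [fun k => (hu k).integral_eq φ hφ i]
    exact l2.neg

/-! ### Sobolev functions -/

theorem lpNorm_congr {F : Type*} [NormedAddCommGroup F] {p : ℝ} {u v : 𝔼 → F}
    (h : u =ᵐ[volume.restrict Ω] v) : lpNorm p Ω u = lpNorm p Ω v :=
  eLpNorm_congr_ae h

theorem lpNorm_sub_comm {F : Type*} [NormedAddCommGroup F] {p : ℝ} (u v : 𝔼 → F) :
    lpNorm p Ω (fun x => u x - v x) = lpNorm p Ω (fun x => v x - u x) :=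
  eLpNorm_sub_comm u v _ _

theorem lpNorm_le_w1Norm {p : ℝ} (hp : 0 < p) (u : 𝔼 → ℝ) : lpNorm p Ω u ≤ w1Norm p Ω u := by
  rw [w1Norm, one_div, ENNReal.le_rpow_inv_iff hp]
  exact le_self_add

theorem lpNorm_weakGrad_le_w1Norm {p : ℝ} (hp : 0 < p) (u : 𝔼 → ℝ) :
    lpNorm p Ω (weakGrad Ω u) ≤ w1Norm p Ω u := by
  rw [w1Norm, one_div, ENNReal.le_rpow_inv_iff hp]
  exact le_add_self

theorem w1Norm_le_add {p : ℝ} (hp : 1 ≤ p) (u : 𝔼 → ℝ) :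
    w1Norm p Ω u ≤ lpNorm p Ω u + lpNorm p Ω (weakGrad Ω u) :=
  ENNReal.rpow_add_rpow_le_add _ _ hp

theorem MemW1.hasWeakGradient {p : ℝ} {u : 𝔼 → ℝ} (hu : MemW1 p Ω u) :
    HasWeakGradient Ω u (weakGrad Ω u) :=
  hasWeakGradient_weakGrad hu.exists_weakGradient

theorem HasWeakGradient.memW1 (hΩ : IsOpen Ω) {p : ℝ} {u : 𝔼 → ℝ} {G : 𝔼 → 𝔼}
    (h : HasWeakGradient Ω u G) (hu : MemLp u (ENNReal.ofReal p) (volume.restrict Ω))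
    (hG : MemLp G (ENNReal.ofReal p) (volume.restrict Ω)) : MemW1 p Ω u :=
  ⟨hu, ⟨G, h⟩, hG.ae_eq (h.weakGrad_ae_eq hΩ).symm⟩

theorem MemW1.add (hΩ : IsOpen Ω) {p : ℝ} {u v : 𝔼 → ℝ} (hu : MemW1 p Ω u)
    (hv : MemW1 p Ω v) : MemW1 p Ω (fun x => u x + v x) :=
  (hu.hasWeakGradient.add hv.hasWeakGradient).memW1 hΩ (hu.memLp.add hv.memLp)
    (hu.memLp_grad.add hv.memLp_grad)

theorem MemW1.const_mul (hΩ : IsOpen Ω) {p : ℝ} {u : 𝔼 → ℝ} (hu : MemW1 p Ω u) (c : ℝ) :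
    MemW1 p Ω (fun x => c * u x) :=
  (hu.hasWeakGradient.const_smul c).memW1 hΩ (hu.memLp.const_mul c)
    (hu.memLp_grad.const_smul c)

theorem MemW1.mono_exponent (hb : Bornology.IsBounded Ω) {p q : ℝ} (hpq : p ≤ q) {u : 𝔼 → ℝ}
    (hu : MemW1 q Ω u) : MemW1 p Ω u := by
  have := isFiniteMeasure_restrict_of_isBounded hb
  exact ⟨hu.memLp.mono_exponent (ENNReal.ofReal_le_ofReal hpq), hu.exists_weakGradient,
    hu.memLp_grad.mono_exponent (ENNReal.ofReal_le_ofReal hpq)⟩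

theorem memW1_of_contDiff (hΩ : IsOpen Ω) (hb : Bornology.IsBounded Ω) (p : ℝ) {v : 𝔼 → ℝ}
    (hv : ContDiff ℝ ∞ v) : MemW1 p Ω v :=
  (hasWeakGradient_gradient hv).memW1 hΩ (memLp_of_continuous hb hv.continuous _)
    (memLp_of_continuous hb (continuous_gradient (hv.of_le (by simp))) _)

theorem weakGrad_sub_ae_eq (hΩ : IsOpen Ω) {p q : ℝ} {u v : 𝔼 → ℝ} (hu : MemW1 p Ω u)
    (hv : MemW1 q Ω v) : weakGrad Ω (fun x => u x - v x)
      =ᵐ[volume.restrict Ω] fun x => weakGrad Ω u x - weakGrad Ω v x :=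
  (hu.hasWeakGradient.sub hv.hasWeakGradient).weakGrad_ae_eq hΩ

theorem tendsto_w1Norm_zero_iff {p : ℝ} (hp : 1 ≤ p) {w : ℕ → 𝔼 → ℝ} :
    Tendsto (fun k => w1Norm p Ω (w k)) atTop (𝓝 0) ↔
      Tendsto (fun k => lpNorm p Ω (w k)) atTop (𝓝 0) ∧
      Tendsto (fun k => lpNorm p Ω (weakGrad Ω (w k))) atTop (𝓝 0) := by
  have hp0 : 0 < p := by linarith
  constructor
  · intro h
    exact ⟨tendsto_of_tendsto_of_tendsto_of_le_of_le tendsto_const_nhds h (fun _ => zero_le)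
      fun k => lpNorm_le_w1Norm hp0 _,
      tendsto_of_tendsto_of_tendsto_of_le_of_le tendsto_const_nhds h (fun _ => zero_le)
      fun k => lpNorm_weakGrad_le_w1Norm hp0 _⟩
  · rintro ⟨h1, h2⟩
    refine tendsto_of_tendsto_of_tendsto_of_le_of_le tendsto_const_nhds ?_ (fun _ => zero_le)
      fun k => w1Norm_le_add hp _
    simpa using h1.add h2

/-- Convergence in `W^{1,p}` of smooth functions, in terms of a given weak gradient. -/
theorem tendsto_w1Norm_sub_smooth_iff (hΩ : IsOpen Ω) {p : ℝ} (hp : 1 ≤ p) {u : 𝔼 → ℝ}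
    {G : 𝔼 → 𝔼} (hu : HasWeakGradient Ω u G) {v : ℕ → 𝔼 → ℝ} (hv : ∀ k, ContDiff ℝ ∞ (v k)) :
    Tendsto (fun k => w1Norm p Ω (fun x => u x - v k x)) atTop (𝓝 0) ↔
      Tendsto (fun k => lpNorm p Ω (fun x => u x - v k x)) atTop (𝓝 0) ∧
      Tendsto (fun k => lpNorm p Ω (fun x => G x - gradient (v k) x)) atTop (𝓝 0) := by
  rw [tendsto_w1Norm_zero_iff hp]
  have : ∀ k, lpNorm p Ω (weakGrad Ω fun x => u x - v k x)
      = lpNorm p Ω (fun x => G x - gradient (v k) x) := fun k =>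
    lpNorm_congr ((hu.sub (hasWeakGradient_gradient (hv k))).weakGrad_ae_eq hΩ)
  simp only [this]

/-- Membership in `W^{1,p}_0` in terms of `ε`-approximation and a given weak gradient. -/
theorem memW10_iff (hΩ : IsOpen Ω) {p : ℝ} (hp : 1 ≤ p) {u : 𝔼 → ℝ}
    {G : 𝔼 → 𝔼} (hu : HasWeakGradient Ω u G)
    (hul : MemLp u (ENNReal.ofReal p) (volume.restrict Ω))
    (hGl : MemLp G (ENNReal.ofReal p) (volume.restrict Ω)) :
    MemW10 p Ω u ↔ ∀ ε : ℝ≥0∞, 0 < ε → ∃ φ, IsTestFunction Ω φ ∧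
      lpNorm p Ω (fun x => u x - φ x) ≤ ε ∧ lpNorm p Ω (fun x => G x - gradient φ x) ≤ ε := by
  constructor
  · rintro ⟨-, φ, hφ, hlim⟩ ε hε
    obtain ⟨h1, h2⟩ := (tendsto_w1Norm_sub_smooth_iff hΩ hp hu fun k => (hφ k).contDiff).1 hlim
    obtain ⟨k, hk1, hk2⟩ :=
      ((ENNReal.tendsto_nhds_zero.1 h1 ε hε).and (ENNReal.tendsto_nhds_zero.1 h2 ε hε)).exists
    exact ⟨φ k, hφ k, hk1, hk2⟩
  · intro h
    choose φ hφ h1 h2 using fun k : ℕ => h ((k : ℝ≥0∞)⁻¹) (by simp)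
    refine ⟨hu.memW1 hΩ hul hGl, φ, hφ,
      (tendsto_w1Norm_sub_smooth_iff hΩ hp hu fun k => (hφ k).contDiff).2 ⟨?_, ?_⟩⟩
    · exact tendsto_of_tendsto_of_tendsto_of_le_of_le tendsto_const_nhds
        ENNReal.tendsto_inv_nat_nhds_zero (fun _ => zero_le) h1
    · exact tendsto_of_tendsto_of_tendsto_of_le_of_le tendsto_const_nhds
        ENNReal.tendsto_inv_nat_nhds_zero (fun _ => zero_le) h2

theorem lpNorm_add_le {F : Type*} [NormedAddCommGroup F] {p : ℝ} (hp : 1 ≤ p) {u v : 𝔼 → F}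
    (hu : AEStronglyMeasurable u (volume.restrict Ω))
    (hv : AEStronglyMeasurable v (volume.restrict Ω)) :
    lpNorm p Ω (fun x => u x + v x) ≤ lpNorm p Ω u + lpNorm p Ω v :=
  eLpNorm_add_le hu hv (one_le_ofReal hp)

theorem lpNorm_sub_le_add {F : Type*} [NormedAddCommGroup F] {p : ℝ} (hp : 1 ≤ p) {u v w : 𝔼 → F}
    (hu : AEStronglyMeasurable u (volume.restrict Ω))
    (hv : AEStronglyMeasurable v (volume.restrict Ω))
    (hw : AEStronglyMeasurable w (volume.restrict Ω)) :
    lpNorm p Ω (fun x => u x - w x) ≤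
      lpNorm p Ω (fun x => u x - v x) + lpNorm p Ω (fun x => v x - w x) := by
  refine le_trans (le_of_eq ?_) (lpNorm_add_le hp (hu.sub hv) (hv.sub hw))
  simp

theorem lpNorm_const_smul {F : Type*} [NormedAddCommGroup F] [NormedSpace ℝ F] {p : ℝ} (c : ℝ)
    (u : 𝔼 → F) : lpNorm p Ω (fun x => c • u x) = ‖c‖ₑ * lpNorm p Ω u :=
  eLpNorm_const_smul c u _ _

theorem IsTestFunction.add {φ ψ : 𝔼 → ℝ} (hφ : IsTestFunction Ω φ) (hψ : IsTestFunction Ω ψ) :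
    IsTestFunction Ω (fun x => φ x + ψ x) :=
  ⟨hφ.contDiff.add hψ.contDiff, hφ.hasCompactSupport.add hψ.hasCompactSupport,
    (tsupport_add φ ψ).trans (Set.union_subset hφ.tsupport_subset hψ.tsupport_subset)⟩

theorem IsTestFunction.const_mul {φ : 𝔼 → ℝ} (hφ : IsTestFunction Ω φ) (c : ℝ) :
    IsTestFunction Ω (fun x => c * φ x) :=
  ⟨contDiff_const.mul hφ.contDiff, hφ.hasCompactSupport.mul_left,
    (tsupport_mul_subset_right (f := fun _ => c)).trans hφ.tsupport_subset⟩

theorem IsTestFunction.zero : IsTestFunction Ω (fun _ => (0 : ℝ)) :=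
  ⟨contDiff_const, HasCompactSupport.zero, by simp [tsupport]⟩

theorem MemW10.add (hΩ : IsOpen Ω) {p : ℝ} (hp : 1 ≤ p) {u v : 𝔼 → ℝ} (hu : MemW10 p Ω u)
    (hv : MemW10 p Ω v) : MemW10 p Ω (fun x => u x + v x) := by
  refine (memW10_iff hΩ hp (hu.1.hasWeakGradient.add hv.1.hasWeakGradient)
    (hu.1.memLp.add hv.1.memLp) (hu.1.memLp_grad.add hv.1.memLp_grad)).2 fun ε hε => ?_
  have hε2 : 0 < ε / 2 := ENNReal.half_pos hε.ne'
  obtain ⟨φ, hφ, a1, a2⟩ := (memW10_iff hΩ hp hu.1.hasWeakGradient hu.1.memLp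
    hu.1.memLp_grad).1 hu _ hε2
  obtain ⟨ψ, hψ, b1, b2⟩ := (memW10_iff hΩ hp hv.1.hasWeakGradient hv.1.memLp
    hv.1.memLp_grad).1 hv _ hε2
  have s1 := hφ.contDiff.of_le (m := 1) (by simp)
  have s2 := hψ.contDiff.of_le (m := 1) (by simp)
  refine ⟨_, hφ.add hψ, ?_, ?_⟩
  · have e : (fun x => u x + v x - (φ x + ψ x)) = fun x => (u x - φ x) + (v x - ψ x) := by
      funext x; ring
    rw [e, ← ENNReal.add_halves ε]
    exact (lpNorm_add_le hp
      (hu.1.memLp.aestronglyMeasurable.sub s1.continuous.aestronglyMeasurable)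
      (hv.1.memLp.aestronglyMeasurable.sub s2.continuous.aestronglyMeasurable)).trans
      (add_le_add a1 b1)
  · have e : (fun x => weakGrad Ω u x + weakGrad Ω v x - gradient (fun x => φ x + ψ x) x)
        = fun x => (weakGrad Ω u x - gradient φ x) + (weakGrad Ω v x - gradient ψ x) := by
      rw [gradient_add s1 s2]
      funext x; exact add_sub_add_comm _ _ _ _
    rw [e, ← ENNReal.add_halves ε]
    exact (lpNorm_add_le hp
      (hu.1.memLp_grad.aestronglyMeasurable.sub (continuous_gradient s1).aestronglyMeasurable)
      (hv.1.memLp_grad.aestronglyMeasurable.sub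
        (continuous_gradient s2).aestronglyMeasurable)).trans (add_le_add a2 b2)

theorem gradient_const_mul {v : 𝔼 → ℝ} (hv : ContDiff ℝ 1 v) (c : ℝ) :
    gradient (fun x => c * v x) = fun x => c • gradient v x := by
  funext x
  have := fderiv_const_mul (hv.differentiable one_ne_zero x) c
  simp [gradient, this]

theorem MemW10.const_mul (hΩ : IsOpen Ω) {p : ℝ} (hp : 1 ≤ p) {u : 𝔼 → ℝ} (hu : MemW10 p Ω u)
    (c : ℝ) : MemW10 p Ω (fun x => c * u x) := by
  obtain ⟨φ, hφ, hlim⟩ := hu.2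
  refine ⟨hu.1.const_mul hΩ c, fun k x => c * φ k x, fun k => (hφ k).const_mul c, ?_⟩
  have hg := hu.1.hasWeakGradient
  obtain ⟨h1, h2⟩ := (tendsto_w1Norm_sub_smooth_iff hΩ hp hg fun k => (hφ k).contDiff).1 hlim
  refine (tendsto_w1Norm_sub_smooth_iff hΩ hp (hg.const_smul c)
    fun k => ((hφ k).const_mul c).contDiff).2 ⟨?_, ?_⟩
  · have e : ∀ k, lpNorm p Ω (fun x => c * u x - c * φ k x)
        = ‖c‖ₑ * lpNorm p Ω (fun x => u x - φ k x) := fun k => by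
      rw [← lpNorm_const_smul]; simp [mul_sub]
    simp only [e]
    simpa using ENNReal.Tendsto.const_mul (a := ‖c‖ₑ) h1 (.inr enorm_ne_top)
  · have e : ∀ k, lpNorm p Ω (fun x => c • weakGrad Ω u x - gradient (fun x => c * φ k x) x)
        = ‖c‖ₑ * lpNorm p Ω (fun x => weakGrad Ω u x - gradient (φ k) x) := fun k => by
      rw [← lpNorm_const_smul,
        gradient_const_mul ((hφ k).contDiff.of_le (by simp))]
      simp [smul_sub]
    simp only [e]
    simpa using ENNReal.Tendsto.const_mul (a := ‖c‖ₑ) h2 (.inr enorm_ne_top)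

theorem MemW10.sub (hΩ : IsOpen Ω) {p : ℝ} (hp : 1 ≤ p) {u v : 𝔼 → ℝ} (hu : MemW10 p Ω u)
    (hv : MemW10 p Ω v) : MemW10 p Ω (fun x => u x - v x) := by
  simpa [sub_eq_add_neg] using hu.add hΩ hp (hv.const_mul hΩ hp (-1))

theorem MemW10.zero (hΩ : IsOpen Ω) (hb : Bornology.IsBounded Ω) {p : ℝ} (hp : 1 ≤ p) :
    MemW10 p Ω (fun _ => 0) := by
  have h := memW1_of_contDiff hΩ hb p (contDiff_const (c := (0 : ℝ)))
  refine (memW10_iff hΩ hp (hasWeakGradient_gradient contDiff_const) h.memLp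
    (memLp_of_continuous hb (continuous_gradient contDiff_const) _)).2 fun ε hε =>
    ⟨_, .zero, ?_, ?_⟩ <;> simp [lpNorm]

/-- `W^{1,p}_0` is closed in `W^{1,p}`. -/
theorem memW10_of_tendsto (hΩ : IsOpen Ω) (hb : Bornology.IsBounded Ω) {p : ℝ} (hp : 1 ≤ p)
    {u : ℕ → 𝔼 → ℝ} {v : 𝔼 → ℝ} {H : 𝔼 → 𝔼} (hu : ∀ k, MemW10 p Ω (u k))
    (hv : MemLp v (ENNReal.ofReal p) (volume.restrict Ω))
    (hH : MemLp H (ENNReal.ofReal p) (volume.restrict Ω))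
    (h1 : Tendsto (fun k => lpNorm p Ω (fun x => u k x - v x)) atTop (𝓝 0))
    (h2 : Tendsto (fun k => lpNorm p Ω (fun x => weakGrad Ω (u k) x - H x)) atTop (𝓝 0)) :
    HasWeakGradient Ω v H ∧ MemW10 p Ω v := by
  have hw : HasWeakGradient Ω v H := hasWeakGradient_of_tendsto hb hp
    (fun k => (hu k).1.hasWeakGradient) (fun k => (hu k).1.memLp) (fun k => (hu k).1.memLp_grad)
    hv hH h1 h2
  refine ⟨hw, (memW10_iff hΩ hp hw hv hH).2 fun ε hε => ?_⟩
  have hε2 : 0 < ε / 2 := ENNReal.half_pos hε.ne'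
  obtain ⟨k, hk1, hk2⟩ :=
    ((ENNReal.tendsto_nhds_zero.1 h1 _ hε2).and (ENNReal.tendsto_nhds_zero.1 h2 _ hε2)).exists
  obtain ⟨φ, hφ, a1, a2⟩ := (memW10_iff hΩ hp (hu k).1.hasWeakGradient (hu k).1.memLp
    (hu k).1.memLp_grad).1 (hu k) _ hε2
  have s1 := hφ.contDiff.of_le (m := 1) (by simp)
  refine ⟨φ, hφ, ?_, ?_⟩
  · rw [← ENNReal.add_halves ε]
    refine (lpNorm_sub_le_add hp hv.aestronglyMeasurable (hu k).1.memLp.aestronglyMeasurable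
      s1.continuous.aestronglyMeasurable).trans (add_le_add ?_ a1)
    rwa [lpNorm_sub_comm]
  · rw [← ENNReal.add_halves ε]
    refine (lpNorm_sub_le_add hp hH.aestronglyMeasurable (hu k).1.memLp_grad.aestronglyMeasurable
      (continuous_gradient s1).aestronglyMeasurable).trans (add_le_add ?_ a2)
    rwa [lpNorm_sub_comm]

/-! ### Surface measure versus volume -/

/-- The set `A + [0, δ] e` swept out by translating `A` in the direction `e`. -/
def tube (e : 𝔼) (δ : ℝ) (A : Set 𝔼) : Set 𝔼 :=
  {x | ∃ z ∈ A, ∃ t ∈ Set.Icc 0 δ, x = z + t • e}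

theorem tube_eq_image {e : 𝔼} {δ : ℝ} {A : Set 𝔼} :
    tube e δ A = (fun w : 𝔼 × ℝ => w.1 + w.2 • e) '' (A ×ˢ Set.Icc 0 δ) := by
  ext x
  constructor
  · rintro ⟨z, hz, t, ht, rfl⟩
    exact ⟨(z, t), ⟨hz, ht⟩, rfl⟩
  · rintro ⟨⟨z, t⟩, ⟨hz, ht⟩, rfl⟩
    exact ⟨z, hz, t, ht, rfl⟩

theorem isCompact_tube {e : 𝔼} {δ : ℝ} {A : Set 𝔼} (hA : IsCompact A) :
    IsCompact (tube e δ A) := by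
  rw [tube_eq_image]
  exact (hA.prod isCompact_Icc).image (by fun_prop)

/-- If `A` lies in a ball of radius `d ≤ δ`, then `⌊δ / d⌋ + 1` balls of radius `2 d` with centres
on a segment of direction `e` cover the tube over `A`. -/
theorem volume_tube_le_of_subset_closedBall (hn : n ≠ 0) {e : 𝔼} (he : ‖e‖ = 1) {δ d : ℝ}
    (hd : 0 < d) (hdδ : d ≤ δ) {A : Set 𝔼} {x : 𝔼} (hA : A ⊆ Metric.closedBall x d) :
    volume (tube e δ A) ≤
      ENNReal.ofReal (2 ^ (n + 1) * δ * d ^ (n - 1)) * volume (Metric.ball (0 : 𝔼) 1) := by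
  set N := ⌊δ / d⌋₊
  have hδ : 0 < δ := hd.trans_le hdδ
  have hsub : tube e δ A ⊆
      ⋃ k ∈ Finset.range (N + 1), Metric.closedBall (x + ((k : ℝ) * d) • e) (2 * d) := by
    rintro y ⟨z, hz, t, ht, rfl⟩
    have hk : ⌊t / d⌋₊ ≤ N := Nat.floor_mono (by gcongr; exact ht.2)
    refine Set.mem_biUnion (x := ⌊t / d⌋₊) (by simpa [Nat.lt_succ_iff] using hk) ?_
    rw [mem_closedBall_iff_norm]
    have h1 : (⌊t / d⌋₊ : ℝ) * d ≤ t := by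
      rw [← le_div_iff₀ hd]; exact Nat.floor_le (div_nonneg ht.1 hd.le)
    have h2 : t ≤ (⌊t / d⌋₊ : ℝ) * d + d := by
      have := (Nat.lt_floor_add_one (t / d)).le
      rw [div_le_iff₀ hd] at this
      linarith
    have e1 : z + t • e - (x + ((⌊t / d⌋₊ : ℝ) * d) • e)
        = (z - x) + (t - (⌊t / d⌋₊ : ℝ) * d) • e := by rw [sub_smul]; abel
    rw [e1]
    refine (norm_add_le _ _).trans ?_
    have h3 := mem_closedBall_iff_norm.1 (hA hz)
    rw [norm_smul, he, mul_one, Real.norm_eq_abs, abs_of_nonneg (by linarith)]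
    linarith
  refine (measure_mono hsub).trans ((measure_biUnion_finset_le _ _).trans ?_)
  simp only [Measure.addHaar_closedBall _ _ (by positivity : (0 : ℝ) ≤ 2 * d), Finset.sum_const,
    Finset.card_range, nsmul_eq_mul, finrank_euclideanSpace, Fintype.card_fin]
  rw [← mul_assoc]
  gcongr
  rw [← ENNReal.ofReal_natCast, ← ENNReal.ofReal_mul (by positivity)]
  apply ENNReal.ofReal_le_ofReal
  have hN : (N : ℝ) * d ≤ δ := by
    rw [← le_div_iff₀ hd]; exact Nat.floor_le (by positivity)
  obtain ⟨m, rfl⟩ := Nat.exists_eq_succ_of_ne_zero hn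
  simp only [Nat.succ_eq_add_one, Nat.add_sub_cancel]
  push_cast
  calc ((N : ℝ) + 1) * (2 * d) ^ (m + 1) = (N * d + d) * (2 ^ (m + 1) * d ^ m) := by ring
    _ ≤ (2 * δ) * (2 ^ (m + 1) * d ^ m) := by gcongr; linarith
    _ = _ := by ring

/-- The right-hand side is a multiple of the term that a set `A` of small diameter contributes to
the `(n-1)`-dimensional Hausdorff measure. -/
theorem volume_tube_le_ediam (hn : 2 ≤ n) {e : 𝔼} (he : ‖e‖ = 1) {δ : ℝ} (hδ : 0 < δ)
    {A : Set 𝔼} (hA : Metric.ediam A ≤ ENNReal.ofReal δ) :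
    volume (tube e δ A) ≤ ENNReal.ofReal (2 ^ (n + 1) * δ) * volume (Metric.ball (0 : 𝔼) 1) *
      ⨆ _ : A.Nonempty, Metric.ediam A ^ ((n - 1 : ℕ) : ℝ) := by
  rcases A.eq_empty_or_nonempty with rfl | hne
  · simp [tube]
  simp only [hne, ciSup_unique, ENNReal.rpow_natCast]
  obtain ⟨x, hx⟩ := hne
  have hfin : Metric.ediam A ≠ ⊤ := ne_top_of_le_ne_top ENNReal.ofReal_ne_top hA
  have hb : Bornology.IsBounded A := Metric.isBounded_iff_ediam_ne_top.2 hfin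
  have hd0 : Metric.diam A ≤ δ := ENNReal.toReal_le_of_le_ofReal hδ.le hA
  have hed : Metric.ediam A = ENNReal.ofReal (Metric.diam A) := (ENNReal.ofReal_toReal hfin).symm
  have key : ∀ d, 0 < d → d ≤ δ → Metric.diam A ≤ d → volume (tube e δ A) ≤
      ENNReal.ofReal (2 ^ (n + 1) * δ) * volume (Metric.ball (0 : 𝔼) 1) *
        ENNReal.ofReal d ^ (n - 1) := by
    intro d h1 h2 h3
    refine (volume_tube_le_of_subset_closedBall (by omega) he h1 h2 (x := x) fun y hy => ?_).trans
      (le_of_eq ?_)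
    · exact (Metric.dist_le_diam_of_mem hb hy hx).trans h3
    · rw [ENNReal.ofReal_mul (by positivity), ENNReal.ofReal_pow h1.le]
      ring
  rcases (Metric.diam_nonneg (s := A)).eq_or_lt with h0 | h0
  -- if the diameter vanishes, radii `d → 0` have to be used in place of `diam A`
  · rw [hed, ← h0]
    have hlim : Tendsto (fun d : ℝ => ENNReal.ofReal (2 ^ (n + 1) * δ) *
        volume (Metric.ball (0 : 𝔼) 1) * ENNReal.ofReal d ^ (n - 1)) (𝓝[>] 0)
        (𝓝 (ENNReal.ofReal (2 ^ (n + 1) * δ) *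
        volume (Metric.ball (0 : 𝔼) 1) * ENNReal.ofReal 0 ^ (n - 1))) := by
      refine ENNReal.Tendsto.const_mul ?_ (.inr ?_)
      · have hcont := (ENNReal.continuous_pow (n - 1)).comp ENNReal.continuous_ofReal
        exact hcont.continuousAt.tendsto.mono_left nhdsWithin_le_nhds
      · exact ENNReal.mul_ne_top ENNReal.ofReal_ne_top measure_ball_lt_top.ne
    refine ge_of_tendsto hlim ?_
    filter_upwards [Ioc_mem_nhdsGT hδ] with d hd
    exact key d hd.1 hd.2 (h0 ▸ hd.1.le)
  · rw [hed]
    exact key _ h0 hd0 le_rfl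

/-- The volume of `A + [0, δ] e` is controlled by the surface measure of `A`, for every set `A`. -/
theorem exists_volume_tube_le (hn : 2 ≤ n) : ∃ C : ℝ≥0, ∀ (e : 𝔼), ‖e‖ = 1 → ∀ δ : ℝ, 0 < δ →
    ∀ A : Set 𝔼, volume (tube e δ A) ≤ C * ENNReal.ofReal δ * μHE[n - 1] A := by
  -- `μHE[n - 1]` is `c` times the Hausdorff measure `μH[n - 1]`
  set c := Measure.addHaarScalarFactor (volume : Measure (EuclideanSpace ℝ (Fin (n - 1))))
    μH[(n - 1 : ℕ)]
  have hc : c ≠ 0 := Measure.addHaarScalarFactor_volume_hausdorffMeasure_ne_zero (n - 1)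
  set β := volume (Metric.ball (0 : 𝔼) 1)
  have hβ : β ≠ ⊤ := measure_ball_lt_top.ne
  refine ⟨2 ^ (n + 1) * β.toNNReal * c⁻¹, fun e he δ hδ A => ?_⟩
  -- both sides are countably subadditive in `A`, so it suffices to treat the small sets of a
  -- covering
  have main : volume (tube e δ A) ≤
      ENNReal.ofReal (2 ^ (n + 1) * δ) * β * μH[(n - 1 : ℕ)] A := by
    rw [Measure.hausdorffMeasure_apply]
    simp only [ENNReal.mul_iSup]
    refine le_iSup₂_of_le (ENNReal.ofReal δ) (by simpa using hδ) ?_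
    have hfin : ENNReal.ofReal (2 ^ (n + 1) * δ) * β ≠ ⊤ :=
      ENNReal.mul_ne_top ENNReal.ofReal_ne_top hβ
    have h0 : ENNReal.ofReal (2 ^ (n + 1) * δ) * β ≠ 0 :=
      mul_ne_zero (by simp; positivity) (Metric.measure_ball_pos volume _ one_pos).ne'
    simp only [ENNReal.mul_iInf_of_ne h0 hfin]
    refine le_iInf fun t => le_iInf fun hsub => le_iInf fun ht => ?_
    calc volume (tube e δ A) ≤ volume (⋃ k, tube e δ (t k)) := by
          refine measure_mono ?_
          rintro x ⟨z, hz, s, hs, rfl⟩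
          obtain ⟨k, hk⟩ := Set.mem_iUnion.1 (hsub hz)
          exact Set.mem_iUnion.2 ⟨k, z, hk, s, hs, rfl⟩
      _ ≤ ∑' k, volume (tube e δ (t k)) := measure_iUnion_le _
      _ ≤ _ := by
          rw [← ENNReal.tsum_mul_left]
          exact ENNReal.tsum_le_tsum fun k => volume_tube_le_ediam hn he hδ (ht k)
  refine main.trans (le_of_eq ?_)
  have e1 : (μHE[n - 1] : Measure 𝔼) A = c * μH[(n - 1 : ℕ)] A := by
    rw [Measure.euclideanHausdorffMeasure_def]
    rfl
  rw [e1]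
  push_cast
  rw [ENNReal.coe_toNNReal hβ, ENNReal.ofReal_mul (by positivity), ENNReal.coe_inv hc]
  have h2 : ENNReal.ofReal (2 ^ (n + 1)) = 2 ^ (n + 1) := by
    rw [ENNReal.ofReal_pow (by norm_num)]; simp
  rw [h2]
  calc _ = 2 ^ (n + 1) * ENNReal.ofReal δ * β * 1 * μH[(n - 1 : ℕ)] A := by ring
    _ = 2 ^ (n + 1) * ENNReal.ofReal δ * β * ((c : ℝ≥0∞)⁻¹ * c) * μH[(n - 1 : ℕ)] A := by
        rw [ENNReal.inv_mul_cancel (by simpa using hc) ENNReal.coe_ne_top]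
    _ = _ := by ring

/-- If lines in the direction `e` meet the compact set `A` transversally, then the surface
measure of `A` is controlled by the volume of `A + [0, δ] e`. -/
theorem ofReal_mul_surface_le_volume_tube {c : ℝ≥0} (hc : 0 < c) {e : 𝔼} (he : ‖e‖ = 1) {δ : ℝ}
    {A : Set 𝔼} (hA : IsCompact A)
    (htr : ∀ z ∈ A, ∀ z' ∈ A, ∀ t : ℝ, c * ‖z' - z‖ ≤ ‖z' - z - t • e‖) :
    ENNReal.ofReal δ * μHE[n - 1] A ≤ (c⁻¹ : ℝ≥0) ^ (n - 1) * volume (tube e δ A) := by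
  set S : Submodule ℝ 𝔼 := ℝ ∙ e
  have he0 : e ≠ 0 := by rintro rfl; simp at he
  have hS : Module.finrank ℝ S = 1 := finrank_span_singleton he0
  have hSo : Module.finrank ℝ Sᗮ = n - 1 := by
    have := S.finrank_add_finrank_orthogonal
    rw [hS, finrank_euclideanSpace, Fintype.card_fin] at this
    omega
  set π := Sᗮ.orthogonalProjectionOnto
  have hS_proj : ∀ x : 𝔼, (S.orthogonalProjectionOnto x : 𝔼) = inner ℝ e x • e := fun x =>
    Submodule.starProjection_unit_singleton ℝ he x
  have hdec : ∀ x : 𝔼, (π x : 𝔼) = x - inner ℝ e x • e := by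
    intro x
    rw [← hS_proj]
    exact Submodule.starProjection_orthogonal_val x
  -- by transversality, the projection `π` to `e^⊥` has a Lipschitz inverse on `A`
  have hanti : AntilipschitzWith c⁻¹ (fun z : A => π z) := by
    refine AntilipschitzWith.of_le_mul_dist fun z z' => ?_
    have := htr z' z'.2 z z.2 (inner ℝ e ((z : 𝔼) - z'))
    rw [← hdec, ← dist_eq_norm] at this
    rw [NNReal.coe_inv, inv_mul_eq_div, le_div_iff₀ (by exact_mod_cast hc), mul_comm]
    rw [dist_eq_norm (π z), ← map_sub]
    exact this
  have h1 : (μHE[n - 1] : Measure 𝔼) A ≤ (c⁻¹ : ℝ≥0) ^ (n - 1) * volume (π '' A) := by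
    have e1 : (volume : Measure Sᗮ) (π '' A) = μHE[n - 1] (π '' A) := by
      rw [← InnerProductSpace.euclideanHausdorffMeasure_eq_volume, hSo]
    have e2 : π '' A = (fun z : A => π z) '' Set.univ := by
      ext y; simp
    have e3 := hanti.le_hausdorffMeasure_image (d := ((n - 1 : ℕ) : ℝ)) (by positivity) Set.univ
    have e4 := (isometry_subtype_coe (s := A)).hausdorffMeasure_image (d := ((n - 1 : ℕ) : ℝ))
      (.inl (by positivity)) Set.univ
    rw [Set.image_univ, Subtype.range_coe] at e4
    rw [← e4, ← e2, ENNReal.rpow_natCast] at e3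
    rw [e1, Measure.euclideanHausdorffMeasure_def, Measure.euclideanHausdorffMeasure_def]
    simp only [Measure.smul_apply, ENNReal.smul_def, smul_eq_mul]
    rw [← mul_assoc, mul_comm (((c⁻¹ : ℝ≥0) : ℝ≥0∞) ^ (n - 1)), mul_assoc]
    gcongr
  -- Fubini: over each point of `π A`, the tube contains a segment of length `δ`
  have h2 : ENNReal.ofReal δ * volume (π '' A) ≤ volume (tube e δ A) := by
    have hmp := (S.measurePreserving_measurableEquivProd (0 : 𝔼)).symm
    rw [InnerProductSpace.euclideanHausdorffMeasure_eq_volume] at hmp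
    have hmt : MeasurableSet (tube e δ A) := (isCompact_tube hA).measurableSet
    rw [← hmp.measure_preimage_equiv, Measure.volume_eq_prod,
      Measure.prod_apply_symm (((S.measurableEquivProd (0 : 𝔼)).symm.measurable) hmt)]
    have hmπ : MeasurableSet (π '' A) := (hA.image π.continuous).measurableSet
    rw [← setLIntegral_const, ← lintegral_indicator hmπ]
    refine lintegral_mono fun y => ?_
    by_cases hy : y ∈ π '' A
    · rw [Set.indicator_of_mem hy]
      obtain ⟨z, hz, rfl⟩ := hy
      have hI : volume (Set.Icc (inner ℝ e z) (inner ℝ e z + δ)) = ENNReal.ofReal δ := by simp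
      rw [← hI,
        ← (LinearIsometryEquiv.toSpanUnitSingleton e he).symm.measurePreserving.measure_preimage
        measurableSet_Icc.nullMeasurableSet]
      refine measure_mono fun s hs => ?_
      obtain ⟨t, rfl⟩ := (LinearIsometryEquiv.toSpanUnitSingleton e he).surjective s
      simp only [Set.mem_preimage, LinearIsometryEquiv.symm_apply_apply] at hs
      refine ⟨z, hz, t - inner ℝ e z, ⟨by linarith [hs.1], by linarith [hs.2]⟩, ?_⟩
      simp only [Submodule.measurableEquivProd_symm_apply, hdec,
        LinearIsometryEquiv.toSpanUnitSingleton_apply, vadd_eq_add, add_zero, sub_smul]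
      exact (add_sub_left_comm _ _ _)
    · rw [Set.indicator_of_notMem hy]
      exact zero_le
  calc _ ≤ ENNReal.ofReal δ * ((c⁻¹ : ℝ≥0) ^ (n - 1) * volume (π '' A)) := by gcongr
    _ = (c⁻¹ : ℝ≥0) ^ (n - 1) * (ENNReal.ofReal δ * volume (π '' A)) := by ring
    _ ≤ _ := by gcongr

/-! ### Estimates along lines -/

theorem lintegral_rpow_le_measure_univ_mul {Y : Type*} [MeasurableSpace Y] (ν : Measure Y)
    {F : Y → ℝ≥0∞} (hF : Measurable F) {p : ℝ} (hp : 1 ≤ p) :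
    (∫⁻ y, F y ∂ν) ^ p ≤ ν Set.univ ^ (p - 1) * ∫⁻ y, F y ^ p ∂ν := by
  have hp0 : 0 < p := by linarith
  have h := eLpNorm'_le_eLpNorm'_mul_rpow_measure_univ (μ := ν) (f := F) one_pos hp
    hF.aestronglyMeasurable
  simp only [eLpNorm', enorm_eq_self, ENNReal.rpow_one, div_one] at h
  refine (ENNReal.rpow_le_rpow h hp0.le).trans (le_of_eq ?_)
  rw [ENNReal.mul_rpow_of_nonneg _ _ hp0.le, ← ENNReal.rpow_mul, ← ENNReal.rpow_mul,
    one_div_mul_cancel hp0.ne', ENNReal.rpow_one, sub_mul, one_div_mul_cancel hp0.ne', one_mul,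
    mul_comm]

/-- Jensen's inequality for averages, integrated. -/
theorem lintegral_rpow_lintegral_le {X Y : Type*} [MeasurableSpace X] [MeasurableSpace Y]
    (μ : Measure X) [SFinite μ] (ν : Measure Y) [SFinite ν] {F : X → Y → ℝ≥0∞}
    (hF : Measurable (Function.uncurry F)) {p : ℝ} (hp : 1 ≤ p) :
    ∫⁻ x, (∫⁻ y, F x y ∂ν) ^ p ∂μ ≤ ν Set.univ ^ (p - 1) * ∫⁻ y, ∫⁻ x, F x y ^ p ∂μ ∂ν := by
  have hm : Measurable fun x => ∫⁻ y, F x y ^ p ∂ν := (hF.pow_const p).lintegral_prod_right'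
  rw [← lintegral_lintegral_swap (hF.pow_const p).aemeasurable, ← lintegral_const_mul _ hm]
  exact lintegral_mono fun x => lintegral_rpow_le_measure_univ_mul ν (hF.of_uncurry_left) hp

/-- The part of `Ω` from which one leaves `Ω` within distance `δ` in the direction `-e`. -/
def exitStrip (Ω : Set 𝔼) (e : 𝔼) (δ : ℝ) : Set 𝔼 :=
  {x | x ∈ Ω ∧ ∃ t ∈ Set.Icc 0 δ, x - t • e ∉ Ω}

theorem exitStrip_subset (Ω : Set 𝔼) (e : 𝔼) (δ : ℝ) : exitStrip Ω e δ ⊆ Ω := fun _ h => h.1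

open scoped Pointwise in
theorem measurableSet_exitStrip (hΩ : IsOpen Ω) (e : 𝔼) (δ : ℝ) :
    MeasurableSet (exitStrip Ω e δ) := by
  have h : exitStrip Ω e δ = Ω ∩ (Ωᶜ + (fun t : ℝ => t • e) '' Set.Icc 0 δ) := by
    ext x
    simp only [exitStrip, Set.mem_ofPred_eq, Set.mem_inter_iff, Set.mem_add, Set.mem_image]
    refine and_congr_right fun _ => ⟨?_, ?_⟩
    · rintro ⟨t, ht, hx⟩
      exact ⟨x - t • e, hx, t • e, ⟨t, ht, rfl⟩, by simp⟩
    · rintro ⟨z, hz, -, ⟨t, ht, rfl⟩, rfl⟩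
      exact ⟨t, ht, by simpa using hz⟩
  rw [h]
  refine hΩ.measurableSet.inter ?_
  exact (hΩ.isClosed_compl.add_right_of_isCompact
    (isCompact_Icc.image (by fun_prop))).measurableSet

/-- The fundamental theorem of calculus along a segment. -/
theorem enorm_sub_le_lintegral_gradient {v : 𝔼 → ℝ} (hv : ContDiff ℝ 1 v) {e : 𝔼} (he : ‖e‖ = 1)
    (x : 𝔼) {s : ℝ} (hs : 0 ≤ s) :
    ‖v x - v (x - s • e)‖ₑ ≤ ∫⁻ t in Set.Ioc 0 s, ‖gradient v (x - t • e)‖ₑ := by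
  have hd : ∀ t : ℝ, HasDerivAt (fun t : ℝ => v (x - t • e)) (fderiv ℝ v (x - t • e) (-e)) t := by
    intro t
    have h1 : HasDerivAt (fun t : ℝ => x - t • e) (-e) t := by
      simpa using ((hasDerivAt_id t).smul_const e).const_sub x
    exact ((hv.differentiable one_ne_zero _).hasFDerivAt).comp_hasDerivAt t h1
  have hc : Continuous fun t : ℝ => fderiv ℝ v (x - t • e) (-e) :=
    ((hv.continuous_fderiv one_ne_zero).comp (by fun_prop)).clm_apply continuous_const
  have hint := intervalIntegral.integral_eq_sub_of_hasDerivAt (a := 0) (b := s)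
    (fun t _ => hd t) (hc.intervalIntegrable _ _)
  simp only [zero_smul, sub_zero] at hint
  rw [← enorm_neg, neg_sub, ← hint, intervalIntegral.integral_of_le hs]
  refine (enorm_integral_le_lintegral_enorm _).trans (lintegral_mono fun t => ?_)
  refine enorm_le_iff_norm_le.2 ?_
  rw [norm_gradient]
  refine ((fderiv ℝ v (x - t • e)).le_opNorm _).trans ?_
  simp [he]

/-- From a point of the exit strip, the first boundary point met in the direction `-e`. -/
theorem exists_first_exit (hΩ : IsOpen Ω) {e : 𝔼} {δ : ℝ} {x : 𝔼} (hx : x ∈ exitStrip Ω e δ) :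
    ∃ s ∈ Set.Icc 0 δ, x - s • e ∈ frontier Ω ∧
      ∀ t ∈ Set.Ico 0 s, x - t • e ∈ exitStrip Ω e δ := by
  obtain ⟨hxΩ, t₀, ht₀, hxt⟩ := hx
  set S : Set ℝ := Set.Icc 0 δ ∩ (fun t : ℝ => x - t • e) ⁻¹' Ωᶜ
  have hS : IsCompact S :=
    isCompact_Icc.inter_right (hΩ.isClosed_compl.preimage (by fun_prop))
  obtain ⟨s, hsS, hmin⟩ := hS.exists_isLeast ⟨t₀, ht₀, hxt⟩
  have hin : ∀ t ∈ Set.Ico 0 s, x - t • e ∈ Ω := by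
    intro t ht
    by_contra hcon
    exact absurd (hmin ⟨⟨ht.1, ht.2.le.trans hsS.1.2⟩, hcon⟩) (not_le.2 ht.2)
  have hs0 : 0 < s := by
    refine lt_of_le_of_ne hsS.1.1 ?_
    rintro rfl
    exact hsS.2 (by simpa using hxΩ)
  refine ⟨s, hsS.1, ?_, fun t ht => ⟨hin t ht, s - t, ⟨by linarith [ht.2], by
    linarith [ht.1, hsS.1.2]⟩, ?_⟩⟩
  · rw [hΩ.frontier_eq]
    refine ⟨?_, hsS.2⟩
    have hlim : Tendsto (fun t : ℝ => x - t • e) (𝓝[<] s) (𝓝 (x - s • e)) :=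
      ((by fun_prop : Continuous fun t : ℝ => x - t • e).tendsto s).mono_left nhdsWithin_le_nhds
    refine mem_closure_of_tendsto hlim ?_
    filter_upwards [Ioo_mem_nhdsLT hs0] with t ht
    exact hin t ⟨ht.1.le, ht.2⟩
  · have : x - t • e - (s - t) • e = x - s • e := by rw [sub_smul]; abel
    rw [this]
    exact hsS.2

/-- The total variation of `v` along the part in `U` of the segment of length `δ` that starts at `x`
in the direction `-e`. -/
noncomputable def lineVariation (v : 𝔼 → ℝ) (e : 𝔼) (δ : ℝ) (U : Set 𝔼) (x : 𝔼) : ℝ≥0∞ :=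
  ∫⁻ t in Set.Ioc 0 δ, U.indicator (fun y => ‖gradient v y‖ₑ) (x - t • e)

theorem measurable_indicator_gradient {v : 𝔼 → ℝ} (hv : ContDiff ℝ 1 v) {U : Set 𝔼}
    (hU : MeasurableSet U) : Measurable (U.indicator fun y => ‖gradient v y‖ₑ) :=
  ((continuous_gradient hv).measurable.enorm).indicator hU

theorem measurable_lineVariation {v : 𝔼 → ℝ} (hv : ContDiff ℝ 1 v) (e : 𝔼) (δ : ℝ) {U : Set 𝔼}
    (hU : MeasurableSet U) : Measurable (lineVariation v e δ U) := by
  have : Measurable (Function.uncurry fun (x : 𝔼) (t : ℝ) =>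
      U.indicator (fun y => ‖gradient v y‖ₑ) (x - t • e)) :=
    (measurable_indicator_gradient hv hU).comp
      (by fun_prop : Continuous fun w : 𝔼 × ℝ => w.1 - w.2 • e).measurable
  exact this.lintegral_prod_right'

/-- Jensen's inequality, Fubini's theorem and the translation invariance of volume. -/
theorem lintegral_lineVariation_rpow_le {v : 𝔼 → ℝ} (hv : ContDiff ℝ 1 v) (e : 𝔼) {δ : ℝ}
    (hδ : 0 < δ) {U : Set 𝔼} (hU : MeasurableSet U) {p : ℝ} (hp : 1 ≤ p) :
    ∫⁻ x, lineVariation v e δ U x ^ p ≤ ENNReal.ofReal δ ^ p * ∫⁻ x in U, ‖gradient v x‖ₑ ^ p := by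
  have hp0 : 0 < p := by linarith
  have hm : Measurable (Function.uncurry fun (x : 𝔼) (t : ℝ) =>
      U.indicator (fun y => ‖gradient v y‖ₑ) (x - t • e)) :=
    (measurable_indicator_gradient hv hU).comp
      (by fun_prop : Continuous fun w : 𝔼 × ℝ => w.1 - w.2 • e).measurable
  refine (lintegral_rpow_lintegral_le volume (volume.restrict (Set.Ioc 0 δ)) hm hp).trans
    (le_of_eq ?_)
  have h1 : ∀ t : ℝ, ∫⁻ x, U.indicator (fun y => ‖gradient v y‖ₑ) (x - t • e) ^ p
      = ∫⁻ x in U, ‖gradient v x‖ₑ ^ p := by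
    intro t
    rw [lintegral_sub_right_eq_self (fun x => U.indicator (fun y => ‖gradient v y‖ₑ) x ^ p),
      ← lintegral_indicator hU]
    congr 1 with x
    by_cases hx : x ∈ U <;> simp [hx, hp0]
  simp only [h1, lintegral_const, Measure.restrict_apply, MeasurableSet.univ, Set.univ_inter,
    Real.volume_Ioc, sub_zero]
  have hne : ENNReal.ofReal δ ≠ 0 := by simpa using hδ
  rw [mul_comm (∫⁻ x in U, ‖gradient v x‖ₑ ^ p), ← mul_assoc]
  congr 1
  nth_rw 2 [← ENNReal.rpow_one (ENNReal.ofReal δ)]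
  rw [← ENNReal.rpow_add _ _ hne ENNReal.ofReal_ne_top, sub_add_cancel]

/-- A function is compared at `x` with its value at the point `z` where the line through `x` in the
direction `-e` first leaves `Ω`; the segment in between stays in the exit strip. -/
theorem exists_enorm_le_add_lineVariation (hΩ : IsOpen Ω) {v : 𝔼 → ℝ} (hv : ContDiff ℝ 1 v)
    {e : 𝔼} (he : ‖e‖ = 1) {δ : ℝ} {x : 𝔼} (hx : x ∈ exitStrip Ω e δ) :
    ∃ z ∈ frontier Ω, ∃ s ∈ Set.Icc 0 δ, x = z + s • e ∧
      ‖v x‖ₑ ≤ ‖v z‖ₑ + lineVariation v e δ (exitStrip Ω e δ) x := by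
  obtain ⟨s, hs, hz, hin⟩ := exists_first_exit hΩ hx
  refine ⟨x - s • e, hz, s, hs, by simp, ?_⟩
  have h1 : ‖v x‖ₑ ≤ ‖v (x - s • e)‖ₑ + ‖v x - v (x - s • e)‖ₑ := by
    refine le_trans (le_of_eq ?_) (enorm_add_le _ _)
    simp
  refine h1.trans (add_le_add le_rfl ((enorm_sub_le_lintegral_gradient hv he x hs.1).trans ?_))
  rw [lineVariation, setLIntegral_congr (Ioo_ae_eq_Ioc (a := (0 : ℝ)) (b := s)).symm]
  calc ∫⁻ t in Set.Ioo 0 s, ‖gradient v (x - t • e)‖ₑ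
      = ∫⁻ t in Set.Ioo 0 s,
          (exitStrip Ω e δ).indicator (fun y => ‖gradient v y‖ₑ) (x - t • e) :=
        setLIntegral_congr_fun measurableSet_Ioo fun t ht => by
          simp only [Set.indicator_of_mem (hin t ⟨ht.1.le, ht.2⟩)]
    _ ≤ _ := lintegral_mono_set
        (Set.Ioo_subset_Ioc_self.trans (Set.Ioc_subset_Ioc_right hs.2))

/-- The strip estimate: where `Ω` is left within distance `δ`, a function is controlled by its
boundary values and its gradient. The constant depends on the dimension only.

With `h` the variation of `v` along lines, `|v| ≤ k + h` for `k = (|v| - h)⁺`. The term `h` is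
bounded by the gradient, and `|v|` dominates `k` at the boundary point reached in the direction
`-e`, so that the superlevel sets of `k` are contained in tubes over those of `|v|` on the boundary.
-/
theorem exists_eLpNorm_exitStrip_le (hn : 2 ≤ n) : ∃ C : ℝ≥0, ∀ (Ω : Set 𝔼), IsOpen Ω →
    ∀ (e : 𝔼), ‖e‖ = 1 → ∀ δ : ℝ, 0 < δ → ∀ p : ℝ, 1 ≤ p → ∀ v : 𝔼 → ℝ, ContDiff ℝ 1 v →
      lpNorm p (exitStrip Ω e δ) v ≤
        (C * ENNReal.ofReal δ) ^ (1 / p) * boundaryNorm p Ω v +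
          ENNReal.ofReal δ * lpNorm p (exitStrip Ω e δ) (gradient v) := by
  obtain ⟨C, hC⟩ := exists_volume_tube_le hn
  refine ⟨C, fun Ω hΩ e he δ hδ p hp v hv => ?_⟩
  set U := exitStrip Ω e δ with hUdef
  have hU : MeasurableSet U := measurableSet_exitStrip hΩ e δ
  have hp0 : 0 < p := by linarith
  have hP : ENNReal.ofReal p ≠ 0 := by simpa using hp0
  have hPr : (ENNReal.ofReal p).toReal = p := ENNReal.toReal_ofReal hp0.le
  set h := lineVariation v e δ U
  have hh : Measurable h := measurable_lineVariation hv e δ hU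
  -- the subtraction of extended nonnegative reals is truncated at `0`
  set k : 𝔼 → ℝ≥0∞ := fun x => ‖v x‖ₑ - h x
  have hvm : Measurable fun x => ‖v x‖ₑ := hv.continuous.measurable.enorm
  have hk : Measurable k := hvm.sub hh
  have hkfin : ∀ x, k x ≠ ⊤ := fun x => ne_top_of_le_ne_top enorm_ne_top tsub_le_self
  -- the superlevel sets of `k` are swept out by those of `v` on the boundary
  have hlevel : ∀ t : ℝ, 0 < t → volume.restrict U {x | t < (k x).toReal} ≤
      C * ENNReal.ofReal δ * surfaceMeasure Ω {x | t < |v x|} := by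
    intro t ht
    rw [surfaceMeasure, Measure.restrict_apply
        (measurableSet_lt measurable_const hv.continuous.abs.measurable),
      Measure.restrict_apply (measurableSet_lt measurable_const hk.ennreal_toReal)]
    refine le_trans (measure_mono ?_) (hC e he δ hδ _)
    rintro x ⟨hx1, hx2⟩
    obtain ⟨z, hz, s, hs, hxz, hle⟩ := exists_enorm_le_add_lineVariation hΩ hv he hx2
    refine ⟨z, ⟨?_, hz⟩, s, hs, hxz⟩
    have h3 : k x ≤ ‖v z‖ₑ := tsub_le_iff_right.2 hle
    have h4 : (k x).toReal ≤ |v z| := by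
      have := ENNReal.toReal_mono enorm_ne_top h3
      simpa using this
    exact lt_of_lt_of_le hx1 h4
  -- the layer cake formula turns the estimate of superlevel sets into one of integrals
  have hkint : ∫⁻ x in U, k x ^ p ≤
      C * ENNReal.ofReal δ * ∫⁻ x, ‖v x‖ₑ ^ p ∂(surfaceMeasure Ω) := by
    have e1 : ∀ x, k x ^ p = ENNReal.ofReal ((k x).toReal ^ p) := fun x => by
      rw [← ENNReal.ofReal_rpow_of_nonneg ENNReal.toReal_nonneg hp0.le,
        ENNReal.ofReal_toReal (hkfin x)]
    have e2 : ∀ x, ‖v x‖ₑ ^ p = ENNReal.ofReal (|v x| ^ p) := fun x => by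
      rw [← ENNReal.ofReal_rpow_of_nonneg (abs_nonneg _) hp0.le, ← Real.enorm_eq_ofReal_abs]
    simp only [e1, e2]
    rw [lintegral_rpow_eq_lintegral_meas_lt_mul _ (.of_forall fun x => ENNReal.toReal_nonneg)
        hk.ennreal_toReal.aemeasurable hp0,
      lintegral_rpow_eq_lintegral_meas_lt_mul _ (.of_forall fun x => abs_nonneg _)
        hv.continuous.abs.measurable.aemeasurable hp0, mul_left_comm,
      ← lintegral_const_mul' _ _ (ENNReal.mul_ne_top ENNReal.coe_ne_top ENNReal.ofReal_ne_top)]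
    refine mul_le_mul_right (setLIntegral_mono' measurableSet_Ioi fun t ht => ?_) _
    rw [← mul_assoc]
    gcongr
    exact hlevel t ht
  rw [lpNorm, lpNorm, boundaryNorm, eLpNorm_eq_lintegral_rpow_enorm_toReal hP ENNReal.ofReal_ne_top,
    eLpNorm_eq_lintegral_rpow_enorm_toReal hP ENNReal.ofReal_ne_top,
    eLpNorm_eq_lintegral_rpow_enorm_toReal hP ENNReal.ofReal_ne_top, hPr]
  calc (∫⁻ x in U, ‖v x‖ₑ ^ p) ^ (1 / p) ≤ (∫⁻ x in U, ((k + h) x) ^ p) ^ (1 / p) := by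
        gcongr with x
        exact le_tsub_add
    _ ≤ (∫⁻ x in U, k x ^ p) ^ (1 / p) + (∫⁻ x in U, h x ^ p) ^ (1 / p) :=
        ENNReal.lintegral_Lp_add_le hk.aemeasurable hh.aemeasurable hp
    _ ≤ (C * ENNReal.ofReal δ * ∫⁻ x, ‖v x‖ₑ ^ p ∂(surfaceMeasure Ω)) ^ (1 / p) +
        (ENNReal.ofReal δ ^ p * ∫⁻ x in U, ‖gradient v x‖ₑ ^ p) ^ (1 / p) := by
        gcongr
        exact (setLIntegral_le_lintegral _ _).trans (lintegral_lineVariation_rpow_le hv e hδ hU hp)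
    _ = _ := by
        rw [ENNReal.mul_rpow_of_nonneg (_ * _) _ (by positivity),
          ENNReal.mul_rpow_of_nonneg (_ ^ p) _ (by positivity), ← ENNReal.rpow_mul,
          mul_one_div_cancel hp0.ne', ENNReal.rpow_one]

/-! ### Friedrichs' inequality -/

theorem exists_norm_eq_one (hn : 2 ≤ n) : ∃ e : 𝔼, ‖e‖ = 1 :=
  ⟨EuclideanSpace.single ⟨0, by omega⟩ 1, by simp⟩

/-- Friedrichs' inequality for smooth functions: the exit strip of width exceeding the diameter is
all of `Ω`. -/
theorem exists_lpNorm_le_of_contDiff (hn : 2 ≤ n) (hΩ : IsOpen Ω) (hb : Bornology.IsBounded Ω)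
    {p : ℝ} (hp : 1 ≤ p) : ∃ C : ℝ≥0, ∀ v : 𝔼 → ℝ, ContDiff ℝ 1 v →
      lpNorm p Ω v ≤ C * (boundaryNorm p Ω v + lpNorm p Ω (gradient v)) := by
  obtain ⟨C, hC⟩ := exists_eLpNorm_exitStrip_le hn
  obtain ⟨e, he⟩ := exists_norm_eq_one hn
  set δ : ℝ := Metric.diam Ω + 1
  have hδ : 0 < δ := by have := Metric.diam_nonneg (s := Ω); positivity
  have hU : exitStrip Ω e δ = Ω := by
    refine Set.Subset.antisymm (exitStrip_subset _ _ _) fun x hx => ⟨hx, δ, ⟨hδ.le, le_rfl⟩, ?_⟩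
    intro hcon
    have := Metric.dist_le_diam_of_mem hb hx hcon
    rw [dist_eq_norm, sub_sub_cancel, norm_smul, he, mul_one, Real.norm_of_nonneg hδ.le] at this
    linarith
  have hf1 : (C * ENNReal.ofReal δ) ^ (1 / p) ≠ ⊤ :=
    ENNReal.rpow_ne_top_of_nonneg (by positivity)
      (ENNReal.mul_ne_top ENNReal.coe_ne_top ENNReal.ofReal_ne_top)
  refine ⟨((C * ENNReal.ofReal δ) ^ (1 / p)).toNNReal + δ.toNNReal, fun v hv => ?_⟩
  have h := hC Ω hΩ e he δ hδ p hp v hv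
  rw [hU] at h
  refine h.trans ?_
  rw [ENNReal.coe_add, ENNReal.coe_toNNReal hf1, mul_add]
  gcongr
  · exact le_self_add
  · exact le_add_self

theorem boundaryNorm_of_isTestFunction (hΩ : IsOpen Ω) {p : ℝ} {φ : 𝔼 → ℝ}
    (hφ : IsTestFunction Ω φ) : boundaryNorm p Ω φ = 0 := by
  have : φ =ᵐ[surfaceMeasure Ω] 0 := by
    rw [surfaceMeasure, EventuallyEq, ae_restrict_iff' isClosed_frontier.measurableSet]
    refine .of_forall fun x hx => image_eq_zero_of_notMem_tsupport fun h => ?_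
    rw [hΩ.frontier_eq] at hx
    exact hx.2 (hφ.tsupport_subset h)
  rw [boundaryNorm, eLpNorm_congr_ae this, eLpNorm_zero]

/-- Friedrichs' inequality on `W^{1,p}`. -/
theorem exists_lpNorm_le_of_hasTrace (hn : 2 ≤ n) (hΩ : IsOpen Ω) (hb : Bornology.IsBounded Ω)
    {p : ℝ} (hp : 1 ≤ p) : ∃ C : ℝ≥0, ∀ u g : 𝔼 → ℝ, HasTrace p Ω u g →
      lpNorm p Ω u ≤ C * (boundaryNorm p Ω g + lpNorm p Ω (weakGrad Ω u)) := by
  obtain ⟨C, hC⟩ := exists_lpNorm_le_of_contDiff hn hΩ hb hp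
  refine ⟨C, fun u g hu => ?_⟩
  obtain ⟨hu1, hg, v, hv, h1, h2⟩ := hu
  obtain ⟨h3, h4⟩ := (tendsto_w1Norm_sub_smooth_iff hΩ hp hu1.hasWeakGradient hv).1 h1
  have hvc : ∀ k, ContDiff ℝ 1 (v k) := fun k => (hv k).of_le (by simp)
  have hle : ∀ k, lpNorm p Ω u ≤ lpNorm p Ω (fun x => u x - v k x) +
      C * ((boundaryNorm p Ω g + boundaryNorm p Ω (fun x => v k x - g x)) +
        (lpNorm p Ω (weakGrad Ω u) + lpNorm p Ω (fun x => weakGrad Ω u x - gradient (v k) x))) := by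
    intro k
    have a1 : lpNorm p Ω u ≤ lpNorm p Ω (fun x => u x - v k x) + lpNorm p Ω (v k) := by
      refine le_trans (le_of_eq ?_) (lpNorm_add_le hp
        (hu1.memLp.aestronglyMeasurable.sub (hvc k).continuous.aestronglyMeasurable)
        (hvc k).continuous.aestronglyMeasurable)
      simp
    have a2 : boundaryNorm p Ω (v k) ≤
        boundaryNorm p Ω g + boundaryNorm p Ω (fun x => v k x - g x) := by
      refine le_trans (le_of_eq ?_) (eLpNorm_add_le hg.aestronglyMeasurable
        ((hvc k).continuous.aestronglyMeasurable.sub hg.aestronglyMeasurable) (one_le_ofReal hp))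
      congr 1
      funext x
      simp
    have a3 : lpNorm p Ω (gradient (v k)) ≤ lpNorm p Ω (weakGrad Ω u) +
        lpNorm p Ω (fun x => weakGrad Ω u x - gradient (v k) x) := by
      rw [lpNorm_sub_comm (weakGrad Ω u)]
      refine le_trans (le_of_eq ?_) (lpNorm_add_le hp hu1.memLp_grad.aestronglyMeasurable
        ((continuous_gradient (hvc k)).aestronglyMeasurable.sub
          hu1.memLp_grad.aestronglyMeasurable))
      simp
    refine a1.trans (add_le_add le_rfl ((hC _ (hvc k)).trans ?_))
    gcongr
  have hlim : Tendsto (fun k => lpNorm p Ω (fun x => u x - v k x) +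
      C * ((boundaryNorm p Ω g + boundaryNorm p Ω (fun x => v k x - g x)) +
        (lpNorm p Ω (weakGrad Ω u) + lpNorm p Ω (fun x => weakGrad Ω u x - gradient (v k) x))))
      atTop (𝓝 (0 + C * ((boundaryNorm p Ω g + 0) + (lpNorm p Ω (weakGrad Ω u) + 0)))) :=
    h3.add (ENNReal.Tendsto.const_mul ((tendsto_const_nhds.add h2).add
      (tendsto_const_nhds.add h4)) (.inr ENNReal.coe_ne_top))
  simpa using ge_of_tendsto' hlim hle

theorem MemW10.hasTrace_zero (hΩ : IsOpen Ω) {p : ℝ} {u : 𝔼 → ℝ} (hu : MemW10 p Ω u) :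
    HasTrace p Ω u (fun _ => 0) := by
  obtain ⟨h, φ, hφ, hlim⟩ := hu
  refine ⟨h, MemLp.zero, φ, fun k => (hφ k).contDiff, hlim, ?_⟩
  have : ∀ k, boundaryNorm p Ω (fun x => φ k x - 0) = 0 := fun k => by
    simpa using boundaryNorm_of_isTestFunction hΩ (hφ k)
  simpa only [this] using tendsto_const_nhds

/-- Poincaré's inequality on `W^{1,p}_0`. -/
theorem exists_lpNorm_le_of_memW10 (hn : 2 ≤ n) (hΩ : IsOpen Ω) (hb : Bornology.IsBounded Ω)
    {p : ℝ} (hp : 1 ≤ p) : ∃ C : ℝ≥0, ∀ u : 𝔼 → ℝ, MemW10 p Ω u →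
      lpNorm p Ω u ≤ C * lpNorm p Ω (weakGrad Ω u) := by
  obtain ⟨C, hC⟩ := exists_lpNorm_le_of_hasTrace hn hΩ hb hp
  refine ⟨C, fun u hu => (hC u _ (hu.hasTrace_zero hΩ)).trans (le_of_eq ?_)⟩
  simp [boundaryNorm]

/-! ### The cone condition and the trace inequality -/

/-- The uniform cone condition near `z₀`: within the ball of radius `r` about `z₀`, the set `Ω` is
stable under translation by the vectors of the open cone around `e` with aperture `κ`. -/
structure ConeCondition (Ω : Set 𝔼) (z₀ e : 𝔼) (κ r : ℝ) : Prop where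
  norm_eq : ‖e‖ = 1
  aperture_pos : 0 < κ
  radius_pos : 0 < r
  mem_of_mem : ∀ x ∈ Ω ∩ Metric.ball z₀ r, ∀ y ∈ Metric.ball z₀ r, ∀ t : ℝ, 0 < t →
    ‖y - x - t • e‖ < κ * t → y ∈ Ω

/-- Moving by `t e + η` raises the height of a point by at least `t - |η|`, and the graph beneath it
by at most `2 L |η|`, so that the aperture `1 / (2 L + 1)` is admissible. -/
theorem IsBoundedLipschitzDomain.exists_coneCondition (hΩ : IsBoundedLipschitzDomain Ω) {z₀ : 𝔼}
    (hz₀ : z₀ ∈ frontier Ω) : ∃ e κ r, ConeCondition Ω z₀ e κ r := by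
  obtain ⟨e, γ, L, r, he, hγ, hr, h⟩ := hΩ.lipschitz_boundary z₀ hz₀
  have hL : (0 : ℝ) < 2 * L + 1 := by positivity
  refine ⟨e, 1 / (2 * L + 1), r, he, by positivity, hr, ?_⟩
  rintro x ⟨hx, hxr⟩ y hy t ht hxy
  rw [h x hxr] at hx
  rw [h y hy]
  set η := y - x - t • e with hη
  have h1 : inner ℝ e y = inner ℝ e x + t + inner ℝ e η := by
    have : y = x + t • e + η := by rw [hη]; abel
    rw [this, inner_add_right, inner_add_right, inner_smul_right, real_inner_self_eq_norm_sq, he]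
    ring
  have h2 : |inner ℝ e η| ≤ ‖η‖ := by simpa [he] using abs_real_inner_le_norm e η
  have h3 : dist (y - inner ℝ e y • e) (x - inner ℝ e x • e) ≤ 2 * ‖η‖ := by
    have : y - inner ℝ e y • e - (x - inner ℝ e x • e) = η - inner ℝ e η • e := by
      rw [h1, hη, add_smul, add_smul]; abel
    rw [dist_eq_norm, this]
    refine (norm_sub_le _ _).trans ?_
    rw [norm_smul, he, mul_one, Real.norm_eq_abs]
    linarith
  have h4 := hγ.dist_le_mul (y - inner ℝ e y • e) (x - inner ℝ e x • e)
  rw [Real.dist_eq] at h4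
  have h5 := (abs_le.1 h4).2
  have h6 := (abs_le.1 h2).1
  have h7 : (L : ℝ) * dist (y - inner ℝ e y • e) (x - inner ℝ e x • e) ≤ L * (2 * ‖η‖) := by
    gcongr
  rw [one_div_mul_eq_div, lt_div_iff₀ hL] at hxy
  nlinarith

theorem ConeCondition.mem_of_mem_closure {z₀ e : 𝔼} {κ r : ℝ} (h : ConeCondition Ω z₀ e κ r)
    {x y : 𝔼} (hx : x ∈ closure Ω) (hxr : x ∈ Metric.ball z₀ r) (hy : y ∈ Metric.ball z₀ r) {t : ℝ}
    (ht : 0 < t) (hxy : ‖y - x - t • e‖ < κ * t) : y ∈ Ω := by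
  have hopen : IsOpen {x' : 𝔼 | ‖y - x' - t • e‖ < κ * t} :=
    isOpen_lt (by fun_prop) continuous_const
  obtain ⟨x', ⟨hx'1, hx'2⟩, hx'Ω⟩ :=
    mem_closure_iff.1 hx _ (hopen.inter Metric.isOpen_ball) ⟨hxy, hxr⟩
  exact h.mem_of_mem x' ⟨hx'Ω, hx'2⟩ y hy t ht hx'1

/-- Two boundary points cannot differ by a vector of the open cone, since `Ω` would contain one of
them. -/
theorem ConeCondition.transversal (hΩ : IsOpen Ω) {z₀ e : 𝔼} {κ r : ℝ}
    (h : ConeCondition Ω z₀ e κ r) {z z' : 𝔼} (hz : z ∈ frontier Ω) (hzr : z ∈ Metric.ball z₀ r)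
    (hz' : z' ∈ frontier Ω) (hzr' : z' ∈ Metric.ball z₀ r) (t : ℝ) :
    κ / (1 + κ) * ‖z' - z‖ ≤ ‖z' - z - t • e‖ := by
  have hκ := h.aperture_pos
  have key : ∀ z z' : 𝔼, z ∈ frontier Ω → z ∈ Metric.ball z₀ r → z' ∈ frontier Ω →
      z' ∈ Metric.ball z₀ r → ∀ t : ℝ, 0 ≤ t → κ / (1 + κ) * ‖z' - z‖ ≤ ‖z' - z - t • e‖ := by
    intro z z' hz hzr hz' hzr' t ht
    have h1 : κ * t ≤ ‖z' - z - t • e‖ := by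
      rcases ht.eq_or_lt with rfl | ht
      · simp
      · by_contra hcon
        rw [hΩ.frontier_eq] at hz'
        exact hz'.2 (h.mem_of_mem_closure (frontier_subset_closure hz) hzr hzr' ht (not_le.1 hcon))
    have h2 : ‖z' - z‖ ≤ ‖z' - z - t • e‖ + t := by
      have := norm_add_le (z' - z - t • e) (t • e)
      rwa [sub_add_cancel, norm_smul, h.norm_eq, mul_one, Real.norm_of_nonneg ht] at this
    rw [div_mul_eq_mul_div, div_le_iff₀ (by positivity)]
    nlinarith
  rcases le_total 0 t with ht | ht
  · exact key z z' hz hzr hz' hzr' t ht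
  · have := key z' z hz' hzr' hz hzr (-t) (by linarith)
    rw [norm_sub_rev z z'] at this
    refine this.trans (le_of_eq ?_)
    rw [← norm_neg]
    congr 1
    rw [neg_smul]; abel

theorem IsBoundedLipschitzDomain.isCompact_frontier (hΩ : IsBoundedLipschitzDomain Ω) :
    IsCompact (frontier Ω) :=
  hΩ.isBounded.isCompact_closure.of_isClosed_subset isClosed_frontier frontier_subset_closure

/-- The boundary is covered by finitely many balls in which a cone condition holds. -/
theorem IsBoundedLipschitzDomain.exists_finite_cover (hΩ : IsBoundedLipschitzDomain Ω) :
    ∃ (I : Finset 𝔼) (e : 𝔼 → 𝔼) (κ r : 𝔼 → ℝ), (∀ z ∈ I, ConeCondition Ω z (e z) (κ z) (r z)) ∧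
      frontier Ω ⊆ ⋃ z ∈ I, Metric.ball z (r z / 4) := by
  choose! e κ r h using fun (z : 𝔼) (hz : z ∈ frontier Ω) => hΩ.exists_coneCondition hz
  obtain ⟨I, hI, hcov⟩ := hΩ.isCompact_frontier.elim_nhds_subcover
    (fun z => Metric.ball z (r z / 4)) fun z hz =>
      Metric.ball_mem_nhds z (by have := (h z hz).radius_pos; positivity)
  exact ⟨I, e, κ, r, fun z hz => h z (hI z hz), hcov⟩

/-- Near `z₀`, the surface measure is controlled by the volume of tubes in the direction of the
cone. -/
theorem ConeCondition.surface_le (hΩ : IsOpen Ω) {z₀ e : 𝔼} {κ r : ℝ}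
    (h : ConeCondition Ω z₀ e κ r) : ∃ K : ℝ≥0, ∀ A : Set 𝔼, IsCompact A → A ⊆ frontier Ω →
      A ⊆ Metric.ball z₀ r → ∀ δ : ℝ, 0 < δ →
      μHE[n - 1] A ≤ K / ENNReal.ofReal δ * volume (tube e δ A) := by
  have hκ := h.aperture_pos
  set c : ℝ≥0 := ⟨κ / (1 + κ), by positivity⟩
  have hc : 0 < c := by
    rw [← NNReal.coe_pos]
    show 0 < κ / (1 + κ)
    positivity
  refine ⟨c⁻¹ ^ (n - 1), fun A hA hAf hAb δ hδ => ?_⟩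
  have h1 := ofReal_mul_surface_le_volume_tube (δ := δ) hc h.norm_eq hA
    fun z hz z' hz' t => h.transversal hΩ (hAf hz) (hAb hz) (hAf hz') (hAb hz') t
  have h0 : ENNReal.ofReal δ ≠ 0 := by simpa using hδ
  rw [ENNReal.div_eq_inv_mul, mul_assoc, ← ENNReal.div_eq_inv_mul,
    ENNReal.le_div_iff_mul_le (.inl h0) (.inl ENNReal.ofReal_ne_top), mul_comm]
  exact_mod_cast h1

theorem surfaceMeasure_lt_top (hΩ : IsBoundedLipschitzDomain Ω) :
    surfaceMeasure Ω Set.univ < ⊤ := by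
  obtain ⟨I, e, κ, r, hcone, hcov⟩ := hΩ.exists_finite_cover
  rw [surfaceMeasure, Measure.restrict_apply MeasurableSet.univ, Set.univ_inter]
  have hsub : frontier Ω ⊆ ⋃ z ∈ I, (frontier Ω ∩ Metric.closedBall z (r z / 4)) := by
    intro x hx
    obtain ⟨z, hz, hxz⟩ := Set.mem_iUnion₂.1 (hcov hx)
    exact Set.mem_iUnion₂.2 ⟨z, hz, hx, Metric.ball_subset_closedBall hxz⟩
  refine (measure_mono hsub).trans_lt ((measure_biUnion_finset_le _ _).trans_lt ?_)
  refine ENNReal.sum_lt_top.2 fun z hz => ?_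
  have hr := (hcone z hz).radius_pos
  obtain ⟨K, hK⟩ := (hcone z hz).surface_le hΩ.isOpen
  have hc := hΩ.isCompact_frontier.inter_right (Metric.isClosed_closedBall (x := z) (ε := r z / 4))
  refine (hK _ hc Set.inter_subset_left (Set.inter_subset_right.trans
    (Metric.closedBall_subset_ball (by linarith))) 1 one_pos).trans_lt ?_
  refine ENNReal.mul_lt_top ?_ (isCompact_tube hc).measure_lt_top
  simp

theorem volume_frontier (hn : 2 ≤ n) (hΩ : IsBoundedLipschitzDomain Ω) :
    volume (frontier Ω) = 0 := by
  have h1 := surfaceMeasure_lt_top hΩ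
  rw [surfaceMeasure, Measure.restrict_apply MeasurableSet.univ, Set.univ_inter] at h1
  -- a set of finite `(n-1)`-dimensional measure is null in dimension `n`
  rcases Measure.euclideanHausdorffMeasure_zero_or_top (show n - 1 < n by omega) (frontier Ω)
    with h | h
  · rwa [EuclideanSpace.euclideanHausdorffMeasure_eq_volume] at h
  · exact absurd h h1.ne

theorem lineVariation_ne_top (hb : Bornology.IsBounded Ω) {v : 𝔼 → ℝ} (hv : ContDiff ℝ 1 v)
    (e : 𝔼) (δ : ℝ) (x : 𝔼) : lineVariation v e δ Ω x ≠ ⊤ := by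
  obtain ⟨C, hC⟩ := hb.isCompact_closure.exists_bound_of_continuousOn
    (continuous_gradient hv).continuousOn
  have hle : ∀ y, Ω.indicator (fun y => ‖gradient v y‖ₑ) y ≤ ENNReal.ofReal C := by
    intro y
    by_cases hy : y ∈ Ω
    · rw [Set.indicator_of_mem hy, ← ofReal_norm]
      exact ENNReal.ofReal_le_ofReal (hC y (subset_closure hy))
    · simp [hy]
  refine ne_top_of_le_ne_top ?_ (lintegral_mono fun t => hle (x - t • e))
  simp [ENNReal.mul_eq_top]

/-- The local trace inequality. At a boundary point `z`, the value `|v z|` is at most `|v| + g` at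
each point above `z`, where `g` is the variation of `v` along lines; hence the tube over a
superlevel set of `|v|` on the boundary lies in a superlevel set of `|v| + g`. -/
theorem ConeCondition.lintegral_boundary_le (hn : 2 ≤ n) (hΩ : IsBoundedLipschitzDomain Ω)
    {z₀ e : 𝔼} {κ r : ℝ} (h : ConeCondition Ω z₀ e κ r) {p : ℝ} (hp : 1 ≤ p) :
    ∃ K : ℝ≥0, ∀ v : 𝔼 → ℝ, ContDiff ℝ 1 v →
      ∫⁻ x in frontier Ω ∩ Metric.closedBall z₀ (r / 4), ‖v x‖ₑ ^ p ∂μHE[n - 1] ≤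
        K * (lpNorm p Ω v + lpNorm p Ω (gradient v)) ^ p := by
  obtain ⟨K, hK⟩ := h.surface_le hΩ.isOpen
  have hr := h.radius_pos
  have hp0 : 0 < p := by linarith
  set δ : ℝ := r / 4
  have hδ : 0 < δ := by positivity
  set A := frontier Ω ∩ Metric.closedBall z₀ (r / 4)
  have hA : IsCompact A := hΩ.isCompact_frontier.inter_right Metric.isClosed_closedBall
  have hKδ : (K : ℝ≥0∞) / ENNReal.ofReal δ ≠ ⊤ :=
    ENNReal.div_ne_top ENNReal.coe_ne_top (by simpa using hδ)
  have hmax : ENNReal.ofReal (max 1 δ) ^ p ≠ ⊤ :=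
    ENNReal.rpow_ne_top_of_nonneg hp0.le ENNReal.ofReal_ne_top
  refine ⟨((K : ℝ≥0∞) / ENNReal.ofReal δ).toNNReal * (ENNReal.ofReal (max 1 δ) ^ p).toNNReal,
    fun v hv => ?_⟩
  have hUm := hΩ.isOpen.measurableSet
  set g := lineVariation v e δ Ω with hg
  have hgm : Measurable g := measurable_lineVariation hv e δ hUm
  have hvm : Measurable fun x => ‖v x‖ₑ := hv.continuous.measurable.enorm
  set k : 𝔼 → ℝ≥0∞ := fun x => ‖v x‖ₑ + g x
  have hk : Measurable k := hvm.add hgm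
  have hkfin : ∀ x, k x ≠ ⊤ := fun x =>
    ENNReal.add_ne_top.2 ⟨enorm_ne_top, lineVariation_ne_top hΩ.isBounded hv e δ x⟩
  -- the tube over a superlevel set of `v` on the boundary lies in a superlevel set of `k`
  have hlevel : ∀ t : ℝ, 0 < t → (μHE[n - 1]).restrict A {x | t ≤ |v x|} ≤
      K / ENNReal.ofReal δ * volume.restrict Ω {x | t ≤ (k x).toReal} := by
    intro t ht
    rw [Measure.restrict_apply (measurableSet_le measurable_const hv.continuous.abs.measurable),
      Measure.restrict_apply (measurableSet_le measurable_const hk.ennreal_toReal)]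
    have hB : IsCompact ({x | t ≤ |v x|} ∩ A) :=
      hA.inter_left (isClosed_le continuous_const hv.continuous.abs)
    refine (hK _ hB (Set.inter_subset_right.trans Set.inter_subset_left)
      (Set.inter_subset_right.trans (Set.inter_subset_right.trans
        (Metric.closedBall_subset_ball (by linarith)))) δ hδ).trans (mul_le_mul_right ?_ _)
    have hsub : tube e δ ({x | t ≤ |v x|} ∩ A) ⊆
        ({x | t ≤ (k x).toReal} ∩ Ω) ∪ frontier Ω := by
      rintro x ⟨z, ⟨hzt, hzf, hzb⟩, s, hs, rfl⟩
      rcases hs.1.eq_or_lt with rfl | hs0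
      · right; simpa using hzf
      left
      -- points slightly above a boundary point lie in `Ω`
      have hmem : ∀ τ ∈ Set.Ioc 0 s, z + τ • e ∈ Ω := by
        intro τ hτ
        refine h.mem_of_mem_closure (frontier_subset_closure hzf)
          (Metric.closedBall_subset_ball (by linarith) hzb) ?_ hτ.1
          (by have := h.aperture_pos; simpa using mul_pos this hτ.1)
        rw [mem_ball_iff_norm]
        have e1 : z + τ • e - z₀ = (z - z₀) + τ • e := by abel
        rw [e1]
        refine (norm_add_le _ _).trans_lt ?_
        rw [norm_smul, h.norm_eq, mul_one, Real.norm_of_nonneg hτ.1.le]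
        have := mem_closedBall_iff_norm.1 hzb
        have := hτ.2.trans hs.2
        simp only [δ] at this
        linarith
      refine ⟨?_, hmem s ⟨hs0, le_rfl⟩⟩
      have h1 : ‖v z‖ₑ ≤ k (z + s • e) := by
        have a1 : ‖v z‖ₑ ≤ ‖v (z + s • e)‖ₑ + ‖v (z + s • e) - v (z + s • e - s • e)‖ₑ := by
          rw [add_sub_cancel_right]
          have := enorm_sub_le (a := v (z + s • e)) (b := v (z + s • e) - v z)
          rwa [sub_sub_cancel] at this
        refine a1.trans (add_le_add le_rfl
          ((enorm_sub_le_lintegral_gradient hv h.norm_eq _ hs.1).trans ?_))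
        rw [hg, lineVariation, setLIntegral_congr (Ioo_ae_eq_Ioc (a := (0 : ℝ)) (b := s)).symm]
        calc ∫⁻ τ in Set.Ioo 0 s, ‖gradient v (z + s • e - τ • e)‖ₑ
            = ∫⁻ τ in Set.Ioo 0 s,
                Ω.indicator (fun y => ‖gradient v y‖ₑ) (z + s • e - τ • e) :=
              setLIntegral_congr_fun measurableSet_Ioo fun τ hτ => by
                have e2 : z + s • e - τ • e = z + (s - τ) • e := by rw [sub_smul]; abel
                have := hmem (s - τ) ⟨by linarith [hτ.2], by linarith [hτ.1]⟩
                rw [← e2] at this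
                simp only [Set.indicator_of_mem this]
          _ ≤ _ := lintegral_mono_set
              (Set.Ioo_subset_Ioc_self.trans (Set.Ioc_subset_Ioc_right hs.2))
      have h2 := ENNReal.toReal_mono (hkfin _) h1
      exact le_trans hzt (by simpa using h2)
    refine (measure_mono (μ := volume) hsub).trans ((measure_union_le _ _).trans ?_)
    rw [volume_frontier hn hΩ, add_zero]
  -- the layer cake formula
  have hmain : ∫⁻ x in A, ‖v x‖ₑ ^ p ∂μHE[n - 1] ≤
      K / ENNReal.ofReal δ * ∫⁻ x in Ω, k x ^ p := by
    have e1 : ∀ x, k x ^ p = ENNReal.ofReal ((k x).toReal ^ p) := fun x => by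
      rw [← ENNReal.ofReal_rpow_of_nonneg ENNReal.toReal_nonneg hp0.le,
        ENNReal.ofReal_toReal (hkfin x)]
    have e2 : ∀ x, ‖v x‖ₑ ^ p = ENNReal.ofReal (|v x| ^ p) := fun x => by
      rw [← ENNReal.ofReal_rpow_of_nonneg (abs_nonneg _) hp0.le, ← Real.enorm_eq_ofReal_abs]
    simp only [e1, e2]
    rw [lintegral_rpow_eq_lintegral_meas_le_mul _ (.of_forall fun x => ENNReal.toReal_nonneg)
        hk.ennreal_toReal.aemeasurable hp0,
      lintegral_rpow_eq_lintegral_meas_le_mul _ (.of_forall fun x => abs_nonneg _)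
        hv.continuous.abs.measurable.aemeasurable hp0, mul_left_comm,
      ← lintegral_const_mul' _ _ hKδ]
    refine mul_le_mul_right (setLIntegral_mono' measurableSet_Ioi fun t ht => ?_) _
    rw [← mul_assoc]
    gcongr
    exact hlevel t ht
  have hP : ENNReal.ofReal p ≠ 0 := by simpa using hp0
  have hPr : (ENNReal.ofReal p).toReal = p := ENNReal.toReal_ofReal hp0.le
  have hmink : (∫⁻ x in Ω, k x ^ p) ^ (1 / p) ≤
      ENNReal.ofReal (max 1 δ) * (lpNorm p Ω v + lpNorm p Ω (gradient v)) := by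
    calc (∫⁻ x in Ω, k x ^ p) ^ (1 / p)
        ≤ (∫⁻ x in Ω, ‖v x‖ₑ ^ p) ^ (1 / p) + (∫⁻ x in Ω, g x ^ p) ^ (1 / p) :=
          ENNReal.lintegral_Lp_add_le hvm.aemeasurable hgm.aemeasurable hp
      _ ≤ (∫⁻ x in Ω, ‖v x‖ₑ ^ p) ^ (1 / p) +
          (ENNReal.ofReal δ ^ p * ∫⁻ x in Ω, ‖gradient v x‖ₑ ^ p) ^ (1 / p) := by
          gcongr
          exact (setLIntegral_le_lintegral _ _).trans
            (lintegral_lineVariation_rpow_le hv e hδ hUm hp)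
      _ = lpNorm p Ω v + ENNReal.ofReal δ * lpNorm p Ω (gradient v) := by
          rw [lpNorm, lpNorm, eLpNorm_eq_lintegral_rpow_enorm_toReal hP ENNReal.ofReal_ne_top,
            eLpNorm_eq_lintegral_rpow_enorm_toReal hP ENNReal.ofReal_ne_top, hPr,
            ENNReal.mul_rpow_of_nonneg (_ ^ p) _ (by positivity), ← ENNReal.rpow_mul,
            mul_one_div_cancel hp0.ne', ENNReal.rpow_one]
      _ ≤ _ := by
          rw [mul_add]
          gcongr
          · exact le_mul_of_one_le_left zero_le (by simp)
          · exact le_max_right _ _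
  rw [ENNReal.coe_mul, ENNReal.coe_toNNReal hKδ, ENNReal.coe_toNNReal hmax]
  refine hmain.trans ?_
  rw [mul_assoc, ← ENNReal.mul_rpow_of_nonneg _ _ hp0.le]
  gcongr
  rwa [one_div, ENNReal.rpow_inv_le_iff hp0] at hmink

theorem lintegral_biUnion_finset_le {X ι : Type*} [MeasurableSpace X] (μ : Measure X) (I : Finset ι)
    (s : ι → Set X) (f : X → ℝ≥0∞) :
    ∫⁻ x in ⋃ i ∈ I, s i, f x ∂μ ≤ ∑ i ∈ I, ∫⁻ x in s i, f x ∂μ := by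
  have h := lintegral_iUnion_le (μ := μ) (fun i : I => s i) f
  rw [tsum_fintype, Finset.sum_coe_sort I fun i => ∫⁻ x in s i, f x ∂μ] at h
  rwa [Set.iUnion_subtype] at h

/-- The trace inequality for smooth functions. -/
theorem exists_boundaryNorm_le (hn : 2 ≤ n) (hΩ : IsBoundedLipschitzDomain Ω) {p : ℝ}
    (hp : 1 ≤ p) : ∃ C : ℝ≥0, ∀ v : 𝔼 → ℝ, ContDiff ℝ 1 v →
      boundaryNorm p Ω v ≤ C * (lpNorm p Ω v + lpNorm p Ω (gradient v)) := by
  have hp0 : 0 < p := by linarith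
  have hP : ENNReal.ofReal p ≠ 0 := by simpa using hp0
  have hPr : (ENNReal.ofReal p).toReal = p := ENNReal.toReal_ofReal hp0.le
  obtain ⟨I, e, κ, r, hcone, hcov⟩ := hΩ.exists_finite_cover
  choose! K hK using fun z (hz : z ∈ I) => (hcone z hz).lintegral_boundary_le hn hΩ hp
  refine ⟨(∑ z ∈ I, K z) ^ (1 / p), fun v hv => ?_⟩
  have hsub : frontier Ω ⊆ ⋃ z ∈ I, (frontier Ω ∩ Metric.closedBall z (r z / 4)) := by
    intro x hx
    obtain ⟨z, hz, hxz⟩ := Set.mem_iUnion₂.1 (hcov hx)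
    exact Set.mem_iUnion₂.2 ⟨z, hz, hx, Metric.ball_subset_closedBall hxz⟩
  rw [boundaryNorm, eLpNorm_eq_lintegral_rpow_enorm_toReal hP ENNReal.ofReal_ne_top, hPr,
    surfaceMeasure, one_div, ENNReal.rpow_inv_le_iff hp0, ENNReal.mul_rpow_of_nonneg _ _ hp0.le,
    ENNReal.coe_rpow_of_nonneg _ (by positivity), ← ENNReal.rpow_mul, inv_mul_cancel₀ hp0.ne',
    ENNReal.rpow_one]
  calc ∫⁻ x in frontier Ω, ‖v x‖ₑ ^ p ∂μHE[n - 1]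
      ≤ ∫⁻ x in ⋃ z ∈ I, (frontier Ω ∩ Metric.closedBall z (r z / 4)), ‖v x‖ₑ ^ p ∂μHE[n - 1] :=
        lintegral_mono_set hsub
    _ ≤ ∑ z ∈ I, ∫⁻ x in frontier Ω ∩ Metric.closedBall z (r z / 4), ‖v x‖ₑ ^ p ∂μHE[n - 1] :=
        lintegral_biUnion_finset_le _ _ _ _
    _ ≤ ∑ z ∈ I, K z * (lpNorm p Ω v + lpNorm p Ω (gradient v)) ^ p :=
        Finset.sum_le_sum fun z hz => hK z hz v hv
    _ = _ := by rw [← Finset.sum_mul]; push_cast; rfl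

/-! ### Mollification -/

/-- Convolution of `g` with a normalized smooth bump. The centre `c` of the bump need not be the
origin, so that this also covers mollification followed by a translation. -/
noncomputable def mollify {F : Type*} [NormedAddCommGroup F] [NormedSpace ℝ F] {c : 𝔼}
    (ρ : ContDiffBump c) (g : 𝔼 → F) (x : 𝔼) : F :=
  ∫ t, ρ.normed volume (x - t) • g t

open DomAddAct in
/-- Translation is continuous in `L^p`. -/
theorem exists_eLpNorm_translate_le {F : Type*} [NormedAddCommGroup F] {p : ℝ≥0∞} (hp : 1 ≤ p)
    (hpt : p ≠ ⊤) {G : 𝔼 → F} (hG : MemLp G p volume) {ε : ℝ≥0∞} (hε : 0 < ε) :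
    ∃ r : ℝ, 0 < r ∧ ∀ s : 𝔼, ‖s‖ < r → eLpNorm (fun x => G (x - s) - G x) p volume ≤ ε := by
  have : Fact (1 ≤ p) := ⟨hp⟩
  have : Fact (p ≠ ⊤) := ⟨hpt⟩
  have hcont : Continuous fun s : 𝔼 => (DomAddAct.mk (-s)) +ᵥ hG.toLp G :=
    (DomAddAct.continuous_mk.comp continuous_neg).vadd continuous_const
  have h0 : (DomAddAct.mk (-(0 : 𝔼))) +ᵥ hG.toLp G = hG.toLp G := by simp
  have hlim := (EMetric.tendsto_nhds.1 (hcont.tendsto 0)) ε hε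
  obtain ⟨r, hr, hball⟩ := Metric.eventually_nhds_iff.1 hlim
  refine ⟨r, hr, fun s hs => ?_⟩
  have h1 := hball (y := s) (by simpa using hs)
  rw [h0, DomAddAct.mk_vadd_toLp, Lp.edist_toLp_toLp] at h1
  refine le_trans (le_of_eq ?_) h1.le
  congr 1
  funext x
  simp [sub_eq_add_neg, add_comm]

theorem integrable_normed_smul {F : Type*} [NormedAddCommGroup F] [NormedSpace ℝ F] {c : 𝔼}
    (ρ : ContDiffBump c) {g : 𝔼 → F} (hg : LocallyIntegrable g volume) (x : 𝔼) :
    Integrable (fun t => ρ.normed volume (x - t) • g t) volume := by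
  refine hg.integrable_smul_left_of_hasCompactSupport
    (ρ.continuous_normed.comp (by fun_prop)) ?_
  exact (ρ.hasCompactSupport_normed).comp_homeomorph (Homeomorph.subLeft x)

/-- Mollification converges in `L^p` as the support of the kernel shrinks to the origin. -/
theorem exists_eLpNorm_mollify_sub_le {F : Type*} [NormedAddCommGroup F] [NormedSpace ℝ F]
    [CompleteSpace F] {p : ℝ} (hp : 1 ≤ p) {G : 𝔼 → F}
    (hG : MemLp G (ENNReal.ofReal p) volume) {ε : ℝ≥0∞} (hε : 0 < ε) :
    ∃ r : ℝ, 0 < r ∧ ∀ (c : 𝔼) (ρ : ContDiffBump c), Metric.ball c ρ.rOut ⊆ Metric.ball 0 r →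
      eLpNorm (fun x => mollify ρ G x - G x) (ENNReal.ofReal p) volume ≤ ε := by
  have hp0 : 0 < p := by linarith
  have hP : ENNReal.ofReal p ≠ 0 := by simpa using hp0
  have hPr : (ENNReal.ofReal p).toReal = p := ENNReal.toReal_ofReal hp0.le
  obtain ⟨G', hG'm, hGG'⟩ := hG.aestronglyMeasurable
  have hG' : MemLp G' (ENNReal.ofReal p) volume := hG.ae_eq hGG'
  obtain ⟨r, hr, htr⟩ :=
    exists_eLpNorm_translate_le (one_le_ofReal hp) ENNReal.ofReal_ne_top hG' hε
  refine ⟨r, hr, fun c ρ hρ => ?_⟩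
  have hmol : mollify ρ G = mollify ρ G' := by
    funext x
    refine integral_congr_ae ?_
    filter_upwards [hGG'] with t ht
    rw [ht]
  have hcongr : (fun x => mollify ρ G x - G x) =ᵐ[volume] fun x => mollify ρ G' x - G' x := by
    filter_upwards [hGG'] with x hx
    rw [hmol, hx]
  rw [eLpNorm_congr_ae hcongr]
  set k := ρ.normed (volume : Measure 𝔼)
  have hkm : Measurable fun s => ‖k s‖ₑ := (ρ.continuous_normed (μ := volume)).measurable.enorm
  set ν : Measure 𝔼 := volume.withDensity fun s => ‖k s‖ₑ
  have hν : ν Set.univ = 1 := by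
    rw [withDensity_apply _ MeasurableSet.univ, setLIntegral_univ]
    have h1 : ∀ s, ‖k s‖ₑ = ENNReal.ofReal (k s) := fun s =>
      Real.enorm_of_nonneg (ρ.nonneg_normed s)
    simp only [h1]
    rw [← ofReal_integral_eq_lintegral_ofReal ρ.integrable_normed
      (.of_forall ρ.nonneg_normed), ρ.integral_normed, ENNReal.ofReal_one]
  have : IsFiniteMeasure ν := ⟨by simp [hν]⟩
  have hloc : LocallyIntegrable G' volume := hG'.locallyIntegrable (one_le_ofReal hp)
  -- mollification averages translates with respect to the probability measure `ν`
  have hpt : ∀ x, ‖mollify ρ G' x - G' x‖ₑ ≤ ∫⁻ s, ‖G' (x - s) - G' x‖ₑ ∂ν := by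
    intro x
    have e1 : mollify ρ G' x = ∫ s, k s • G' (x - s) := by
      rw [mollify, ← integral_sub_left_eq_self _ volume x]
      simp [k]
    have hi : Integrable (fun s => k s • G' (x - s)) := by
      have := (integrable_normed_smul ρ hloc x).comp_sub_left x
      simpa [k] using this
    have e2 : mollify ρ G' x - G' x = ∫ s, k s • (G' (x - s) - G' x) := by
      simp only [smul_sub]
      rw [integral_sub hi (ρ.integrable_normed.smul_const _), ← e1]
      simp [ρ.integral_normed_smul]
    rw [e2]
    refine (enorm_integral_le_lintegral_enorm _).trans (le_of_eq ?_)
    rw [lintegral_withDensity_eq_lintegral_mul₀ hkm.aemeasurable]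
    · simp [enorm_smul]
    · exact ((hG'm.comp_measurable (by fun_prop)).sub stronglyMeasurable_const).enorm.aemeasurable
  have hFm : Measurable (Function.uncurry fun (x s : 𝔼) => ‖G' (x - s) - G' x‖ₑ) :=
    ((hG'm.comp_measurable (by fun_prop : Measurable fun w : 𝔼 × 𝔼 => w.1 - w.2)).sub
      (hG'm.comp_measurable measurable_fst)).enorm
  rw [eLpNorm_eq_lintegral_rpow_enorm_toReal hP ENNReal.ofReal_ne_top, hPr, one_div,
    ENNReal.rpow_inv_le_iff hp0]
  calc ∫⁻ x, ‖mollify ρ G' x - G' x‖ₑ ^ p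
      ≤ ∫⁻ x, (∫⁻ s, ‖G' (x - s) - G' x‖ₑ ∂ν) ^ p := by
        gcongr with x
        exact hpt x
    _ ≤ ν Set.univ ^ (p - 1) * ∫⁻ s, (∫⁻ x, ‖G' (x - s) - G' x‖ₑ ^ p) ∂ν :=
        lintegral_rpow_lintegral_le volume ν hFm hp
    _ = ∫⁻ s, (∫⁻ x, ‖G' (x - s) - G' x‖ₑ ^ p) ∂ν := by rw [hν, ENNReal.one_rpow, one_mul]
    _ ≤ ∫⁻ s, ε ^ p ∂ν := by
        refine lintegral_mono_ae ?_
        rw [ae_withDensity_iff hkm]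
        refine .of_forall fun s hs => ?_
        have hs' : s ∈ Function.support k := by simpa using hs
        rw [ρ.support_normed_eq] at hs'
        have h2 := htr s (by simpa using hρ hs')
        rwa [eLpNorm_eq_lintegral_rpow_enorm_toReal hP ENNReal.ofReal_ne_top, hPr, one_div,
          ENNReal.rpow_inv_le_iff hp0] at h2
    _ = ε ^ p := by rw [lintegral_const, hν, mul_one]

open scoped Convolution in
theorem mollify_eq_convolution {c : 𝔼} (ρ : ContDiffBump c) (g : 𝔼 → ℝ) :
    mollify ρ g = g ⋆[ContinuousLinearMap.lsmul ℝ ℝ, volume] ρ.normed volume := by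
  funext x
  simp [mollify, convolution, mul_comm]

theorem contDiff_mollify {c : 𝔼} (ρ : ContDiffBump c) {g : 𝔼 → ℝ}
    (hg : LocallyIntegrable g volume) : ContDiff ℝ ∞ (mollify ρ g) := by
  rw [mollify_eq_convolution]
  exact ρ.hasCompactSupport_normed.contDiff_convolution_right _ hg ρ.contDiff_normed

theorem fderiv_mollify {c : 𝔼} (ρ : ContDiffBump c) {g : 𝔼 → ℝ}
    (hg : LocallyIntegrable g volume) (x w : 𝔼) :
    fderiv ℝ (mollify ρ g) x w = ∫ t, g t * fderiv ℝ (ρ.normed volume) (x - t) w := by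
  have h := ρ.hasCompactSupport_normed.hasFDerivAt_convolution_right
    (ContinuousLinearMap.lsmul ℝ ℝ) hg (ρ.contDiff_normed (μ := volume) (n := 1)) x
  rw [mollify_eq_convolution, h.fderiv, convolution_precompR_apply _ hg
    (ρ.hasCompactSupport_normed.fderiv ℝ)
      (ρ.contDiff_normed (μ := volume) (n := 1) |>.continuous_fderiv one_ne_zero)]
  simp [convolution]

/-- The localization `η G + u ∇η` of a weak gradient `G` of `u`. -/
noncomputable def localizedGrad (η u : 𝔼 → ℝ) (G : 𝔼 → 𝔼) (x : 𝔼) : 𝔼 :=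
  η x • G x + u x • gradient η x

theorem fderiv_mul_comp_sub {η k : 𝔼 → ℝ} (hη : Differentiable ℝ η) (hk : Differentiable ℝ k)
    (x t w : 𝔼) : fderiv ℝ (fun t => η t * k (x - t)) t w =
      k (x - t) * fderiv ℝ η t w - η t * fderiv ℝ k (x - t) w := by
  have h3 : HasFDerivAt (fun t => x - t) (-ContinuousLinearMap.id ℝ 𝔼) t :=
    (hasFDerivAt_id t).const_sub x
  have h4 : HasFDerivAt (fun t => k (x - t)) ((fderiv ℝ k (x - t)).comp
      (-ContinuousLinearMap.id ℝ 𝔼)) t := (hk _).hasFDerivAt.comp t h3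
  rw [((hη t).hasFDerivAt.fun_mul h4).fderiv]
  simp
  ring

/-- The gradient of the mollification of `η u`, at points where the kernel does not see the part of
`supp η` outside `Ω`. -/
theorem gradient_mollify {u η : 𝔼 → ℝ} {G : 𝔼 → 𝔼} (hu : HasWeakGradient Ω u G)
    (hΩ : MeasurableSet Ω)
    (hη : ContDiff ℝ ∞ η) {c : 𝔼} (ρ : ContDiffBump c)
    (hg : LocallyIntegrable (Ω.indicator fun t => η t * u t) volume)
    (hH : LocallyIntegrable (Ω.indicator (localizedGrad η u G)) volume) {x : 𝔼}
    (hx : ∀ t ∈ tsupport η, x - t ∈ Metric.closedBall c ρ.rOut → t ∈ Ω) :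
    gradient (mollify ρ (Ω.indicator fun t => η t * u t)) x =
      mollify ρ (Ω.indicator (localizedGrad η u G)) x := by
  set k := ρ.normed (volume : Measure 𝔼)
  have hk : ContDiff ℝ ∞ k := ρ.contDiff_normed
  have hkx : ContDiff ℝ ∞ fun t => k (x - t) := hk.comp (contDiff_const.sub contDiff_id)
  have hcs : HasCompactSupport fun t => k (x - t) :=
    (ρ.hasCompactSupport_normed).comp_homeomorph (Homeomorph.subLeft x)
  have hts : tsupport (fun t => k (x - t)) ⊆ (fun t => x - t) ⁻¹' Metric.closedBall c ρ.rOut := by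
    refine closure_minimal (fun t ht => ?_)
      (Metric.isClosed_closedBall.preimage (by fun_prop))
    have : x - t ∈ Function.support k := ht
    rw [ρ.support_normed_eq] at this
    have h1 : x - t ∈ Metric.closedBall c ρ.rOut := Metric.ball_subset_closedBall this
    exact h1
  have hsub : tsupport η ∩ tsupport (fun t => k (x - t)) ⊆ Ω := fun t ht => hx t ht.1 (hts ht.2)
  -- the hypothesis on `x` makes `t ↦ η t * k (x - t)` a test function in `Ω`
  have hψ : IsTestFunction Ω (fun t => η t * k (x - t)) := by
    refine ⟨hη.mul hkx, hcs.mul_left, ?_⟩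
    exact (Set.subset_inter (tsupport_mul_subset_left (f := η) (g := fun t => k (x - t)))
      (tsupport_mul_subset_right (f := η) (g := fun t => k (x - t)))).trans hsub
  ext i
  set w : 𝔼 := EuclideanSpace.single i 1
  have hdψ : ∀ t, fderiv ℝ (fun t => η t * k (x - t)) t w =
      k (x - t) * fderiv ℝ η t w - η t * fderiv ℝ k (x - t) w := by
    exact fun t =>
      fderiv_mul_comp_sub (hη.differentiable (by simp)) (hk.differentiable (by simp)) x t w
  have hθ : IntegrableOn (fun t => u t * (k (x - t) * fderiv ℝ η t w)) Ω := by
    refine integrableOn_mul_of_tsupport_subset hu.locallyIntegrableOn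
      (hkx.continuous.mul ((hη.continuous_fderiv (by simp)).clm_apply continuous_const))
      hcs.mul_right ?_
    refine (Set.subset_inter ?_ (tsupport_mul_subset_left (f := fun t => k (x - t))
      (g := fun t => fderiv ℝ η t w))).trans hsub
    refine (tsupport_mul_subset_right (f := fun t => k (x - t))
      (g := fun t => fderiv ℝ η t w)).trans
      ((closure_mono fun y hy => ?_).trans (tsupport_fderiv_subset ℝ))
    contrapose! hy
    simp [Function.notMem_support.1 hy]
  have hu1 : IntegrableOn (fun t => u t * fderiv ℝ (fun t => η t * k (x - t)) t w) Ω :=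
    (hψ.fderiv_apply w).integrableOn_mul hu.locallyIntegrableOn
  have hG1 : IntegrableOn (fun t => G t i * (η t * k (x - t))) Ω :=
    hψ.integrableOn_mul (locallyIntegrableOn_apply hu.locallyIntegrableOn_grad i)
  have hL : gradient (mollify ρ (Ω.indicator fun t => η t * u t)) x i =
      ∫ t in Ω, (u t * (k (x - t) * fderiv ℝ η t w)
        - u t * fderiv ℝ (fun t => η t * k (x - t)) t w) := by
    rw [gradient_apply, fderiv_mollify ρ hg, ← integral_indicator hΩ]
    congr 1 with t
    by_cases ht : t ∈ Ω
    · simp only [Set.indicator_of_mem ht, hdψ]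
      ring
    · simp [ht]
  have hR : mollify ρ (Ω.indicator (localizedGrad η u G)) x i =
      ∫ t in Ω, (u t * (k (x - t) * fderiv ℝ η t w) + G t i * (η t * k (x - t))) := by
    have := (EuclideanSpace.proj (𝕜 := ℝ) i).integral_comp_comm (integrable_normed_smul ρ hH x)
    rw [mollify]
    refine Eq.trans (this.symm) ?_
    rw [← integral_indicator hΩ]
    congr 1 with t
    by_cases ht : t ∈ Ω
    · simp [Set.indicator_of_mem ht, localizedGrad, gradient_apply, w, k]
      ring
    · simp [ht]
  rw [hL, hR, integral_sub hθ hu1, integral_add hθ hG1, hu.integral_eq _ hψ i, sub_neg_eq_add]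

/-! ### Density of smooth functions -/

theorem memLp_localized {p : ℝ≥0∞} {u η : 𝔼 → ℝ} {G : 𝔼 → 𝔼} (hΩ : MeasurableSet Ω)
    (hu : MemLp u p (volume.restrict Ω))
    (hG : MemLp G p (volume.restrict Ω)) (hη : ContDiff ℝ ∞ η)
    (hc : HasCompactSupport η) :
    MemLp (Ω.indicator fun t => η t * u t) p volume ∧
      MemLp (Ω.indicator (localizedGrad η u G)) p volume := by
  obtain ⟨C, hC⟩ := hc.exists_bound_of_continuous hη.continuous
  have hgc : HasCompactSupport (gradient η) :=
    (hc.fderiv ℝ).comp_left (g := (InnerProductSpace.toDual ℝ 𝔼).symm) (map_zero _)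
  have hgcont : Continuous (gradient η) := continuous_gradient (hη.of_le (by simp))
  obtain ⟨D, hD⟩ := hgc.exists_bound_of_continuous hgcont
  rw [memLp_indicator_iff_restrict hΩ, memLp_indicator_iff_restrict hΩ]
  constructor
  · refine hu.of_le_mul (c := C) (hη.continuous.aestronglyMeasurable.mul hu.aestronglyMeasurable)
      (.of_forall fun x => ?_)
    rw [norm_mul]
    exact mul_le_mul_of_nonneg_right (hC x) (norm_nonneg _)
  · refine MemLp.add (f := fun x => η x • G x) (g := fun x => u x • gradient η x) ?_ ?_
    · refine hG.of_le_mul (c := C)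
        (hη.continuous.aestronglyMeasurable.smul hG.aestronglyMeasurable) (.of_forall fun x => ?_)
      rw [norm_smul]
      exact mul_le_mul_of_nonneg_right (hC x) (norm_nonneg _)
    · refine hu.of_le_mul (c := D)
        (hu.aestronglyMeasurable.smul hgcont.aestronglyMeasurable) (.of_forall fun x => ?_)
      rw [norm_smul, mul_comm]
      exact mul_le_mul_of_nonneg_right (hD x) (norm_nonneg _)

/-- Mollification of a localized Sobolev function converges in `W^{1,p}(Ω)`, provided the kernel
sees the support of the cutoff from `Ω` only through `Ω`. -/
theorem exists_mollify_approx {p : ℝ} (hp : 1 ≤ p) {u η : 𝔼 → ℝ} {G : 𝔼 → 𝔼} (hΩ : IsOpen Ω)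
    (hw : HasWeakGradient Ω u G) (hu : MemLp u (ENNReal.ofReal p) (volume.restrict Ω))
    (hG : MemLp G (ENNReal.ofReal p) (volume.restrict Ω)) (hη : ContDiff ℝ ∞ η)
    (hc : HasCompactSupport η) {ε : ℝ≥0∞} (hε : 0 < ε) :
    ∃ r : ℝ, 0 < r ∧ ∀ (c : 𝔼) (ρ : ContDiffBump c), Metric.ball c ρ.rOut ⊆ Metric.ball 0 r →
      (∀ x ∈ Ω, ∀ t ∈ tsupport η, x - t ∈ Metric.closedBall c ρ.rOut → t ∈ Ω) →
      ContDiff ℝ ∞ (mollify ρ (Ω.indicator fun t => η t * u t)) ∧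
      lpNorm p Ω (fun x => η x * u x - mollify ρ (Ω.indicator fun t => η t * u t) x) ≤ ε ∧
      lpNorm p Ω (fun x => localizedGrad η u G x -
        gradient (mollify ρ (Ω.indicator fun t => η t * u t)) x) ≤ ε := by
  obtain ⟨m1, m2⟩ := memLp_localized hΩ.measurableSet hu hG hη hc
  obtain ⟨r1, hr1, h1⟩ := exists_eLpNorm_mollify_sub_le hp m1 hε
  obtain ⟨r2, hr2, h2⟩ := exists_eLpNorm_mollify_sub_le hp m2 hε
  have l1 := m1.locallyIntegrable (one_le_ofReal hp)
  have l2 := m2.locallyIntegrable (one_le_ofReal hp)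
  refine ⟨min r1 r2, lt_min hr1 hr2, fun c ρ hρ hx => ⟨contDiff_mollify ρ l1, ?_, ?_⟩⟩
  · rw [lpNorm_sub_comm]
    refine le_trans ?_ (h1 c ρ (hρ.trans (Metric.ball_subset_ball (min_le_left _ _))))
    refine le_trans (le_of_eq ?_) (eLpNorm_restrict_le _ _ _ Ω)
    refine eLpNorm_congr_ae ((ae_restrict_iff' hΩ.measurableSet).2 (.of_forall fun x hxΩ => ?_))
    simp [Set.indicator_of_mem hxΩ]
  · rw [lpNorm_sub_comm]
    refine le_trans ?_ (h2 c ρ (hρ.trans (Metric.ball_subset_ball (min_le_right _ _))))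
    refine le_trans (le_of_eq ?_) (eLpNorm_restrict_le _ _ _ Ω)
    refine eLpNorm_congr_ae ((ae_restrict_iff' hΩ.measurableSet).2 (.of_forall fun x hxΩ => ?_))
    simp only [gradient_mollify hw hΩ.measurableSet hη ρ l1 l2 (hx x hxΩ),
      Set.indicator_of_mem hxΩ]

/-- A Sobolev function multiplied by a cutoff supported in `Ω` is approximated by test functions. -/
theorem exists_testFunction_approx {p : ℝ} (hp : 1 ≤ p) {u η : 𝔼 → ℝ} {G : 𝔼 → 𝔼} (hΩ : IsOpen Ω)
    (hw : HasWeakGradient Ω u G) (hu : MemLp u (ENNReal.ofReal p) (volume.restrict Ω))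
    (hG : MemLp G (ENNReal.ofReal p) (volume.restrict Ω)) (hη : IsTestFunction Ω η)
    {ε : ℝ≥0∞} (hε : 0 < ε) :
    ∃ φ, IsTestFunction Ω φ ∧ lpNorm p Ω (fun x => η x * u x - φ x) ≤ ε ∧
      lpNorm p Ω (fun x => localizedGrad η u G x - gradient φ x) ≤ ε := by
  obtain ⟨r, hr, h⟩ := exists_mollify_approx hp hΩ hw hu hG hη.contDiff hη.hasCompactSupport hε
  obtain ⟨d, hd, hsub⟩ :=
    hη.hasCompactSupport.isCompact.exists_cthickening_subset_open hΩ hη.tsupport_subset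
  have hb : 0 < min d (r / 2) := lt_min hd (by positivity)
  let ρ : ContDiffBump (0 : 𝔼) := ⟨min d (r / 2) / 2, min d (r / 2), by positivity, by linarith⟩
  have hρr : Metric.ball 0 ρ.rOut ⊆ Metric.ball (0 : 𝔼) r :=
    Metric.ball_subset_ball ((min_le_right _ _).trans (by linarith))
  obtain ⟨h1, h2, h3⟩ := h 0 ρ hρr fun x _ t ht _ => hη.tsupport_subset ht
  have hsupp : tsupport (mollify ρ (Ω.indicator fun t => η t * u t)) ⊆
      Metric.cthickening d (tsupport η) := by
    refine closure_minimal (fun x hx => ?_) Metric.isClosed_cthickening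
    by_contra hcon
    refine hx (integral_eq_zero_of_ae (.of_forall fun t => ?_))
    by_cases ht : t ∈ tsupport η
    · have h5 : x - t ∉ Metric.ball (0 : 𝔼) ρ.rOut := by
        intro hmem
        refine hcon (Metric.mem_cthickening_of_dist_le x t d _ ht ?_)
        rw [mem_ball_zero_iff] at hmem
        rw [dist_eq_norm]
        exact hmem.le.trans (min_le_left _ _)
      rw [← ρ.support_normed_eq (μ := volume), Function.notMem_support] at h5
      simp [h5]
    · by_cases htΩ : t ∈ Ω <;> simp [htΩ, image_eq_zero_of_notMem_tsupport ht]
  exact ⟨_, ⟨h1, hη.hasCompactSupport.isCompact.cthickening.of_isClosed_subset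
    (isClosed_tsupport _) hsupp, hsupp.trans hsub⟩, h2, h3⟩

open scoped Manifold in
theorem exists_smooth_partition {ι : Type} [Fintype ι] {K : Set 𝔼} (hK : IsClosed K)
    (U : ι → Set 𝔼) (hU : ∀ i, IsOpen (U i)) (hcov : K ⊆ ⋃ i, U i) :
    ∃ η : ι → 𝔼 → ℝ, (∀ i, ContDiff ℝ ∞ (η i)) ∧ (∀ i, tsupport (η i) ⊆ U i) ∧
      ∀ x ∈ K, ∑ i, η i x = 1 := by
  obtain ⟨f, hf⟩ := SmoothPartitionOfUnity.exists_isSubordinate 𝓘(ℝ, 𝔼) hK U hU hcov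
  refine ⟨fun i => f i, fun i => (f i).contMDiff.contDiff, hf, fun x hx => ?_⟩
  rw [← finsum_eq_sum_of_fintype]
  exact f.sum_eq_one hx

theorem gradient_sum {ι : Type*} (I : Finset ι) {v : ι → 𝔼 → ℝ}
    (hv : ∀ i, ContDiff ℝ 1 (v i)) (x : 𝔼) :
    gradient (fun y => ∑ i ∈ I, v i y) x = ∑ i ∈ I, gradient (v i) x := by
  have := fderiv_fun_sum (𝕜 := ℝ) (u := I) (A := v) (x := x)
    fun i _ => (hv i).differentiable one_ne_zero x
  simp [gradient, this]

theorem lpNorm_sum_le {F : Type*} [NormedAddCommGroup F] {p : ℝ} (hp : 1 ≤ p) {ι : Type*}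
    (I : Finset ι) {w : ι → 𝔼 → F}
    (hw : ∀ i ∈ I, AEStronglyMeasurable (w i) (volume.restrict Ω)) :
    lpNorm p Ω (fun x => ∑ i ∈ I, w i x) ≤ ∑ i ∈ I, lpNorm p Ω (w i) := by
  refine le_trans (le_of_eq ?_) (eLpNorm_sum_le hw (one_le_ofReal hp))
  congr 1
  funext x
  simp

/-- Near a boundary point with a cone condition, shifted kernels see `Ω` from `Ω`. -/
theorem ConeCondition.exists_bump {z e : 𝔼} {κ r : ℝ} (h : ConeCondition Ω z e κ r) {r₀ : ℝ}
    (hr₀ : 0 < r₀) : ∃ (c : 𝔼) (ρ : ContDiffBump c), Metric.ball c ρ.rOut ⊆ Metric.ball 0 r₀ ∧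
      ∀ x ∈ Ω, ∀ t ∈ Metric.ball z (r / 4), x - t ∈ Metric.closedBall c ρ.rOut → t ∈ Ω := by
  have hκ := h.aperture_pos
  have hr := h.radius_pos
  set b := min r₀ (r / 2)
  have hb : 0 < b := lt_min hr₀ (by positivity)
  set τ := b / (2 * (1 + κ))
  have hτ : 0 < τ := by positivity
  have hτb : τ * (1 + κ) = b / 2 := by simp only [τ]; field_simp
  -- the kernel is centred at `-τ e`, so that the mollified function at `x` depends on values near
  -- the point `x + τ e` inside the cone
  let ρ : ContDiffBump (-(τ • e)) := ⟨κ * τ / 4, κ * τ / 2, by positivity, by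
    have : 0 < κ * τ := by positivity
    linarith⟩
  have hρ : ρ.rOut = κ * τ / 2 := rfl
  have hnorm : ‖τ • e‖ = τ := by rw [norm_smul, h.norm_eq, mul_one, Real.norm_of_nonneg hτ.le]
  have hκτ : 0 < κ * τ := by positivity
  refine ⟨_, ρ, fun s hs => ?_, fun x hx t ht hxt => ?_⟩
  · rw [mem_ball_iff_norm, sub_neg_eq_add, hρ] at hs
    rw [mem_ball_zero_iff]
    have := norm_sub_le (s + τ • e) (τ • e)
    rw [add_sub_cancel_right, hnorm] at this
    have : b ≤ r₀ := min_le_left _ _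
    nlinarith
  · rw [mem_closedBall_iff_norm, sub_neg_eq_add, hρ] at hxt
    have h1 : ‖x - t‖ ≤ κ * τ / 2 + τ := by
      have := norm_sub_le (x - t + τ • e) (τ • e)
      rw [add_sub_cancel_right, hnorm] at this
      linarith
    have hbr : b ≤ r / 2 := min_le_right _ _
    refine h.mem_of_mem x ⟨hx, ?_⟩ t (Metric.ball_subset_ball (by linarith) ht) τ hτ ?_
    · rw [mem_ball_iff_norm] at ht ⊢
      have := norm_add_le (x - t) (t - z)
      rw [sub_add_sub_cancel] at this
      nlinarith
    · rw [← norm_neg]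
      have e1 : -(t - x - τ • e) = x - t + τ • e := by abel
      rw [e1]
      linarith

/-- Functions smooth up to the boundary are dense in `W^{1,p}(Ω)`. -/
theorem exists_smooth_approx (hΩ : IsBoundedLipschitzDomain Ω) {p : ℝ} (hp : 1 ≤ p) {u : 𝔼 → ℝ}
    {G : 𝔼 → 𝔼} (hw : HasWeakGradient Ω u G)
    (hu : MemLp u (ENNReal.ofReal p) (volume.restrict Ω))
    (hG : MemLp G (ENNReal.ofReal p) (volume.restrict Ω)) {ε : ℝ≥0∞} (hε : 0 < ε) :
    ∃ v : 𝔼 → ℝ, ContDiff ℝ ∞ v ∧ lpNorm p Ω (fun x => u x - v x) ≤ ε ∧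
      lpNorm p Ω (fun x => G x - gradient v x) ≤ ε := by
  obtain ⟨I, e, κ, r, hcone, hcov⟩ := hΩ.exists_finite_cover
  -- `closure Ω` is covered by `Ω` (the index `none`) and by balls around boundary points
  let U : Option I → Set 𝔼 := fun o => o.elim Ω fun z => Metric.ball z (r z / 4)
  have hU : ∀ i, IsOpen (U i) := by
    rintro (_ | z)
    · exact hΩ.isOpen
    · exact Metric.isOpen_ball
  have hKU : closure Ω ⊆ ⋃ i, U i := by
    intro x hx
    by_cases hxΩ : x ∈ Ω
    · exact Set.mem_iUnion.2 ⟨none, hxΩ⟩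
    · have hxf : x ∈ frontier Ω := by rw [hΩ.isOpen.frontier_eq]; exact ⟨hx, hxΩ⟩
      obtain ⟨z, hz, hxz⟩ := Set.mem_iUnion₂.1 (hcov hxf)
      exact Set.mem_iUnion.2 ⟨some ⟨z, hz⟩, hxz⟩
  obtain ⟨η, hη, hηU, hsum⟩ := exists_smooth_partition (n := n) isClosed_closure U hU hKU
  have hηc : ∀ i, HasCompactSupport (η i) := by
    rintro (_ | z)
    · exact hΩ.isBounded.isCompact_closure.of_isClosed_subset (isClosed_tsupport _)
        ((hηU none).trans subset_closure)
    · exact (isCompact_closedBall (z : 𝔼) (r z / 4)).of_isClosed_subset (isClosed_tsupport _)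
        ((hηU (some z)).trans Metric.ball_subset_closedBall)
  set N : ℝ≥0∞ := ((Fintype.card (Option I) : ℕ) : ℝ≥0∞)
  have hN0 : N ≠ 0 := by simp [N]
  have hNt : N ≠ ⊤ := ENNReal.natCast_ne_top _
  have hεN : 0 < ε / N := ENNReal.div_pos hε.ne' hNt
  have hloc : ∀ i, ∃ v : 𝔼 → ℝ, ContDiff ℝ ∞ v ∧
      lpNorm p Ω (fun x => η i x * u x - v x) ≤ ε / N ∧
      lpNorm p Ω (fun x => localizedGrad (η i) u G x - gradient v x) ≤ ε / N := by
    rintro (_ | z)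
    -- the interior piece has compact support in `Ω`
    · obtain ⟨φ, hφ, h1, h2⟩ := exists_testFunction_approx hp hΩ.isOpen hw hu hG
        ⟨hη none, hηc none, hηU none⟩ hεN
      exact ⟨φ, hφ.contDiff, h1, h2⟩
    -- a boundary piece is mollified with a kernel shifted along the axis of the cone, which at
    -- points of `Ω` only sees points of `Ω`
    · obtain ⟨r₀, hr₀, h⟩ :=
        exists_mollify_approx hp hΩ.isOpen hw hu hG (hη (some z)) (hηc _) hεN
      obtain ⟨c, ρ, h1, h2⟩ := (hcone z z.2).exists_bump hr₀
      exact ⟨_, h c ρ h1 fun x hx t ht => h2 x hx t (hηU (some z) ht)⟩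
  choose v hv h1 h2 using hloc
  have hv1 : ∀ i, ContDiff ℝ 1 (v i) := fun i => (hv i).of_le (by simp)
  have hη1 : ∀ i, ContDiff ℝ 1 (η i) := fun i => (hη i).of_le (by simp)
  have hm : ∀ i, AEStronglyMeasurable (fun x => η i x * u x - v i x) (volume.restrict Ω) :=
    fun i => ((hη i).continuous.aestronglyMeasurable.mul hu.aestronglyMeasurable).sub
      (hv i).continuous.aestronglyMeasurable
  have hm' : ∀ i, AEStronglyMeasurable (fun x => localizedGrad (η i) u G x - gradient (v i) x)
      (volume.restrict Ω) := fun i =>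
    (((hη i).continuous.aestronglyMeasurable.smul hG.aestronglyMeasurable).add
      (hu.aestronglyMeasurable.smul (continuous_gradient (hη1 i)).aestronglyMeasurable)).sub
      (continuous_gradient (hv1 i)).aestronglyMeasurable
  have hcount : ∑ _i : Option I, ε / N = ε := by
    rw [Finset.sum_const, Finset.card_univ, nsmul_eq_mul]
    exact ENNReal.mul_div_cancel hN0 hNt
  refine ⟨fun x => ∑ i, v i x, ContDiff.sum fun i _ => hv i, ?_, ?_⟩
  · calc lpNorm p Ω (fun x => u x - ∑ i, v i x)
        = lpNorm p Ω (fun x => ∑ i, (η i x * u x - v i x)) := by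
          refine lpNorm_congr ((ae_restrict_iff' hΩ.isOpen.measurableSet).2
            (.of_forall fun x hx => ?_))
          simp only [Finset.sum_sub_distrib, ← Finset.sum_mul, hsum x (subset_closure hx), one_mul]
      _ ≤ ∑ i, ε / N := (lpNorm_sum_le hp _ fun i _ => hm i).trans
          (Finset.sum_le_sum fun i _ => h1 i)
      _ = ε := hcount
  · calc lpNorm p Ω (fun x => G x - gradient (fun x => ∑ i, v i x) x)
        = lpNorm p Ω (fun x => ∑ i, (localizedGrad (η i) u G x - gradient (v i) x)) := by
          refine lpNorm_congr ((ae_restrict_iff' hΩ.isOpen.measurableSet).2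
            (.of_forall fun x hx => ?_))
          -- the terms `u ∇η_i` cancel
          have hz : ∑ i, gradient (η i) x = 0 := by
            rw [← gradient_sum _ hη1]
            have he : (fun y => ∑ i, η i y) =ᶠ[𝓝 x] fun _ => (1 : ℝ) := by
              filter_upwards [hΩ.isOpen.mem_nhds hx] with y hy
              exact hsum y (subset_closure hy)
            rw [gradient, he.fderiv_eq]
            simp
          simp only [Finset.sum_sub_distrib, localizedGrad, Finset.sum_add_distrib,
            ← Finset.sum_smul, ← Finset.smul_sum, hsum x (subset_closure hx), one_smul, hz,
            smul_zero, add_zero, gradient_sum _ hv1]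
      _ ≤ ∑ i, ε / N := (lpNorm_sum_le hp _ fun i _ => hm' i).trans
          (Finset.sum_le_sum fun i _ => h2 i)
      _ = ε := hcount

/-! ### Existence of traces -/

/-- Completeness of `L^p`, for sequences of functions. -/
theorem exists_tendsto_eLpNorm_of_cauchy {X F : Type*} [MeasurableSpace X] [NormedAddCommGroup F]
    [CompleteSpace F] {μ : Measure X} {P : ℝ≥0∞} (hP : 1 ≤ P) {w : ℕ → X → F}
    (hw : ∀ k, MemLp (w k) P μ)
    (hc : ∀ ε : ℝ≥0∞, 0 < ε → ∃ N, ∀ k ≥ N, ∀ m ≥ N, eLpNorm (fun x => w k x - w m x) P μ ≤ ε) :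
    ∃ g, MemLp g P μ ∧ Tendsto (fun k => eLpNorm (fun x => w k x - g x) P μ) atTop (𝓝 0) := by
  have : Fact (1 ≤ P) := ⟨hP⟩
  have hcs : CauchySeq fun k => (hw k).toLp (w k) := by
    rw [EMetric.cauchySeq_iff]
    intro ε hε
    obtain ⟨δ, hδ0, hδ⟩ := exists_between hε
    obtain ⟨N, hN⟩ := hc δ hδ0
    refine ⟨N, fun k hk m hm => ?_⟩
    rw [Lp.edist_toLp_toLp]
    exact (hN k hk m hm).trans_lt hδ
  obtain ⟨g, hg⟩ := cauchySeq_tendsto_of_complete hcs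
  refine ⟨g, Lp.memLp g, ?_⟩
  rw [tendsto_iff_edist_tendsto_0] at hg
  refine hg.congr fun k => ?_
  rw [Lp.edist_def]
  refine eLpNorm_congr_ae ?_
  filter_upwards [(hw k).coeFn_toLp] with x hx
  simp [hx]

theorem memLp_surfaceMeasure_of_continuous (hΩ : IsBoundedLipschitzDomain Ω) {v : 𝔼 → ℝ}
    (hv : Continuous v) (P : ℝ≥0∞) : MemLp v P (surfaceMeasure Ω) := by
  have : IsFiniteMeasure (surfaceMeasure Ω) := ⟨surfaceMeasure_lt_top hΩ⟩
  obtain ⟨C, hC⟩ := hΩ.isCompact_frontier.exists_bound_of_continuousOn hv.continuousOn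
  refine MemLp.of_bound hv.aestronglyMeasurable C ?_
  rw [surfaceMeasure]
  exact (ae_restrict_iff' isClosed_frontier.measurableSet).2 (.of_forall hC)

/-- Every function in `W^{1,p}(Ω)` has a trace. -/
theorem MemW1.exists_hasTrace (hn : 2 ≤ n) (hΩ : IsBoundedLipschitzDomain Ω) {p : ℝ} (hp : 1 ≤ p)
    {u : 𝔼 → ℝ} (hu : MemW1 p Ω u) : ∃ g, HasTrace p Ω u g := by
  have hw := hu.hasWeakGradient
  choose v hv h1 h2 using fun k : ℕ => exists_smooth_approx hΩ hp hw hu.memLp hu.memLp_grad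
    (ε := ((k : ℝ≥0∞)⁻¹)) (by simp)
  have hv1 : ∀ k, ContDiff ℝ 1 (v k) := fun k => (hv k).of_le (by simp)
  obtain ⟨C, hC⟩ := exists_boundaryNorm_le hn hΩ hp
  have hdiff : ∀ k m, boundaryNorm p Ω (fun x => v k x - v m x) ≤
      C * (2 * ((k : ℝ≥0∞)⁻¹ + (m : ℝ≥0∞)⁻¹)) := by
    intro k m
    refine (hC _ ((hv1 k).sub (hv1 m))).trans ?_
    rw [gradient_sub (hv1 k) (hv1 m), two_mul]
    gcongr
    · refine (lpNorm_sub_le_add hp (hv k).continuous.aestronglyMeasurable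
        hu.memLp.aestronglyMeasurable (hv m).continuous.aestronglyMeasurable).trans ?_
      rw [lpNorm_sub_comm]
      exact add_le_add (h1 k) (h1 m)
    · refine (lpNorm_sub_le_add hp (continuous_gradient (hv1 k)).aestronglyMeasurable
        hu.memLp_grad.aestronglyMeasurable
        (continuous_gradient (hv1 m)).aestronglyMeasurable).trans ?_
      rw [lpNorm_sub_comm]
      exact add_le_add (h2 k) (h2 m)
  obtain ⟨g, hg, hlim⟩ := exists_tendsto_eLpNorm_of_cauchy (one_le_ofReal hp)
    (fun k => memLp_surfaceMeasure_of_continuous hΩ (hv k).continuous (ENNReal.ofReal p))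
    (fun ε hε => by
      have hl : Tendsto (fun k : ℕ => C * (2 * ((k : ℝ≥0∞)⁻¹ + (k : ℝ≥0∞)⁻¹))) atTop
          (𝓝 (C * (2 * (0 + 0)))) :=
        ENNReal.Tendsto.const_mul (ENNReal.Tendsto.const_mul
          (ENNReal.tendsto_inv_nat_nhds_zero.add ENNReal.tendsto_inv_nat_nhds_zero)
          (.inr (by simp))) (.inr ENNReal.coe_ne_top)
      simp only [add_zero, mul_zero] at hl
      obtain ⟨N, hN⟩ := (ENNReal.tendsto_nhds_zero.1 hl ε hε).exists
      refine ⟨N, fun k hk m hm => (hdiff k m).trans (le_trans ?_ hN)⟩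
      gcongr)
  refine ⟨g, hu, hg, v, hv, (tendsto_w1Norm_sub_smooth_iff hΩ.isOpen hp hw hv).2 ⟨?_, ?_⟩, hlim⟩
  · exact tendsto_of_tendsto_of_tendsto_of_le_of_le tendsto_const_nhds
      ENNReal.tendsto_inv_nat_nhds_zero (fun _ => zero_le) h1
  · exact tendsto_of_tendsto_of_tendsto_of_le_of_le tendsto_const_nhds
      ENNReal.tendsto_inv_nat_nhds_zero (fun _ => zero_le) h2

theorem HasTrace.add (hΩ : IsOpen Ω) {p : ℝ} (hp : 1 ≤ p) {u w g h : 𝔼 → ℝ}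
    (hu : HasTrace p Ω u g) (hw : HasTrace p Ω w h) :
    HasTrace p Ω (fun x => u x + w x) (fun x => g x + h x) := by
  obtain ⟨hu1, hg, v, hv, a1, a2⟩ := hu
  obtain ⟨hw1, hh, y, hy, b1, b2⟩ := hw
  obtain ⟨a3, a4⟩ := (tendsto_w1Norm_sub_smooth_iff hΩ hp hu1.hasWeakGradient hv).1 a1
  obtain ⟨b3, b4⟩ := (tendsto_w1Norm_sub_smooth_iff hΩ hp hw1.hasWeakGradient hy).1 b1
  have sq : ∀ {a b : ℕ → ℝ≥0∞} {c : ℕ → ℝ≥0∞}, Tendsto a atTop (𝓝 0) → Tendsto b atTop (𝓝 0) →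
      (∀ k, c k ≤ a k + b k) → Tendsto c atTop (𝓝 0) := fun ha hb hc =>
    tendsto_of_tendsto_of_tendsto_of_le_of_le tendsto_const_nhds (by simpa using ha.add hb)
      (fun _ => zero_le) hc
  refine ⟨hu1.add hΩ hw1, hg.add hh, fun k x => v k x + y k x, fun k => (hv k).add (hy k),
    (tendsto_w1Norm_sub_smooth_iff hΩ hp (hu1.hasWeakGradient.add hw1.hasWeakGradient)
      fun k => (hv k).add (hy k)).2 ⟨sq a3 b3 fun k => ?_, sq a4 b4 fun k => ?_⟩,
    sq a2 b2 fun k => ?_⟩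
  · refine le_trans (le_of_eq ?_) (lpNorm_add_le hp
      (hu1.memLp.aestronglyMeasurable.sub (hv k).continuous.aestronglyMeasurable)
      (hw1.memLp.aestronglyMeasurable.sub (hy k).continuous.aestronglyMeasurable))
    congr 1; funext x; exact add_sub_add_comm _ _ _ _
  · have c1 := (hv k).of_le (m := 1) (by simp)
    have c2 := (hy k).of_le (m := 1) (by simp)
    refine le_trans (le_of_eq ?_) (lpNorm_add_le hp
      (hu1.memLp_grad.aestronglyMeasurable.sub (continuous_gradient c1).aestronglyMeasurable)
      (hw1.memLp_grad.aestronglyMeasurable.sub (continuous_gradient c2).aestronglyMeasurable))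
    rw [gradient_add c1 c2]
    congr 1; funext x; exact add_sub_add_comm _ _ _ _
  · refine le_trans (le_of_eq ?_) (eLpNorm_add_le
      ((hv k).continuous.aestronglyMeasurable.sub hg.aestronglyMeasurable)
      ((hy k).continuous.aestronglyMeasurable.sub hh.aestronglyMeasurable) (one_le_ofReal hp))
    rw [boundaryNorm]
    congr 1; funext x; simp; ring

theorem HasTrace.const_mul (hΩ : IsOpen Ω) {p : ℝ} (hp : 1 ≤ p) {u g : 𝔼 → ℝ}
    (hu : HasTrace p Ω u g) (c : ℝ) : HasTrace p Ω (fun x => c * u x) (fun x => c * g x) := by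
  obtain ⟨hu1, hg, v, hv, a1, a2⟩ := hu
  obtain ⟨a3, a4⟩ := (tendsto_w1Norm_sub_smooth_iff hΩ hp hu1.hasWeakGradient hv).1 a1
  have sq : ∀ {a b : ℕ → ℝ≥0∞}, Tendsto a atTop (𝓝 0) → (∀ k, b k = ‖c‖ₑ * a k) →
      Tendsto b atTop (𝓝 0) := fun ha hb => by
    rw [funext hb]
    simpa using ENNReal.Tendsto.const_mul (a := ‖c‖ₑ) ha (.inr enorm_ne_top)
  refine ⟨hu1.const_mul hΩ c, hg.const_mul c, fun k x => c * v k x,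
    fun k => contDiff_const.mul (hv k),
    (tendsto_w1Norm_sub_smooth_iff hΩ hp (hu1.hasWeakGradient.const_smul c)
      fun k => contDiff_const.mul (hv k)).2 ⟨sq a3 fun k => ?_, sq a4 fun k => ?_⟩,
    sq a2 fun k => ?_⟩
  · rw [← lpNorm_const_smul]; simp [mul_sub]
  · rw [← lpNorm_const_smul, gradient_const_mul ((hv k).of_le (by simp))]; simp [smul_sub]
  · rw [boundaryNorm, boundaryNorm, ← eLpNorm_const_smul]
    congr 1; funext x; simp [mul_sub]

theorem HasTrace.sub (hΩ : IsOpen Ω) {p : ℝ} (hp : 1 ≤ p) {u w g h : 𝔼 → ℝ}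
    (hu : HasTrace p Ω u g) (hw : HasTrace p Ω w h) :
    HasTrace p Ω (fun x => u x - w x) (fun x => g x - h x) := by
  simpa [sub_eq_add_neg] using hu.add hΩ hp (hw.const_mul hΩ hp (-1))

theorem tendsto_eLpNorm_of_exponent_le {X F : Type*} [MeasurableSpace X] [NormedAddCommGroup F]
    {μ : Measure X} [IsFiniteMeasure μ] {p q : ℝ} (hp : 1 ≤ p) (hpq : p ≤ q) {w : ℕ → X → F}
    (hw : ∀ k, AEStronglyMeasurable (w k) μ)
    (h : Tendsto (fun k => eLpNorm (w k) (ENNReal.ofReal q) μ) atTop (𝓝 0)) :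
    Tendsto (fun k => eLpNorm (w k) (ENNReal.ofReal p) μ) atTop (𝓝 0) := by
  have hp0 : 0 < p := by linarith
  refine tendsto_of_tendsto_of_tendsto_of_le_of_le tendsto_const_nhds ?_ (fun _ => zero_le)
    fun k => eLpNorm_le_eLpNorm_mul_rpow_measure_univ (ENNReal.ofReal_le_ofReal hpq) (hw k)
  have hexp : μ Set.univ ^ (1 / (ENNReal.ofReal p).toReal - 1 / (ENNReal.ofReal q).toReal) ≠ ⊤ := by
    refine ENNReal.rpow_ne_top_of_nonneg ?_ (measure_ne_top _ _)
    rw [ENNReal.toReal_ofReal hp0.le, ENNReal.toReal_ofReal (by linarith), sub_nonneg]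
    gcongr
  simpa using ENNReal.Tendsto.mul_const h (.inr hexp)

theorem HasTrace.mono_exponent (hΩ : IsBoundedLipschitzDomain Ω) {p q : ℝ} (hp : 1 ≤ p)
    (hpq : p ≤ q) {u g : 𝔼 → ℝ} (hu : HasTrace q Ω u g) : HasTrace p Ω u g := by
  have := isFiniteMeasure_restrict_of_isBounded hΩ.isBounded
  have : IsFiniteMeasure (surfaceMeasure Ω) := ⟨surfaceMeasure_lt_top hΩ⟩
  obtain ⟨hu1, hg, v, hv, a1, a2⟩ := hu
  have hw := hu1.hasWeakGradient
  obtain ⟨a3, a4⟩ := (tendsto_w1Norm_sub_smooth_iff hΩ.isOpen (hp.trans hpq) hw hv).1 a1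
  refine ⟨hu1.mono_exponent hΩ.isBounded hpq, hg.mono_exponent (ENNReal.ofReal_le_ofReal hpq), v,
    hv, (tendsto_w1Norm_sub_smooth_iff hΩ.isOpen hp hw hv).2 ⟨?_, ?_⟩, ?_⟩
  · exact tendsto_eLpNorm_of_exponent_le hp hpq (fun k => hu1.memLp.aestronglyMeasurable.sub
      (hv k).continuous.aestronglyMeasurable) a3
  · exact tendsto_eLpNorm_of_exponent_le hp hpq (fun k => hu1.memLp_grad.aestronglyMeasurable.sub
      (continuous_gradient ((hv k).of_le (by simp))).aestronglyMeasurable) a4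
  · exact tendsto_eLpNorm_of_exponent_le hp hpq (fun k =>
      (hv k).continuous.aestronglyMeasurable.sub hg.aestronglyMeasurable) a2

/-! ### Functions with vanishing trace -/

/-- The points of `Ω` at distance at most `ε` from the complement. -/
def boundaryStrip (Ω : Set 𝔼) (ε : ℝ) : Set 𝔼 := {x | x ∈ Ω ∧ Metric.infDist x Ωᶜ ≤ ε}

theorem measurableSet_boundaryStrip (hΩ : IsOpen Ω) (ε : ℝ) :
    MeasurableSet (boundaryStrip Ω ε) :=
  hΩ.measurableSet.inter
    (isClosed_le (Metric.continuous_infDist_pt _) continuous_const).measurableSet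

theorem compl_nonempty_of_isBounded (hn : 2 ≤ n) (hb : Bornology.IsBounded Ω) : Ωᶜ.Nonempty := by
  by_contra hcon
  rw [Set.not_nonempty_iff_eq_empty, Set.compl_empty_iff] at hcon
  obtain ⟨e, he⟩ := exists_norm_eq_one hn
  have : Nontrivial 𝔼 := ⟨e, 0, fun h => by simp [h] at he⟩
  rw [hcon] at hb
  exact NormedSpace.unbounded_univ ℝ 𝔼 hb

theorem infDist_pos_of_mem (hn : 2 ≤ n) (hΩ : IsOpen Ω) (hb : Bornology.IsBounded Ω) {x : 𝔼}
    (hx : x ∈ Ω) : 0 < Metric.infDist x Ωᶜ :=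
  (hΩ.isClosed_compl.notMem_iff_infDist_pos (compl_nonempty_of_isBounded hn hb)).1
    fun h => h hx

theorem exists_frontier_dist_le (hn : 2 ≤ n) (hΩ : IsOpen Ω) (hb : Bornology.IsBounded Ω) {x : 𝔼}
    (hx : x ∈ Ω) : ∃ z ∈ frontier Ω, ‖x - z‖ ≤ Metric.infDist x Ωᶜ := by
  obtain ⟨y, hy, hxy⟩ := hΩ.isClosed_compl.exists_infDist_eq_dist
    (compl_nonempty_of_isBounded hn hb) x
  obtain ⟨s, hs, hz, -⟩ := exists_first_exit hΩ (e := x - y) (δ := 1)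
    (x := x) ⟨hx, 1, by simp, by simpa using hy⟩
  refine ⟨_, hz, ?_⟩
  rw [sub_sub_cancel, norm_smul, Real.norm_of_nonneg hs.1, hxy, dist_eq_norm]
  exact mul_le_of_le_one_left (norm_nonneg _) hs.2

theorem exitStrip_subset_boundaryStrip {e : 𝔼} (he : ‖e‖ = 1) (δ : ℝ) :
    exitStrip Ω e δ ⊆ boundaryStrip Ω δ := by
  rintro x ⟨hx, t, ht, hxt⟩
  refine ⟨hx, (Metric.infDist_le_dist_of_mem (y := x - t • e) hxt).trans ?_⟩
  rw [dist_eq_norm, sub_sub_cancel, norm_smul, he, mul_one, Real.norm_of_nonneg ht.1]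
  exact ht.2

/-- A thin boundary strip is covered by finitely many exit strips of comparable width. -/
theorem exists_boundaryStrip_subset (hn : 2 ≤ n) (hΩ : IsBoundedLipschitzDomain Ω) :
    ∃ (I : Finset 𝔼) (e : 𝔼 → 𝔼) (M : ℝ), (∀ z ∈ I, ‖e z‖ = 1) ∧ 1 ≤ M ∧
      ∀ᶠ ε in 𝓝[>] (0 : ℝ), boundaryStrip Ω ε ⊆ ⋃ z ∈ I, exitStrip Ω (e z) (M * ε) := by
  obtain ⟨I, e, κ, r, hcone, hcov⟩ := hΩ.exists_finite_cover
  have hpos : ∀ z ∈ I, 0 ≤ 2 / κ z := fun z hz => by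
    have := (hcone z hz).aperture_pos
    positivity
  set M : ℝ := 1 + ∑ z ∈ I, 2 / κ z
  have hM1 : 1 ≤ M := le_add_of_nonneg_right (Finset.sum_nonneg hpos)
  have hM : ∀ z ∈ I, 2 / κ z ≤ M := fun z hz =>
    (Finset.single_le_sum hpos hz).trans (le_add_of_nonneg_left zero_le_one)
  refine ⟨I, e, M, fun z hz => (hcone z hz).norm_eq, hM1, ?_⟩
  have hev : ∀ᶠ ε in 𝓝[>] (0 : ℝ), ∀ z ∈ I, ε + M * ε < r z / 4 := by
    rw [eventually_all_finset]
    intro z hz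
    have hr := (hcone z hz).radius_pos
    have hlim : Tendsto (fun ε : ℝ => ε + M * ε) (𝓝[>] 0) (𝓝 (0 + M * 0)) :=
      ((by fun_prop : Continuous fun ε : ℝ => ε + M * ε).tendsto 0).mono_left nhdsWithin_le_nhds
    exact hlim.eventually_lt_const (by simpa using hr)
  filter_upwards [hev, self_mem_nhdsWithin] with ε hε hε0
  rintro x ⟨hx, hxε⟩
  replace hε0 : 0 < ε := hε0
  obtain ⟨y, hy, hxy⟩ := exists_frontier_dist_le hn hΩ.isOpen hΩ.isBounded hx
  obtain ⟨z, hz, hyz⟩ := Set.mem_iUnion₂.1 (hcov hy)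
  have hc := hcone z hz
  have hκ := hc.aperture_pos
  have hMε : 0 < M * ε := by positivity
  refine Set.mem_iUnion₂.2 ⟨z, hz, hx, M * ε, ⟨hMε.le, le_rfl⟩, fun hcon => ?_⟩
  have hεz := hε z hz
  have hr := hc.radius_pos
  rw [hΩ.isOpen.frontier_eq] at hy
  -- let `y` be a boundary point nearest to `x`; if `x - M ε e` belonged to `Ω`, then so would `y`,
  -- by the cone condition and `M ≥ 2 / κ`
  refine hy.2 (hc.mem_of_mem (x - (M * ε) • e z) ⟨hcon, ?_⟩ y
    (Metric.ball_subset_ball (by linarith) hyz) (M * ε) hMε ?_)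
  · rw [mem_ball_iff_norm] at hyz ⊢
    have e1 : x - (M * ε) • e z - z = (x - y) + (y - z) - (M * ε) • e z := by abel
    rw [e1]
    have h1 := norm_sub_le ((x - y) + (y - z)) ((M * ε) • e z)
    have h2 := norm_add_le (x - y) (y - z)
    rw [norm_smul (M * ε), hc.norm_eq, mul_one, Real.norm_of_nonneg hMε.le] at h1
    linarith
  · have e1 : y - (x - (M * ε) • e z) - (M * ε) • e z = -(x - y) := by abel
    rw [e1, norm_neg]
    have h3 : 2 ≤ κ z * M := by
      have := hM z hz
      rw [div_le_iff₀ hκ] at this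
      linarith
    nlinarith

theorem mollify_eq_integral_sub {F : Type*} [NormedAddCommGroup F] [NormedSpace ℝ F] {c : 𝔼}
    (ρ : ContDiffBump c) (g : 𝔼 → F) (x : 𝔼) :
    mollify ρ g x = ∫ s, ρ.normed volume s • g (x - s) := by
  rw [mollify, ← integral_sub_left_eq_self _ volume x]
  simp

/-- Cutoff functions that vanish near the boundary, with gradient bounded by the inverse width of
the transition region. -/
theorem exists_cutoff (hb : Bornology.IsBounded Ω) {ε : ℝ}
    (hε : 0 < ε) : ∃ η : 𝔼 → ℝ, IsTestFunction Ω η ∧ (∀ x, 0 ≤ η x ∧ η x ≤ 1) ∧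
      (∀ x, 4 * ε < Metric.infDist x Ωᶜ → η x = 1 ∧ gradient η x = 0) ∧
      ∀ x, ‖gradient η x‖ ≤ 1 / ε := by
  set d : 𝔼 → ℝ := fun x => Metric.infDist x Ωᶜ
  have hd1 : ∀ x y, |d x - d y| ≤ ‖x - y‖ := fun x y => by
    have := (Metric.lipschitz_infDist_pt Ωᶜ).dist_le_mul x y
    simpa [Real.dist_eq, dist_eq_norm] using this
  -- `ζ` rises linearly from `0` at distance `2 ε` to `1` at distance `3 ε` from the complement of
  -- `Ω`, and mollification at scale `ε` makes it smooth
  set ζ : 𝔼 → ℝ := fun x => max (min (d x / ε - 2) 1) 0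
  have hζL : LipschitzWith (ε.toNNReal)⁻¹ ζ := by
    refine LipschitzWith.max_const (LipschitzWith.min_const ?_ 1) 0
    refine LipschitzWith.of_dist_le_mul fun x y => ?_
    have e1 : d x / ε - 2 - (d y / ε - 2) = (d x - d y) / ε := by ring
    rw [Real.dist_eq, e1, abs_div, abs_of_pos hε, NNReal.coe_inv, Real.coe_toNNReal _ hε.le,
      dist_eq_norm, div_eq_inv_mul]
    gcongr
    exact hd1 x y
  have hζc : Continuous ζ := hζL.continuous
  have hζ0 : ∀ x, 0 ≤ ζ x := fun x => le_max_right _ _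
  have hζ1 : ∀ x, ζ x ≤ 1 := fun x => max_le (min_le_right _ _) zero_le_one
  have hloc : LocallyIntegrable ζ volume := hζc.locallyIntegrable
  let ρ : ContDiffBump (0 : 𝔼) := ⟨ε / 2, ε, by positivity, by linarith⟩
  set k := ρ.normed (volume : Measure 𝔼)
  have hk0 : ∀ s, 0 ≤ k s := ρ.nonneg_normed
  have hk1 : ∫ s, k s = 1 := ρ.integral_normed
  have hki : Integrable k := ρ.integrable_normed
  have hint : ∀ x, Integrable fun s => k s * ζ (x - s) := fun x => by
    have := (integrable_normed_smul ρ hloc x).comp_sub_left x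
    simpa [k] using this
  have happ : ∀ x, mollify ρ ζ x = ∫ s, k s * ζ (x - s) := fun x => mollify_eq_integral_sub ρ ζ x
  have hkz : ∀ s, k s ≠ 0 → ‖s‖ < ε := fun s hs => by
    have : s ∈ Function.support k := hs
    rw [ρ.support_normed_eq] at this
    simpa using this
  have hsmooth := contDiff_mollify ρ hloc
  have hzero : ∀ x, d x < ε → mollify ρ ζ x = 0 := by
    intro x hx
    rw [happ]
    refine integral_eq_zero_of_ae (.of_forall fun s => ?_)
    by_cases hs : k s = 0
    · simp [hs]
    · have h1 := (abs_le.1 (hd1 (x - s) x)).2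
      rw [sub_sub_cancel_left, norm_neg] at h1
      have h2 := hkz s hs
      have h3 : ζ (x - s) = 0 := by
        refine max_eq_right ((min_le_left _ _).trans ?_)
        rw [sub_nonpos, div_le_iff₀ hε]
        linarith
      simp [h3]
  have hone : ∀ x, 4 * ε < d x → mollify ρ ζ x = 1 := by
    intro x hx
    rw [happ, ← hk1]
    refine integral_congr_ae (.of_forall fun s => ?_)
    by_cases hs : k s = 0
    · simp [hs]
    · have h1 := (abs_le.1 (hd1 x (x - s))).2
      rw [sub_sub_cancel] at h1
      have h2 := hkz s hs
      have h3 : ζ (x - s) = 1 := by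
        have : 1 ≤ d (x - s) / ε - 2 := by
          rw [le_sub_iff_add_le, le_div_iff₀ hε]
          linarith
        simp [ζ, min_eq_right this]
      simp [h3]
  refine ⟨mollify ρ ζ, ?_, fun x => ⟨?_, ?_⟩, fun x hx => ⟨hone x hx, ?_⟩, fun x => ?_⟩
  · have hts : tsupport (mollify ρ ζ) ⊆ {x | ε ≤ d x} := by
      refine closure_minimal (fun x hx => ?_)
        (isClosed_le continuous_const (Metric.continuous_infDist_pt _))
      by_contra hcon
      exact hx (hzero x (not_le.1 hcon))
    have hsub : {x | ε ≤ d x} ⊆ Ω := by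
      intro x hx
      by_contra hcon
      have : d x = 0 := Metric.infDist_zero_of_mem hcon
      have hx' : ε ≤ d x := hx
      linarith
    exact ⟨hsmooth, hb.isCompact_closure.of_isClosed_subset (isClosed_tsupport _)
      ((hts.trans hsub).trans subset_closure), hts.trans hsub⟩
  · rw [happ]
    exact integral_nonneg fun s => mul_nonneg (hk0 s) (hζ0 _)
  · rw [happ, ← hk1]
    exact integral_mono (hint x) hki fun s => mul_le_of_le_one_right (hk0 s) (hζ1 _)
  · have he : mollify ρ ζ =ᶠ[𝓝 x] fun _ => (1 : ℝ) := by
      have hopen : IsOpen {y | 4 * ε < d y} :=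
        isOpen_lt continuous_const (Metric.continuous_infDist_pt _)
      filter_upwards [hopen.mem_nhds hx] with y hy
      exact hone y hy
    rw [gradient, he.fderiv_eq]
    simp
  · have hLip : LipschitzWith (ε.toNNReal)⁻¹ (mollify ρ ζ) := by
      refine LipschitzWith.of_dist_le_mul fun x y => ?_
      rw [dist_eq_norm, happ, happ, ← integral_sub (hint x) (hint y)]
      refine (norm_integral_le_integral_norm _).trans ?_
      have hb' : ∀ s, ‖k s * ζ (x - s) - k s * ζ (y - s)‖ ≤
          k s * ((ε.toNNReal)⁻¹ * dist x y) := by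
        intro s
        rw [← mul_sub, norm_mul, Real.norm_of_nonneg (hk0 s)]
        have := hζL.dist_le_mul (x - s) (y - s)
        rw [dist_sub_right, dist_eq_norm (ζ _)] at this
        exact mul_le_mul_of_nonneg_left this (hk0 s)
      refine (integral_mono ((hint x).sub (hint y)).norm (hki.mul_const _) hb').trans (le_of_eq ?_)
      rw [integral_mul_const, hk1, one_mul]
    have := norm_fderiv_le_of_lipschitz ℝ hLip (x₀ := x)
    rw [norm_gradient, one_div]
    simpa [Real.coe_toNNReal _ hε.le] using this

theorem lintegral_enorm_rpow_eq_lpNorm {F : Type*} [NormedAddCommGroup F] {p : ℝ} (hp : 1 ≤ p)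
    (u : 𝔼 → F) : ∫⁻ x in Ω, ‖u x‖ₑ ^ p = lpNorm p Ω u ^ p := by
  have hp0 : 0 < p := by linarith
  have hP : ENNReal.ofReal p ≠ 0 := by simpa using hp0
  have hPr : (ENNReal.ofReal p).toReal = p := ENNReal.toReal_ofReal hp0.le
  rw [lpNorm, eLpNorm_eq_lintegral_rpow_enorm_toReal hP ENNReal.ofReal_ne_top, hPr,
    ← ENNReal.rpow_mul, one_div_mul_cancel hp0.ne', ENNReal.rpow_one]

theorem lpNorm_mono_set {F : Type*} [NormedAddCommGroup F] {p : ℝ} {S T : Set 𝔼} (h : S ⊆ T)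
    (u : 𝔼 → F) : lpNorm p S u ≤ lpNorm p T u :=
  eLpNorm_mono_measure _ (Measure.restrict_mono h le_rfl)

theorem lpNorm_biUnion_le {F ι : Type*} [NormedAddCommGroup F] {p : ℝ} (hp : 1 ≤ p)
    (I : Finset ι) (S : ι → Set 𝔼) (u : 𝔼 → F) :
    lpNorm p (⋃ i ∈ I, S i) u ≤ ∑ i ∈ I, lpNorm p (S i) u := by
  have hp0 : 0 < p := by linarith
  rw [← ENNReal.rpow_le_rpow_iff hp0, ← lintegral_enorm_rpow_eq_lpNorm hp]
  refine (lintegral_biUnion_finset_le _ _ _ _).trans ?_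
  simp only [lintegral_enorm_rpow_eq_lpNorm hp]
  induction I using Finset.cons_induction with
  | empty => simp
  | cons i I hi ih =>
    rw [Finset.sum_cons, Finset.sum_cons]
    exact (add_le_add le_rfl ih).trans (ENNReal.add_rpow_le_rpow_add _ _ hp)

/-- The strip estimate for functions with vanishing trace. -/
theorem HasTrace.lpNorm_exitStrip_le (hn : 2 ≤ n) (hΩ : IsOpen Ω) {p : ℝ} (hp : 1 ≤ p) {u : 𝔼 → ℝ}
    (hu : HasTrace p Ω u (fun _ => 0)) {e : 𝔼} (he : ‖e‖ = 1) {δ : ℝ} (hδ : 0 < δ) :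
    lpNorm p (exitStrip Ω e δ) u ≤
      ENNReal.ofReal δ * lpNorm p (exitStrip Ω e δ) (weakGrad Ω u) := by
  obtain ⟨C, hC⟩ := exists_eLpNorm_exitStrip_le hn
  obtain ⟨hu1, -, v, hv, h1, h2⟩ := hu
  obtain ⟨h3, h4⟩ := (tendsto_w1Norm_sub_smooth_iff hΩ hp hu1.hasWeakGradient hv).1 h1
  have hvc : ∀ k, ContDiff ℝ 1 (v k) := fun k => (hv k).of_le (by simp)
  set U := exitStrip Ω e δ
  have hU : U ⊆ Ω := exitStrip_subset Ω e δ
  have hmono := Measure.restrict_mono hU (le_refl (volume : Measure 𝔼))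
  have m1 := hu1.memLp.aestronglyMeasurable.mono_measure hmono
  have m2 := hu1.memLp_grad.aestronglyMeasurable.mono_measure hmono
  have hle : ∀ k, lpNorm p U u ≤ lpNorm p Ω (fun x => u x - v k x) +
      ((C * ENNReal.ofReal δ) ^ (1 / p) * boundaryNorm p Ω (fun x => v k x - 0) +
        ENNReal.ofReal δ * (lpNorm p U (weakGrad Ω u) +
          lpNorm p Ω (fun x => weakGrad Ω u x - gradient (v k) x))) := by
    intro k
    have a1 : lpNorm p U u ≤ lpNorm p U (fun x => u x - v k x) + lpNorm p U (v k) := by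
      refine le_trans (le_of_eq ?_) (lpNorm_add_le hp
        (m1.sub (hvc k).continuous.aestronglyMeasurable)
        (hvc k).continuous.aestronglyMeasurable)
      simp
    have a3 : lpNorm p U (gradient (v k)) ≤ lpNorm p U (weakGrad Ω u) +
        lpNorm p U (fun x => weakGrad Ω u x - gradient (v k) x) := by
      rw [lpNorm_sub_comm (weakGrad Ω u)]
      refine le_trans (le_of_eq ?_) (lpNorm_add_le hp m2
        ((continuous_gradient (hvc k)).aestronglyMeasurable.sub m2))
      simp
    have a2 : boundaryNorm p Ω (v k) = boundaryNorm p Ω (fun x => v k x - 0) := by simp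
    refine a1.trans
      (add_le_add (lpNorm_mono_set hU _) ((hC Ω hΩ e he δ hδ p hp _ (hvc k)).trans ?_))
    rw [a2]
    gcongr
    exact a3.trans (add_le_add le_rfl (lpNorm_mono_set hU _))
  have hf1 : (C * ENNReal.ofReal δ) ^ (1 / p) ≠ ⊤ :=
    ENNReal.rpow_ne_top_of_nonneg (by positivity)
      (ENNReal.mul_ne_top ENNReal.coe_ne_top ENNReal.ofReal_ne_top)
  have hlim := h3.add ((ENNReal.Tendsto.const_mul h2 (.inr hf1)).add
    (ENNReal.Tendsto.const_mul ((tendsto_const_nhds (x := lpNorm p U (weakGrad Ω u))).add h4)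
      (.inr (ENNReal.ofReal_ne_top (r := δ)))))
  simpa using ge_of_tendsto' hlim hle

theorem tendsto_lpNorm_boundaryStrip (hn : 2 ≤ n) (hΩ : IsOpen Ω) (hb : Bornology.IsBounded Ω)
    {p : ℝ} (hp : 1 ≤ p) {G : 𝔼 → 𝔼}
    (hG : MemLp G (ENNReal.ofReal p) (volume.restrict Ω)) :
    Tendsto (fun ε => lpNorm p (boundaryStrip Ω ε) G) (𝓝[>] 0) (𝓝 0) := by
  have hp0 : 0 < p := by linarith
  have hfin : ∫⁻ x in Ω, ‖G x‖ₑ ^ p ≠ ⊤ := by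
    rw [lintegral_enorm_rpow_eq_lpNorm hp]
    exact ENNReal.rpow_ne_top_of_nonneg hp0.le hG.eLpNorm_ne_top
  have hlim : Tendsto (fun ε => ∫⁻ x in Ω, (boundaryStrip Ω ε).indicator (fun x => ‖G x‖ₑ ^ p) x)
      (𝓝[>] 0) (𝓝 (∫⁻ x in Ω, 0)) := by
    refine tendsto_lintegral_filter_of_dominated_convergence' (fun x => ‖G x‖ₑ ^ p)
      (.of_forall fun ε => ?_) (.of_forall fun ε => .of_forall fun x => ?_) hfin ?_
    · exact (hG.aestronglyMeasurable.enorm.pow_const p).indicator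
        (measurableSet_boundaryStrip hΩ ε)
    · exact Set.indicator_le_self _ _ x
    · refine (ae_restrict_iff' hΩ.measurableSet).2 (.of_forall fun x hx => ?_)
      refine tendsto_const_nhds.congr' ?_
      have hx0 := infDist_pos_of_mem hn hΩ hb hx
      filter_upwards [Ioo_mem_nhdsGT hx0] with ε hε
      rw [Set.indicator_of_notMem]
      exact fun h => absurd h.2 (not_le.2 hε.2)
  rw [lintegral_zero] at hlim
  have h2 := (ENNReal.continuous_rpow_const (y := 1 / p)).tendsto 0 |>.comp hlim
  rw [ENNReal.zero_rpow_of_pos (by positivity)] at h2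
  refine h2.congr fun ε => ?_
  have hS := measurableSet_boundaryStrip hΩ ε
  have hsub : boundaryStrip Ω ε ∩ Ω = boundaryStrip Ω ε :=
    Set.inter_eq_left.2 fun x hx => hx.1
  rw [Function.comp_apply, lintegral_indicator hS, Measure.restrict_restrict hS, hsub,
    lintegral_enorm_rpow_eq_lpNorm hp, ← ENNReal.rpow_mul, mul_one_div_cancel hp0.ne',
    ENNReal.rpow_one]

/-- Functions in `W^{1,p}(Ω)` with vanishing trace belong to `W^{1,p}_0(Ω)`. -/
theorem HasTrace.memW10 (hn : 2 ≤ n) (hΩ : IsBoundedLipschitzDomain Ω) {p : ℝ} (hp : 1 ≤ p)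
    {u : 𝔼 → ℝ} (hu : HasTrace p Ω u (fun _ => 0)) : MemW10 p Ω u := by
  have hu1 := hu.1
  set G := weakGrad Ω u
  have hw : HasWeakGradient Ω u G := hu1.hasWeakGradient
  have hO := hΩ.isOpen
  rw [memW10_iff hO hp hw hu1.memLp hu1.memLp_grad]
  intro ε hε
  obtain ⟨I, e, M, he, hM, hcov⟩ := exists_boundaryStrip_subset hn hΩ
  set N : ℝ≥0∞ := ((I.card : ℕ) : ℝ≥0∞)
  have hmul : ∀ c : ℝ, 0 < c → Tendsto (fun s : ℝ => c * s) (𝓝[>] 0) (𝓝[>] 0) := by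
    intro c hc
    refine tendsto_nhdsWithin_iff.2 ⟨?_, ?_⟩
    · have := ((by fun_prop : Continuous fun s : ℝ => c * s).tendsto 0).mono_left
        (nhdsWithin_le_nhds (s := Set.Ioi 0))
      simpa using this
    · filter_upwards [self_mem_nhdsWithin] with s hs
      have : (0 : ℝ) < s := hs
      exact show (0 : ℝ) < c * s by positivity
  -- on strips, `u` is controlled by the gradient
  have hstrip : ∀ᶠ s in 𝓝[>] (0 : ℝ), lpNorm p (boundaryStrip Ω (4 * s)) u ≤
      N * (ENNReal.ofReal (M * (4 * s)) * lpNorm p (boundaryStrip Ω (M * (4 * s))) G) := by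
    filter_upwards [(hmul 4 (by norm_num)).eventually hcov, self_mem_nhdsWithin] with s hs hs0
    have hs0' : (0 : ℝ) < s := hs0
    refine (lpNorm_mono_set hs _).trans ((lpNorm_biUnion_le hp _ _ _).trans ?_)
    rw [← nsmul_eq_mul]
    refine Finset.sum_le_card_nsmul _ _ _ fun z hz => ?_
    refine (hu.lpNorm_exitStrip_le hn hO hp (he z hz) (by positivity)).trans ?_
    gcongr
    exact lpNorm_mono_set (exitStrip_subset_boundaryStrip (he z hz) _) _
  have hGlim := tendsto_lpNorm_boundaryStrip hn hO hΩ.isBounded hp hu1.memLp_grad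
  have hlim : Tendsto (fun s : ℝ => lpNorm p (boundaryStrip Ω (4 * s)) G +
      N * ENNReal.ofReal (4 * M) * lpNorm p (boundaryStrip Ω (4 * M * s)) G) (𝓝[>] 0) (𝓝 0) := by
    have := (hGlim.comp (hmul 4 (by norm_num))).add (ENNReal.Tendsto.const_mul
      (a := N * ENNReal.ofReal (4 * M)) (hGlim.comp (hmul (4 * M) (by positivity)))
      (.inr (ENNReal.mul_ne_top (ENNReal.natCast_ne_top _) ENNReal.ofReal_ne_top)))
    simpa using this
  have hε2 : 0 < ε / 2 := ENNReal.half_pos hε.ne'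
  obtain ⟨s, hs1, hs2, hs0, hs3⟩ := (hstrip.and ((ENNReal.tendsto_nhds_zero.1 hlim _ hε2).and
    (Ioo_mem_nhdsGT (zero_lt_one' ℝ)))).exists
  -- cut off at scale `s`: the critical error `u ∇η` is at most `|u| / s` on the strip of width
  -- `4 s`, where `u` is of order `s` times the gradient
  obtain ⟨η, hη, hη01, hη1, hηg⟩ := exists_cutoff hΩ.isBounded hs0
  have hηc := hη.contDiff.continuous
  have hgc := continuous_gradient (hη.contDiff.of_le (m := 1) (by simp))
  obtain ⟨φ, hφ, a1, a2⟩ := exists_testFunction_approx hp hO hw hu1.memLp hu1.memLp_grad hη hε2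
  set S := boundaryStrip Ω (4 * s)
  have hSm : MeasurableSet S := measurableSet_boundaryStrip hO _
  have hind : ∀ {F : Type} [NormedAddCommGroup F] (w : 𝔼 → F),
      lpNorm p Ω (S.indicator w) ≤ lpNorm p S w := fun w => by
    rw [lpNorm, eLpNorm_indicator_eq_eLpNorm_restrict hSm, Measure.restrict_restrict hSm]
    exact lpNorm_mono_set Set.inter_subset_left w
  have hnot : ∀ x ∈ Ω, x ∉ S → 4 * s < Metric.infDist x Ωᶜ := fun x hx hxS => by
    by_contra hcon
    exact hxS ⟨hx, not_lt.1 hcon⟩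
  have hMs : ENNReal.ofReal (M * (4 * s)) ≤ ENNReal.ofReal (4 * M) :=
    ENNReal.ofReal_le_ofReal (by nlinarith)
  have hcomm : M * (4 * s) = 4 * M * s := by ring
  -- the two errors caused by the cutoff
  have b1 : lpNorm p Ω (fun x => u x - η x * u x) ≤ ε / 2 := by
    have hpt : lpNorm p Ω (fun x => u x - η x * u x) ≤ lpNorm p Ω (S.indicator u) := by
      refine eLpNorm_mono_ae ((ae_restrict_iff' hO.measurableSet).2 (.of_forall fun x hx => ?_))
      by_cases hxS : x ∈ S
      · rw [Set.indicator_of_mem hxS]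
        have e1 : u x - η x * u x = (1 - η x) * u x := by ring
        rw [e1, norm_mul, Real.norm_of_nonneg (by linarith [(hη01 x).2])]
        exact mul_le_of_le_one_left (norm_nonneg _) (by linarith [(hη01 x).1])
      · rw [(hη1 x (hnot x hx hxS)).1]
        simp
    refine (hpt.trans ((hind u).trans hs1)).trans (le_trans ?_ hs2)
    rw [← mul_assoc, hcomm]
    refine le_trans ?_ le_add_self
    exact mul_le_mul' (mul_le_mul' le_rfl (hcomm ▸ hMs)) le_rfl
  have b2 : lpNorm p Ω (fun x => G x - localizedGrad η u G x) ≤ ε / 2 := by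
    have hpt : lpNorm p Ω (fun x => G x - localizedGrad η u G x) ≤
        lpNorm p Ω (fun x => ‖S.indicator G x‖ + ‖(1 / s) • S.indicator u x‖) := by
      refine eLpNorm_mono_ae ((ae_restrict_iff' hO.measurableSet).2 (.of_forall fun x hx => ?_))
      by_cases hxS : x ∈ S
      · rw [Set.indicator_of_mem hxS, Set.indicator_of_mem hxS, Real.norm_of_nonneg (by positivity)]
        have e1 : G x - localizedGrad η u G x = (1 - η x) • G x - u x • gradient η x := by
          rw [localizedGrad, sub_smul, one_smul, sub_sub]
        rw [e1]
        refine (norm_sub_le _ _).trans (add_le_add ?_ ?_)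
        · rw [norm_smul, Real.norm_of_nonneg (by linarith [(hη01 x).2])]
          exact mul_le_of_le_one_left (norm_nonneg _) (by linarith [(hη01 x).1])
        · rw [norm_smul, norm_smul, Real.norm_of_nonneg (by positivity : 0 ≤ 1 / s), mul_comm]
          exact mul_le_mul_of_nonneg_right (hηg x) (norm_nonneg _)
      · obtain ⟨c1, c2⟩ := hη1 x (hnot x hx hxS)
        simp [localizedGrad, c1, c2, hxS]
    have hGm := (hu1.memLp_grad.aestronglyMeasurable.indicator hSm)
    have hum := (hu1.memLp.aestronglyMeasurable.indicator hSm)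
    refine (hpt.trans
      ((lpNorm_add_le hp hGm.norm (hum.const_smul (1 / s)).norm).trans ?_)).trans hs2
    have e1 : lpNorm p Ω (fun x => ‖S.indicator G x‖) = lpNorm p Ω (S.indicator G) := eLpNorm_norm _
    have e2 : lpNorm p Ω (fun x => ‖(1 / s) • S.indicator u x‖) =
        ‖1 / s‖ₑ * lpNorm p Ω (S.indicator u) := by
      rw [← lpNorm_const_smul]
      exact eLpNorm_norm _
    have e3 : lpNorm p Ω (fun x => ‖((1 / s) • S.indicator u) x‖) =
        ‖1 / s‖ₑ * lpNorm p Ω (S.indicator u) := e2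
    rw [e1, e3]
    refine add_le_add (hind G) ((mul_le_mul_right ((hind u).trans hs1) _).trans (le_of_eq ?_))
    have e4 : 1 / s * (4 * M * s) = 4 * M := by field_simp
    rw [hcomm, Real.enorm_of_nonneg (by positivity), mul_left_comm, ← mul_assoc (ENNReal.ofReal _),
      ← ENNReal.ofReal_mul (by positivity), e4, ← mul_assoc]
  have hlm : AEStronglyMeasurable (localizedGrad η u G) (volume.restrict Ω) :=
    (hηc.aestronglyMeasurable.smul hu1.memLp_grad.aestronglyMeasurable).add
      (hu1.memLp.aestronglyMeasurable.smul hgc.aestronglyMeasurable)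
  have hφc := hφ.contDiff.of_le (m := 1) (by simp)
  refine ⟨φ, hφ, ?_, ?_⟩
  · rw [← ENNReal.add_halves ε]
    exact (lpNorm_sub_le_add hp hu1.memLp.aestronglyMeasurable
      (hηc.aestronglyMeasurable.mul hu1.memLp.aestronglyMeasurable)
      hφc.continuous.aestronglyMeasurable).trans (add_le_add b1 a1)
  · rw [← ENNReal.add_halves ε]
    exact (lpNorm_sub_le_add hp hu1.memLp_grad.aestronglyMeasurable hlm
      (continuous_gradient hφc).aestronglyMeasurable).trans (add_le_add b2 a2)

/-! ### Pointwise inequalities for powers of the norm -/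

theorem norm_midpoint_rpow_le {r : ℝ} (hr : 1 ≤ r) (ξ η : 𝔼) :
    ‖(1 / 2 : ℝ) • (ξ + η)‖ ^ r ≤ ‖ξ‖ ^ r / 2 + ‖η‖ ^ r / 2 := by
  have h1 : ‖(1 / 2 : ℝ) • (ξ + η)‖ ≤ 1 / 2 * ‖ξ‖ + 1 / 2 * ‖η‖ := by
    rw [norm_smul, Real.norm_of_nonneg (by norm_num)]
    linarith [norm_add_le ξ η]
  have h2 := (convexOn_rpow hr).2 (norm_nonneg ξ) (norm_nonneg η)
    (by norm_num : (0 : ℝ) ≤ 1 / 2) (by norm_num : (0 : ℝ) ≤ 1 / 2) (by norm_num)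
  simp only [smul_eq_mul] at h2
  have h3 := Real.rpow_le_rpow (norm_nonneg _) h1 (by linarith : 0 ≤ r)
  linarith

theorem norm_midpoint_rpow_lt {p : ℝ} (hp : 1 < p) {ξ η : 𝔼} (h : ξ ≠ η) :
    ‖(1 / 2 : ℝ) • (ξ + η)‖ ^ p < ‖ξ‖ ^ p / 2 + ‖η‖ ^ p / 2 := by
  have h0 : (0 : ℝ) < 1 / 2 := by norm_num
  by_cases hn : ‖ξ‖ = ‖η‖
  · have h1 : ‖(1 / 2 : ℝ) • ξ + (1 / 2 : ℝ) • η‖ < ‖ξ‖ :=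
      norm_combo_lt_of_ne le_rfl hn.ge h h0 h0 (by norm_num)
    rw [← hn, smul_add]
    have := Real.rpow_lt_rpow (norm_nonneg _) h1 (by linarith : 0 < p)
    linarith
  · have h1 : ‖(1 / 2 : ℝ) • (ξ + η)‖ ≤ 1 / 2 * ‖ξ‖ + 1 / 2 * ‖η‖ := by
      rw [norm_smul, Real.norm_of_nonneg (by norm_num)]
      linarith [norm_add_le ξ η]
    have h2 := (strictConvexOn_rpow hp).2 (norm_nonneg ξ) (norm_nonneg η) hn h0 h0 (by norm_num)
    simp only [smul_eq_mul] at h2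
    have h3 := Real.rpow_le_rpow (norm_nonneg _) h1 (by linarith : 0 ≤ p)
    linarith

/-- Uniform convexity of `|·|^p`, in the form that makes minimizing sequences Cauchy. By
homogeneity it suffices to compare the two sides on a compact set. -/
theorem exists_norm_sub_rpow_le {p : ℝ} (hp : 1 < p) {ε : ℝ} (hε : 0 < ε) :
    ∃ C : ℝ, 0 ≤ C ∧ ∀ ξ η : 𝔼, ‖ξ - η‖ ^ p + C * ‖(1 / 2 : ℝ) • (ξ + η)‖ ^ p ≤
      ε * (‖ξ‖ ^ p + ‖η‖ ^ p) + C * (‖ξ‖ ^ p / 2 + ‖η‖ ^ p / 2) := by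
  have hp0 : 0 < p := by linarith
  set gap : 𝔼 × 𝔼 → ℝ := fun z =>
    ‖z.1‖ ^ p / 2 + ‖z.2‖ ^ p / 2 - ‖(1 / 2 : ℝ) • (z.1 + z.2)‖ ^ p
  have hpow : ∀ g : 𝔼 × 𝔼 → 𝔼, Continuous g → Continuous fun z => ‖g z‖ ^ p := fun g hg =>
    hg.norm.rpow_const fun _ => .inr hp0.le
  have hgap : Continuous gap :=
    (((hpow _ continuous_fst).div_const _).add ((hpow _ continuous_snd).div_const _)).sub
      (hpow _ (by fun_prop))
  have hdiff := hpow (fun z => z.1 - z.2) (by fun_prop)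
  set K : Set (𝔼 × 𝔼) := Metric.sphere 0 1 ∩
    {z | ε * (‖z.1‖ ^ p + ‖z.2‖ ^ p) ≤ ‖z.1 - z.2‖ ^ p}
  have hK : IsCompact K := (isCompact_sphere _ _).inter_right <| isClosed_le
    (((hpow _ continuous_fst).add (hpow _ continuous_snd)).const_mul ε) hdiff
  have hpos : ∀ z ∈ K, 0 < gap z := by
    rintro ⟨ξ, η⟩ ⟨h1, h2⟩
    refine sub_pos.2 (norm_midpoint_rpow_lt hp fun (h : ξ = η) => ?_)
    subst h
    have h2' : ε * (‖ξ‖ ^ p + ‖ξ‖ ^ p) ≤ ‖ξ - ξ‖ ^ p := h2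
    rw [sub_self, norm_zero, Real.zero_rpow hp0.ne'] at h2'
    have h3 : ‖ξ‖ = 1 := by simpa [Prod.norm_def] using h1
    rw [h3, Real.one_rpow] at h2'
    linarith
  obtain ⟨C, hC⟩ := hK.exists_bound_of_continuousOn
    (f := fun z => ‖z.1 - z.2‖ ^ p / gap z)
    (hdiff.continuousOn.div hgap.continuousOn fun z hz => (hpos z hz).ne')
  refine ⟨max C 0, le_max_right _ _, fun ξ η => ?_⟩
  have hg0 : 0 ≤ gap (ξ, η) := sub_nonneg.2 (norm_midpoint_rpow_le hp.le ξ η)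
  suffices h : ‖ξ - η‖ ^ p ≤ ε * (‖ξ‖ ^ p + ‖η‖ ^ p) + max C 0 * gap (ξ, η) by
    simp only [gap] at h
    linarith
  by_cases hcase : ‖ξ - η‖ ^ p < ε * (‖ξ‖ ^ p + ‖η‖ ^ p)
  · have := mul_nonneg (le_max_right C 0) hg0
    linarith
  have hcase' := not_lt.1 hcase
  by_cases hz : ‖(ξ, η)‖ = 0
  · obtain ⟨rfl, rfl⟩ : ξ = 0 ∧ η = 0 := Prod.mk_eq_zero.1 (norm_eq_zero.1 hz)
    simp [gap, Real.zero_rpow hp0.ne']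
  set ρ : ℝ := ‖(ξ, η)‖
  have hρ : 0 < ρ := lt_of_le_of_ne (norm_nonneg _) (Ne.symm hz)
  have hρp : 0 < ρ⁻¹ ^ p := Real.rpow_pos_of_pos (inv_pos.2 hρ) p
  have hs : ∀ w : 𝔼, ‖ρ⁻¹ • w‖ ^ p = ρ⁻¹ ^ p * ‖w‖ ^ p := fun w => by
    rw [norm_smul, Real.norm_of_nonneg (inv_pos.2 hρ).le,
      Real.mul_rpow (inv_pos.2 hρ).le (norm_nonneg _)]
  have e1 : ‖ρ⁻¹ • ξ - ρ⁻¹ • η‖ ^ p = ρ⁻¹ ^ p * ‖ξ - η‖ ^ p := by rw [← smul_sub, hs]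
  have e2 : gap (ρ⁻¹ • ξ, ρ⁻¹ • η) = ρ⁻¹ ^ p * gap (ξ, η) := by
    simp only [gap]
    rw [← smul_add, smul_comm, hs, hs, hs]
    ring
  have hmem : (ρ⁻¹ • ξ, ρ⁻¹ • η) ∈ K := by
    refine ⟨?_, ?_⟩
    · rw [mem_sphere_zero_iff_norm, ← Prod.smul_mk, norm_smul,
        Real.norm_of_nonneg (inv_pos.2 hρ).le]
      exact inv_mul_cancel₀ hρ.ne'
    · change ε * (‖ρ⁻¹ • ξ‖ ^ p + ‖ρ⁻¹ • η‖ ^ p) ≤ ‖ρ⁻¹ • ξ - ρ⁻¹ • η‖ ^ p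
      rw [e1, hs, hs]
      nlinarith
  have hb := (le_abs_self _).trans (hC _ hmem)
  have hg := hpos _ hmem
  change ‖ρ⁻¹ • ξ - ρ⁻¹ • η‖ ^ p / gap (ρ⁻¹ • ξ, ρ⁻¹ • η) ≤ C at hb
  rw [div_le_iff₀ hg, e1, e2] at hb
  have hb' : ‖ξ - η‖ ^ p ≤ C * gap (ξ, η) := by
    refine le_of_mul_le_mul_left ?_ hρp
    linarith
  have h5 : C * gap (ξ, η) ≤ max C 0 * gap (ξ, η) :=
    mul_le_mul_of_nonneg_right (le_max_left _ _) hg0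
  have h6 : 0 ≤ ε * (‖ξ‖ ^ p + ‖η‖ ^ p) := by positivity
  linarith

/-- `|η|^r ≥ |ξ|^r + r |ξ|^{r-2} ξ·(η - ξ)`. -/
theorem norm_rpow_add_inner_le {r : ℝ} (hr : 1 < r) (ξ η : 𝔼) :
    ‖ξ‖ ^ r + r * inner ℝ (‖ξ‖ ^ (r - 2) • ξ) (η - ξ) ≤ ‖η‖ ^ r := by
  by_cases h0 : ξ = 0
  · subst h0
    rw [norm_zero, Real.zero_rpow (by linarith)]
    simp only [smul_zero, inner_zero_left, mul_zero, add_zero]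
    positivity
  have hξ : 0 < ‖ξ‖ := norm_pos_iff.2 h0
  have hc : (r / (r - 1)).HolderConjugate r := by
    have := (Real.HolderConjugate.conjExponent hr).symm
    simpa [Real.conjExponent] using this
  have hy := Real.young_inequality_of_nonneg (Real.rpow_nonneg (norm_nonneg ξ) (r - 1))
    (norm_nonneg η) hc
  rw [← Real.rpow_mul (norm_nonneg _), mul_div_cancel₀ _ (by linarith : r - 1 ≠ 0)] at hy
  have e1 : inner ℝ (‖ξ‖ ^ (r - 2) • ξ) (η - ξ) =
      ‖ξ‖ ^ (r - 2) * inner ℝ ξ η - ‖ξ‖ ^ r := by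
    rw [real_inner_smul_left, inner_sub_right, real_inner_self_eq_norm_sq, mul_sub,
      ← Real.rpow_natCast, ← Real.rpow_add hξ]
    norm_num
  have e2 : ‖ξ‖ ^ (r - 2) * inner ℝ ξ η ≤ ‖ξ‖ ^ (r - 1) * ‖η‖ := by
    have : ‖ξ‖ ^ (r - 1) = ‖ξ‖ ^ (r - 2) * ‖ξ‖ := by
      rw [← Real.rpow_add_one hξ.ne']
      ring_nf
    rw [this, mul_assoc]
    exact mul_le_mul_of_nonneg_left (real_inner_le_norm ξ η) (by positivity)
  rw [e1]
  have hr0 : 0 < r := by linarith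
  have h3 : r * (‖ξ‖ ^ (r - 1) * ‖η‖) ≤ (r - 1) * ‖ξ‖ ^ r + ‖η‖ ^ r := by
    have := mul_le_mul_of_nonneg_left hy hr0.le
    have h4 : r * (‖ξ‖ ^ r / (r / (r - 1)) + ‖η‖ ^ r / r) = (r - 1) * ‖ξ‖ ^ r + ‖η‖ ^ r := by
      have : r - 1 ≠ 0 := by linarith
      field_simp
    linarith
  nlinarith [mul_le_mul_of_nonneg_left e2 hr0.le]

theorem abs_inner_norm_rpow_smul_le {r : ℝ} (ξ η : 𝔼) :
    |inner ℝ (‖ξ‖ ^ (r - 2) • ξ) η| ≤ ‖ξ‖ ^ (r - 1) * ‖η‖ := by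
  refine (abs_real_inner_le_norm _ _).trans (mul_le_mul_of_nonneg_right ?_ (norm_nonneg _))
  rw [norm_smul, Real.norm_of_nonneg (by positivity)]
  by_cases h0 : ξ = 0
  · subst h0
    simp only [norm_zero, mul_zero]
    positivity
  · rw [← Real.rpow_add_one (norm_ne_zero_iff.2 h0)]
    ring_nf
    exact le_rfl

theorem rpow_sub_one_mul_le {r x y z : ℝ} (hr : 1 < r) (hx : 0 ≤ x) (hy : 0 ≤ y) (hxz : x ≤ z)
    (hyz : y ≤ z) : x ^ (r - 1) * y ≤ z ^ r := by
  rcases (hy.trans hyz).eq_or_lt with rfl | hz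
  · rw [le_antisymm hyz hy, mul_zero]
    positivity
  calc x ^ (r - 1) * y ≤ z ^ (r - 1) * z :=
        mul_le_mul (Real.rpow_le_rpow hx hxz (by linarith)) hyz hy (by positivity)
    _ = z ^ r := by rw [← Real.rpow_add_one hz.ne']; ring_nf

theorem add_rpow_le_two_rpow_mul {r x y : ℝ} (hr : 1 ≤ r) (hx : 0 ≤ x) (hy : 0 ≤ y) :
    (x + y) ^ r ≤ 2 ^ r * (x ^ r + y ^ r) := by
  have h2 := (convexOn_rpow hr).2 hx hy
    (by norm_num : (0 : ℝ) ≤ 1 / 2) (by norm_num : (0 : ℝ) ≤ 1 / 2) (by norm_num)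
  simp only [smul_eq_mul] at h2
  have e : (x + y) ^ r = 2 ^ r * (1 / 2 * x + 1 / 2 * y) ^ r := by
    rw [← Real.mul_rpow (by norm_num) (by positivity)]
    ring_nf
  rw [e]
  refine mul_le_mul_of_nonneg_left (h2.trans ?_) (by positivity)
  have h3 : 0 ≤ x ^ r := by positivity
  have h4 : 0 ≤ y ^ r := by positivity
  linarith

theorem hasDerivAt_norm_add_smul_rpow {r : ℝ} (hr : 1 < r) (ξ η : 𝔼) (t : ℝ) :
    HasDerivAt (fun t : ℝ => ‖ξ + t • η‖ ^ r)
      (r * inner ℝ (‖ξ + t • η‖ ^ (r - 2) • (ξ + t • η)) η) t := by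
  have h1 : HasDerivAt (fun t : ℝ => ξ + t • η) η t := by
    simpa using ((hasDerivAt_id t).smul_const η).const_add ξ
  have h2 := (hasFDerivAt_norm_rpow (ξ + t • η) hr).comp_hasDerivAt t h1
  refine h2.congr_deriv ?_
  rw [real_inner_smul_left, smul_apply, innerSL_apply_apply, smul_eq_mul,
    mul_assoc]

/-! ### Convexity and lower semicontinuity of the energy -/

/-- The double phase integrand `|ξ|^p + (p/q) α |ξ|^q`. -/
noncomputable def phase (p q α : ℝ) (ξ : EuclideanSpace ℝ (Fin n)) : ℝ :=
  ‖ξ‖ ^ p + p / q * α * ‖ξ‖ ^ q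

/-- The functional `𝓕` as a function of the gradient field. -/
noncomputable def gradEnergy (p q : ℝ) (a : EuclideanSpace ℝ (Fin n) → ℝ)
    (Ω : Set (EuclideanSpace ℝ (Fin n)))
    (G : EuclideanSpace ℝ (Fin n) → EuclideanSpace ℝ (Fin n)) : ℝ≥0∞ :=
  ∫⁻ x in Ω, ENNReal.ofReal (phase p q (a x) (G x))

theorem gradEnergy_congr {p q : ℝ} {a : 𝔼 → ℝ} {G H : 𝔼 → 𝔼}
    (h : G =ᵐ[volume.restrict Ω] H) : gradEnergy p q a Ω G = gradEnergy p q a Ω H :=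
  lintegral_congr_ae (h.mono fun x hx => by simp only [hx])

theorem norm_rpow_le_phase {p q α : ℝ} (hp : 1 < p) (hpq : p ≤ q) (hα : 0 ≤ α) (ξ : 𝔼) :
    ‖ξ‖ ^ p ≤ phase p q α ξ := by
  have : 0 < p := by linarith
  have : 0 < q := by linarith
  have : 0 ≤ p / q * α * ‖ξ‖ ^ q := by positivity
  rw [phase]
  linarith

theorem phase_nonneg {p q α : ℝ} (hp : 1 < p) (hpq : p ≤ q) (hα : 0 ≤ α) (ξ : 𝔼) :
    0 ≤ phase p q α ξ :=
  (by positivity : 0 ≤ ‖ξ‖ ^ p).trans (norm_rpow_le_phase hp hpq hα ξ)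

theorem aemeasurable_phase {p q : ℝ} {a : 𝔼 → ℝ} {G : 𝔼 → 𝔼} {μ : Measure 𝔼}
    (ha : AEMeasurable a μ) (hG : AEStronglyMeasurable G μ) :
    AEMeasurable (fun x => ENNReal.ofReal (phase p q (a x) (G x))) μ := by
  have h := hG.norm.aemeasurable
  exact ((h.pow_const p).add ((ha.const_mul (p / q)).mul (h.pow_const q))).ennreal_ofReal

theorem ofReal_norm_rpow {F : Type*} [NormedAddCommGroup F] {p : ℝ} (hp : 0 ≤ p) (v : F) :
    ENNReal.ofReal (‖v‖ ^ p) = ‖v‖ₑ ^ p := by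
  rw [← ofReal_norm, ENNReal.ofReal_rpow_of_nonneg (norm_nonneg _) hp]

theorem lpNorm_rpow_le_gradEnergy {p q : ℝ} (hp : 1 < p) (hpq : p ≤ q) {a : 𝔼 → ℝ}
    (ha0 : ∀ᵐ x ∂(volume.restrict Ω), 0 ≤ a x) (G : 𝔼 → 𝔼) :
    lpNorm p Ω G ^ p ≤ gradEnergy p q a Ω G := by
  rw [← lintegral_enorm_rpow_eq_lpNorm hp.le]
  refine lintegral_mono_ae (ha0.mono fun x hx => ?_)
  rw [← ofReal_norm_rpow (by linarith)]
  exact ENNReal.ofReal_le_ofReal (norm_rpow_le_phase hp hpq hx _)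

/-- If two fields almost minimize `𝓕` and their midpoint does not go below the infimum `m`, then
they are close in `L^p`. -/
theorem exists_lpNorm_sub_le_of_gradEnergy_le {p q : ℝ} (hp : 1 < p) (hpq : p ≤ q) {a : 𝔼 → ℝ}
    (ha : AEMeasurable a (volume.restrict Ω)) (ha0 : ∀ᵐ x ∂(volume.restrict Ω), 0 ≤ a x)
    {m : ℝ≥0∞} (hm : m ≠ ⊤) {δ : ℝ≥0∞} (hδ : 0 < δ) :
    ∃ τ : ℝ≥0∞, 0 < τ ∧ ∀ G H : 𝔼 → 𝔼, AEStronglyMeasurable G (volume.restrict Ω) →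
      AEStronglyMeasurable H (volume.restrict Ω) → gradEnergy p q a Ω G ≤ m + τ →
      gradEnergy p q a Ω H ≤ m + τ →
      m ≤ gradEnergy p q a Ω (fun x => (1 / 2 : ℝ) • (G x + H x)) →
      lpNorm p Ω (fun x => G x - H x) ≤ δ := by
  have hp0 : 0 < p := by linarith
  have hq0 : 0 < q := by linarith
  obtain ⟨D, hD, hDδ⟩ : ∃ D : ℝ, 0 < D ∧ ENNReal.ofReal D ≤ δ ^ p := by
    have h1 : 0 < min (δ ^ p) 1 := lt_min (ENNReal.rpow_pos_of_nonneg hδ hp0.le) one_pos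
    have h2 : min (δ ^ p) 1 ≠ ⊤ := ((min_le_right _ _).trans_lt ENNReal.one_lt_top).ne
    exact ⟨_, ENNReal.toReal_pos h1.ne' h2, by
      rw [ENNReal.ofReal_toReal h2]; exact min_le_left _ _⟩
  set M := m.toReal
  have hM : 0 ≤ M := ENNReal.toReal_nonneg
  have hMm : m = ENNReal.ofReal M := (ENNReal.ofReal_toReal hm).symm
  set ε : ℝ := D / (4 * (M + 1))
  have hε : 0 < ε := by positivity
  obtain ⟨C, hC, hconv⟩ := exists_norm_sub_rpow_le (n := n) hp hε
  set τ : ℝ := min 1 (D / (2 * (C + 1)))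
  have hτ : 0 < τ := lt_min one_pos (by positivity)
  refine ⟨ENNReal.ofReal τ, ENNReal.ofReal_pos.2 hτ, fun G H hG hH eG eH emid => ?_⟩
  have hpt : ∀ᵐ x ∂(volume.restrict Ω), ENNReal.ofReal (‖G x - H x‖ ^ p) +
      ENNReal.ofReal C * ENNReal.ofReal (phase p q (a x) ((1 / 2 : ℝ) • (G x + H x))) ≤
      ENNReal.ofReal (ε + C / 2) * (ENNReal.ofReal (phase p q (a x) (G x)) +
        ENNReal.ofReal (phase p q (a x) (H x))) := by
    filter_upwards [ha0] with x hx
    have p1 := phase_nonneg hp hpq hx (G x)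
    have p2 := phase_nonneg hp hpq hx (H x)
    have p3 := phase_nonneg hp hpq hx ((1 / 2 : ℝ) • (G x + H x))
    rw [← ENNReal.ofReal_add p1 p2, ← ENNReal.ofReal_mul hC, ← ENNReal.ofReal_mul (by positivity),
      ← ENNReal.ofReal_add (by positivity) (by positivity)]
    refine ENNReal.ofReal_le_ofReal ?_
    have h1 := hconv (G x) (H x)
    have h2 := norm_midpoint_rpow_le (by linarith : 1 ≤ q) (G x) (H x)
    have h3 := mul_le_mul_of_nonneg_left h2 (by positivity : 0 ≤ C * (p / q * a x))
    have h4 : 0 ≤ ε * (p / q * a x * (‖G x‖ ^ q + ‖H x‖ ^ q)) := by positivity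
    simp only [phase]
    linarith
  have hint := lintegral_mono_ae hpt
  have hGH : AEMeasurable (fun x => ENNReal.ofReal (‖G x - H x‖ ^ p)) (volume.restrict Ω) :=
    ((hG.sub hH).norm.aemeasurable.pow_const p).ennreal_ofReal
  have hGm := aemeasurable_phase (p := p) (q := q) ha hG
  rw [lintegral_add_left' hGH, lintegral_const_mul' _ _ ENNReal.ofReal_ne_top,
    lintegral_const_mul' _ _ ENNReal.ofReal_ne_top,
    lintegral_add_left' hGm] at hint
  simp only [ofReal_norm_rpow hp0.le] at hint
  rw [lintegral_enorm_rpow_eq_lpNorm hp.le] at hint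
  have h1 : lpNorm p Ω (fun x => G x - H x) ^ p + ENNReal.ofReal (C * M) ≤
      ENNReal.ofReal D + ENNReal.ofReal (C * M) := by
    calc lpNorm p Ω (fun x => G x - H x) ^ p + ENNReal.ofReal (C * M)
        ≤ lpNorm p Ω (fun x => G x - H x) ^ p + ENNReal.ofReal C *
          gradEnergy p q a Ω (fun x => (1 / 2 : ℝ) • (G x + H x)) := by
          rw [ENNReal.ofReal_mul hC, ← hMm]
          exact add_le_add le_rfl (mul_le_mul' le_rfl emid)
      _ ≤ ENNReal.ofReal (ε + C / 2) * (gradEnergy p q a Ω G + gradEnergy p q a Ω H) := hint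
      _ ≤ ENNReal.ofReal (ε + C / 2) *
          (ENNReal.ofReal (M + τ) + ENNReal.ofReal (M + τ)) := by
          rw [ENNReal.ofReal_add hM hτ.le, ← hMm]
          exact mul_le_mul' le_rfl (add_le_add eG eH)
      _ ≤ ENNReal.ofReal D + ENNReal.ofReal (C * M) := by
          rw [← ENNReal.ofReal_add (by positivity) (by positivity),
            ← ENNReal.ofReal_mul (by positivity), ← ENNReal.ofReal_add hD.le (by positivity)]
          refine ENNReal.ofReal_le_ofReal ?_
          have t1 : τ ≤ 1 := min_le_left _ _
          have t2 : τ * (2 * (C + 1)) ≤ D := by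
            rw [← le_div_iff₀ (by positivity)]
            exact min_le_right _ _
          have t3 : ε * (4 * (M + 1)) = D := div_mul_cancel₀ _ (by positivity)
          nlinarith
  have h2 := (ENNReal.add_le_add_iff_right ENNReal.ofReal_ne_top).1 h1
  exact (ENNReal.rpow_le_rpow_iff hp0).1 (h2.trans hDδ)

/-- Lower semicontinuity of the energy, by Fatou's lemma along an almost everywhere convergent
subsequence. -/
theorem gradEnergy_le_of_tendsto {p q : ℝ} (hp : 1 < p) {a : 𝔼 → ℝ}
    (ha : AEMeasurable a (volume.restrict Ω)) {G : ℕ → 𝔼 → 𝔼} {H : 𝔼 → 𝔼}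
    (hG : ∀ k, AEStronglyMeasurable (G k) (volume.restrict Ω))
    (hH : AEStronglyMeasurable H (volume.restrict Ω))
    (hlim : Tendsto (fun k => lpNorm p Ω (fun x => G k x - H x)) atTop (𝓝 0)) {m : ℝ≥0∞}
    (hm : Tendsto (fun k => gradEnergy p q a Ω (G k)) atTop (𝓝 m)) (hq : 0 ≤ q) :
    gradEnergy p q a Ω H ≤ m := by
  have h1 : TendstoInMeasure (volume.restrict Ω) G atTop H :=
    tendstoInMeasure_of_tendsto_eLpNorm (p := ENNReal.ofReal p) (by simp; linarith) hG hH hlim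
  obtain ⟨ns, hns, hae⟩ := h1.exists_seq_tendsto_ae
  have hcont : ∀ α : ℝ, Continuous fun ξ : 𝔼 => ENNReal.ofReal (phase p q α ξ) := fun α => by
    have c1 : Continuous fun ξ : 𝔼 => ‖ξ‖ ^ p :=
      continuous_norm.rpow_const fun _ => .inr (by linarith)
    have c2 : Continuous fun ξ : 𝔼 => ‖ξ‖ ^ q := continuous_norm.rpow_const fun _ => .inr hq
    exact ENNReal.continuous_ofReal.comp (c1.add (c2.const_mul _))
  calc gradEnergy p q a Ω H
      = ∫⁻ x in Ω, liminf (fun k => ENNReal.ofReal (phase p q (a x) (G (ns k) x))) atTop :=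
        lintegral_congr_ae (hae.mono fun x hx =>
          ((((hcont (a x)).tendsto _).comp hx).liminf_eq).symm)
    _ ≤ liminf (fun k => gradEnergy p q a Ω (G (ns k))) atTop :=
        lintegral_liminf_le' fun k => aemeasurable_phase ha (hG _)
    _ = m := (hm.comp hns.tendsto_atTop).liminf_eq

/-! ### Existence and uniqueness of minimizers -/

theorem gradEnergy_le {p q : ℝ} (hp : 1 < p) (hpq : p ≤ q) {a : 𝔼 → ℝ}
    (ha0 : ∀ᵐ x ∂(volume.restrict Ω), 0 ≤ a x) {G : 𝔼 → 𝔼}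
    (hG : AEStronglyMeasurable G (volume.restrict Ω)) :
    gradEnergy p q a Ω G ≤
      lpNorm p Ω G ^ p + eLpNorm a ⊤ (volume.restrict Ω) * lpNorm q Ω G ^ q := by
  have hp0 : 0 < p := by linarith
  have hq0 : 0 < q := by linarith
  have hGp : AEMeasurable (fun x => ‖G x‖ₑ ^ p) (volume.restrict Ω) := hG.enorm.pow_const p
  have hGq : AEMeasurable (fun x => ‖G x‖ₑ ^ q) (volume.restrict Ω) := hG.enorm.pow_const q
  rw [← lintegral_enorm_rpow_eq_lpNorm hp.le, ← lintegral_enorm_rpow_eq_lpNorm (hp.le.trans hpq),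
    ← lintegral_const_mul'' _ hGq, ← lintegral_add_left' hGp]
  have hle := ae_le_eLpNormEssSup (f := a) (μ := volume.restrict Ω)
  refine lintegral_mono_ae ?_
  filter_upwards [ha0, hle] with x hx hx2
  have h1 : p / q ≤ 1 := (div_le_one hq0).2 hpq
  have h2 : phase p q (a x) (G x) ≤ ‖G x‖ ^ p + a x * ‖G x‖ ^ q := by
    have : p / q * a x ≤ a x := mul_le_of_le_one_left hx h1
    exact add_le_add le_rfl (mul_le_mul_of_nonneg_right this (by positivity))
  refine (ENNReal.ofReal_le_ofReal h2).trans ?_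
  rw [ENNReal.ofReal_add (by positivity) (by positivity), ENNReal.ofReal_mul hx,
    ofReal_norm_rpow hp0.le, ofReal_norm_rpow hq0.le, eLpNorm_exponent_top,
    ← Real.enorm_of_nonneg hx]
  exact add_le_add le_rfl (mul_le_mul' hx2 le_rfl)

theorem energy_ne_top (hb : Bornology.IsBounded Ω) {p q : ℝ} (hp : 1 < p) (hpq : p ≤ q)
    {a : 𝔼 → ℝ} (ha : MemLp a ⊤ (volume.restrict Ω))
    (ha0 : ∀ᵐ x ∂(volume.restrict Ω), 0 ≤ a x) {f : 𝔼 → ℝ} (hf : MemW1 q Ω f) :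
    energy p q a Ω f ≠ ⊤ := by
  have hfp := hf.mono_exponent hb hpq
  refine ((gradEnergy_le hp hpq ha0 hf.memLp_grad.aestronglyMeasurable).trans_lt ?_).ne
  exact ENNReal.add_lt_top.2 ⟨ENNReal.rpow_lt_top_of_nonneg (by linarith)
    hfp.memLp_grad.eLpNorm_ne_top, ENNReal.mul_lt_top ha.eLpNorm_lt_top
    (ENNReal.rpow_lt_top_of_nonneg (by linarith) hf.memLp_grad.eLpNorm_ne_top)⟩

theorem self_mem_admissible (hΩ : IsOpen Ω) (hb : Bornology.IsBounded Ω) {p : ℝ} (hp : 1 ≤ p)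
    (f : 𝔼 → ℝ) : f ∈ admissible p Ω f := by
  simpa [admissible] using MemW10.zero hΩ hb hp

theorem MemW1.of_mem_admissible (hΩ : IsOpen Ω) {p : ℝ} {f v : 𝔼 → ℝ} (hf : MemW1 p Ω f)
    (hv : v ∈ admissible p Ω f) : MemW1 p Ω v := by
  have hv' : MemW10 p Ω (fun x => v x - f x) := hv
  simpa using hv'.1.add hΩ hf

theorem MemW10.sub_of_mem_admissible (hΩ : IsOpen Ω) {p : ℝ} (hp : 1 ≤ p) {f v w : 𝔼 → ℝ}
    (hv : v ∈ admissible p Ω f) (hw : w ∈ admissible p Ω f) : MemW10 p Ω (fun x => v x - w x) := by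
  have hv' : MemW10 p Ω (fun x => v x - f x) := hv
  simpa using hv'.sub hΩ hp hw

theorem add_const_mul_mem_admissible (hΩ : IsOpen Ω) {p : ℝ} (hp : 1 ≤ p) {f v φ : 𝔼 → ℝ}
    (hv : v ∈ admissible p Ω f) (hφ : MemW10 p Ω φ) (t : ℝ) :
    (fun x => v x + t * φ x) ∈ admissible p Ω f := by
  have hv' : MemW10 p Ω (fun x => v x - f x) := hv
  have h := hv'.add hΩ hp (hφ.const_mul hΩ hp t)
  have e : (fun x => v x + t * φ x - f x) = fun x => v x - f x + t * φ x := by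
    funext x
    ring
  exact show MemW10 p Ω (fun x => v x + t * φ x - f x) from e ▸ h

theorem weakGrad_add_const_mul_ae_eq (hΩ : IsOpen Ω) {p q : ℝ} {u v : 𝔼 → ℝ} (hu : MemW1 p Ω u)
    (hv : MemW1 q Ω v) (t : ℝ) : weakGrad Ω (fun x => u x + t * v x)
      =ᵐ[volume.restrict Ω] fun x => weakGrad Ω u x + t • weakGrad Ω v x :=
  (hu.hasWeakGradient.add (hv.hasWeakGradient.const_smul t)).weakGrad_ae_eq hΩ

/-- The infimum of `𝓕` bounds the energy of the midpoint of the gradients of two competitors. -/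
theorem le_gradEnergy_midpoint (hΩ : IsOpen Ω) {p q : ℝ} (hp : 1 ≤ p) {a : 𝔼 → ℝ}
    {f v w : 𝔼 → ℝ} (hf : MemW1 p Ω f) (hv : v ∈ admissible p Ω f) (hw : w ∈ admissible p Ω f)
    {m : ℝ≥0∞} (hm : ∀ u ∈ admissible p Ω f, m ≤ energy p q a Ω u) :
    m ≤ gradEnergy p q a Ω (fun x => (1 / 2 : ℝ) • (weakGrad Ω v x + weakGrad Ω w x)) := by
  have hwv := MemW10.sub_of_mem_admissible hΩ hp hw hv
  have hv1 := hf.of_mem_admissible hΩ hv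
  have hw1 := hf.of_mem_admissible hΩ hw
  refine (hm _ (add_const_mul_mem_admissible hΩ hp hv hwv (1 / 2))).trans (le_of_eq ?_)
  refine gradEnergy_congr ?_
  filter_upwards [weakGrad_add_const_mul_ae_eq hΩ hv1 hwv.1 (1 / 2),
    weakGrad_sub_ae_eq hΩ hw1 hv1] with x h1 h2
  rw [h1, h2]
  module

/-- Existence of minimizers by the direct method: by uniform convexity, minimizing sequences
converge strongly in `W^{1,p}`. -/
theorem exists_isMinimizer (hn : 2 ≤ n) (hΩ : IsOpen Ω) (hb : Bornology.IsBounded Ω) {p q : ℝ}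
    (hp : 1 < p) (hpq : p ≤ q) {a : 𝔼 → ℝ} (ha : MemLp a ⊤ (volume.restrict Ω))
    (ha0 : ∀ᵐ x ∂(volume.restrict Ω), 0 ≤ a x) {f : 𝔼 → ℝ} (hf : MemW1 q Ω f) :
    ∃ u, IsMinimizer p q a Ω f u := by
  have ham := ha.aestronglyMeasurable.aemeasurable
  have hfp := hf.mono_exponent hb hpq
  have hfM := self_mem_admissible hΩ hb hp.le f
  set m : ℝ≥0∞ := ⨅ v ∈ admissible p Ω f, energy p q a Ω v
  have hmle : ∀ v ∈ admissible p Ω f, m ≤ energy p q a Ω v := fun v hv => iInf₂_le v hv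
  have hm : m ≠ ⊤ := ((hmle f hfM).trans_lt (energy_ne_top hb hp hpq ha ha0 hf).lt_top).ne
  have hseq : ∀ k : ℕ, ∃ v ∈ admissible p Ω f, energy p q a Ω v < m + (k : ℝ≥0∞)⁻¹ := fun k => by
    have h1 : m < m + (k : ℝ≥0∞)⁻¹ := ENNReal.lt_add_right hm (by simp)
    simpa only [m, iInf_lt_iff, exists_prop] using h1
  choose v hvM hvE using hseq
  have hv1 : ∀ k, MemW1 p Ω (v k) := fun k => hfp.of_mem_admissible hΩ (hvM k)
  have hw : ∀ k, MemW10 p Ω (fun x => v k x - f x) := fun k => hvM k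
  have hwg : ∀ k, weakGrad Ω (fun x => v k x - f x) =ᵐ[volume.restrict Ω]
      fun x => weakGrad Ω (v k) x - weakGrad Ω f x := fun k => weakGrad_sub_ae_eq hΩ (hv1 k) hfp
  -- the gradients form a Cauchy sequence
  have hcau : ∀ ε : ℝ≥0∞, 0 < ε → ∃ N, ∀ k ≥ N, ∀ l ≥ N,
      lpNorm p Ω (fun x => weakGrad Ω (v k) x - weakGrad Ω (v l) x) ≤ ε := by
    intro ε hε
    obtain ⟨τ, hτ, hmod⟩ := exists_lpNorm_sub_le_of_gradEnergy_le hp hpq ham ha0 hm hε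
    obtain ⟨N, hN⟩ := (ENNReal.tendsto_atTop_zero.1 ENNReal.tendsto_inv_nat_nhds_zero) τ hτ
    refine ⟨N, fun k hk l hl => hmod _ _ (hv1 k).memLp_grad.aestronglyMeasurable
      (hv1 l).memLp_grad.aestronglyMeasurable ((hvE k).le.trans (add_le_add le_rfl (hN k hk)))
      ((hvE l).le.trans (add_le_add le_rfl (hN l hl)))
      (le_gradEnergy_midpoint hΩ hp.le hfp (hvM k) (hvM l) hmle)⟩
  obtain ⟨H, hH, hHlim⟩ := exists_tendsto_eLpNorm_of_cauchy (one_le_ofReal hp.le)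
    (fun k => (hw k).1.memLp_grad) fun ε hε => by
      obtain ⟨N, hN⟩ := hcau ε hε
      refine ⟨N, fun k hk l hl => le_trans (le_of_eq ?_) (hN k hk l hl)⟩
      refine eLpNorm_congr_ae ?_
      filter_upwards [hwg k, hwg l] with x h1 h2
      rw [h1, h2]
      abel
  -- by Poincaré's inequality, so do the functions themselves
  obtain ⟨C, hC⟩ := exists_lpNorm_le_of_memW10 hn hΩ hb hp.le
  obtain ⟨w, hwL, hwlim⟩ := exists_tendsto_eLpNorm_of_cauchy (one_le_ofReal hp.le)
    (fun k => (hw k).1.memLp) fun ε hε => by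
      obtain ⟨N, hN⟩ := hcau (ε / (C + 1)) (ENNReal.div_pos hε.ne' (by finiteness))
      refine ⟨N, fun k hk l hl => ?_⟩
      have h1 := hC _ ((hw k).sub hΩ hp.le (hw l))
      refine h1.trans ?_
      have h2 : lpNorm p Ω (weakGrad Ω fun x => v k x - f x - (v l x - f x)) ≤ ε / (C + 1) := by
        refine le_trans (le_of_eq (lpNorm_congr ?_)) (hN k hk l hl)
        filter_upwards [weakGrad_sub_ae_eq hΩ (hw k).1 (hw l).1, hwg k, hwg l] with x h0 h1 h2
        rw [h0, h1, h2]
        abel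
      calc (C : ℝ≥0∞) * lpNorm p Ω (weakGrad Ω fun x => v k x - f x - (v l x - f x))
          ≤ (C + 1) * (ε / (C + 1)) := mul_le_mul' le_self_add h2
        _ ≤ ε := ENNReal.mul_div_le
  -- the limit is admissible, and by lower semicontinuity its energy is the infimum
  obtain ⟨hwH, hw0⟩ := memW10_of_tendsto hΩ hb hp.le hw hwL hH hwlim hHlim
  have huM : (fun x => w x + f x) ∈ admissible p Ω f := by
    simpa [admissible] using hw0
  refine ⟨_, huM, fun z hz => ?_⟩
  refine le_trans ?_ (hmle z hz)
  have hug : weakGrad Ω (fun x => w x + f x) =ᵐ[volume.restrict Ω]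
      fun x => H x + weakGrad Ω f x := (hwH.add hfp.hasWeakGradient).weakGrad_ae_eq hΩ
  have hE : Tendsto (fun k => energy p q a Ω (v k)) atTop (𝓝 m) := by
    refine tendsto_of_tendsto_of_tendsto_of_le_of_le tendsto_const_nhds ?_
      (fun k => hmle _ (hvM k)) fun k => (hvE k).le
    simpa using (tendsto_const_nhds (x := m)).add ENNReal.tendsto_inv_nat_nhds_zero
  have hu1 := hfp.of_mem_admissible hΩ huM
  refine gradEnergy_le_of_tendsto hp ham (fun k => (hv1 k).memLp_grad.aestronglyMeasurable)
    hu1.memLp_grad.aestronglyMeasurable ?_ hE (by linarith)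
  refine hHlim.congr fun k => eLpNorm_congr_ae ?_
  filter_upwards [hug, hwg k] with x h1 h2
  rw [h1, h2]
  abel

theorem ae_eq_of_weakGrad_sub_eq_zero (hn : 2 ≤ n) (hΩ : IsOpen Ω) (hb : Bornology.IsBounded Ω)
    {p : ℝ} (hp : 1 ≤ p) {u v : 𝔼 → ℝ} (h : MemW10 p Ω (fun x => u x - v x))
    (hg : lpNorm p Ω (weakGrad Ω fun x => u x - v x) = 0) : u =ᵐ[volume.restrict Ω] v := by
  obtain ⟨C, hC⟩ := exists_lpNorm_le_of_memW10 hn hΩ hb hp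
  have h0 := hC _ h
  rw [hg, mul_zero, nonpos_iff_eq_zero, lpNorm,
    eLpNorm_eq_zero_iff h.1.memLp.aestronglyMeasurable (by simp; linarith)] at h0
  exact h0.mono fun x hx => sub_eq_zero.1 hx

/-- Uniqueness of the minimizer: two minimizers are almost minimizers to any precision, so that
uniform convexity makes their gradients equal, and Poincaré's inequality the functions. -/
theorem IsMinimizer.ae_eq (hn : 2 ≤ n) (hΩ : IsOpen Ω) (hb : Bornology.IsBounded Ω) {p q : ℝ}
    (hp : 1 < p) (hpq : p ≤ q) {a : 𝔼 → ℝ} (ha : MemLp a ⊤ (volume.restrict Ω))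
    (ha0 : ∀ᵐ x ∂(volume.restrict Ω), 0 ≤ a x) {f : 𝔼 → ℝ} (hf : MemW1 q Ω f) {u w : 𝔼 → ℝ}
    (hu : IsMinimizer p q a Ω f u) (hw : IsMinimizer p q a Ω f w) :
    w =ᵐ[volume.restrict Ω] u := by
  have ham := ha.aestronglyMeasurable.aemeasurable
  have hfp := hf.mono_exponent hb hpq
  have hu1 := hfp.of_mem_admissible hΩ hu.1
  have hw1 := hfp.of_mem_admissible hΩ hw.1
  have hm : energy p q a Ω u ≠ ⊤ :=
    ((hu.2 (self_mem_admissible hΩ hb hp.le f)).trans_lt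
      (energy_ne_top hb hp hpq ha ha0 hf).lt_top).ne
  refine ae_eq_of_weakGrad_sub_eq_zero hn hΩ hb hp.le
    (MemW10.sub_of_mem_admissible hΩ hp.le hw.1 hu.1) ?_
  rw [lpNorm_congr (weakGrad_sub_ae_eq hΩ hw1 hu1)]
  refine le_antisymm (le_of_forall_gt fun δ hδ => ?_) bot_le
  obtain ⟨δ', hδ'0, hδ'⟩ := exists_between hδ
  obtain ⟨τ, -, hmod⟩ := exists_lpNorm_sub_le_of_gradEnergy_le hp hpq ham ha0 hm hδ'0
  exact (hmod _ _ hw1.memLp_grad.aestronglyMeasurable hu1.memLp_grad.aestronglyMeasurable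
    ((hw.2 hu.1).trans le_self_add) le_self_add
    (le_gradEnergy_midpoint hΩ hp.le hfp hw.1 hu.1 fun z hz => hu.2 hz)).trans_lt hδ'

/-! ### The Euler–Lagrange equation -/

/-- The double phase flux `|ξ|^{p-2} ξ + α |ξ|^{q-2} ξ`. -/
noncomputable def flux (p q α : ℝ) (ξ : EuclideanSpace ℝ (Fin n)) : EuclideanSpace ℝ (Fin n) :=
  ‖ξ‖ ^ (p - 2) • ξ + (α * ‖ξ‖ ^ (q - 2)) • ξ

theorem inner_flux (p q α : ℝ) (ξ η : 𝔼) : inner ℝ (flux p q α ξ) η =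
    inner ℝ (‖ξ‖ ^ (p - 2) • ξ) η + α * inner ℝ (‖ξ‖ ^ (q - 2) • ξ) η := by
  rw [flux, inner_add_left, mul_smul, real_inner_smul_left _ _ α]

theorem hasDerivAt_phase {p q : ℝ} (hp : 1 < p) (hpq : p ≤ q) (α : ℝ) (ξ η : 𝔼) (t : ℝ) :
    HasDerivAt (fun t : ℝ => phase p q α (ξ + t • η))
      (p * inner ℝ (flux p q α (ξ + t • η)) η) t := by
  have hq : 1 < q := hp.trans_le hpq
  refine ((hasDerivAt_norm_add_smul_rpow hp ξ η t).add
    ((hasDerivAt_norm_add_smul_rpow hq ξ η t).const_mul (p / q * α))).congr_deriv ?_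
  rw [inner_flux]
  field_simp

/-- The integrand is convex in `ξ`, with gradient `p` times the flux. -/
theorem phase_add_inner_le {p q α : ℝ} (hp : 1 < p) (hpq : p ≤ q) (hα : 0 ≤ α) (ξ η : 𝔼) :
    phase p q α ξ + p * inner ℝ (flux p q α ξ) (η - ξ) ≤ phase p q α η := by
  have hq : 1 < q := hp.trans_le hpq
  have h1 := norm_rpow_add_inner_le hp ξ η
  have h2 := mul_le_mul_of_nonneg_left (norm_rpow_add_inner_le hq ξ η)
    (by positivity : 0 ≤ p / q * α)
  have e : p / q * α * (q * inner ℝ (‖ξ‖ ^ (q - 2) • ξ) (η - ξ)) =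
      p * (α * inner ℝ (‖ξ‖ ^ (q - 2) • ξ) (η - ξ)) := by field_simp
  rw [inner_flux]
  simp only [phase]
  rw [mul_add, e] at h2
  linarith

/-- This bound dominates the derivative of the integrand along a line, uniformly in the parameter.
-/
theorem abs_inner_flux_le {p q α z : ℝ} (hp : 1 < p) (hpq : p ≤ q) (hα : 0 ≤ α) {ξ η : 𝔼}
    (hξ : ‖ξ‖ ≤ z) (hη : ‖η‖ ≤ z) : |inner ℝ (flux p q α ξ) η| ≤ z ^ p + α * z ^ q := by
  have h : ∀ r : ℝ, 1 < r → |inner ℝ (‖ξ‖ ^ (r - 2) • ξ) η| ≤ z ^ r := fun r hr =>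
    (abs_inner_norm_rpow_smul_le ξ η).trans
      (rpow_sub_one_mul_le hr (norm_nonneg _) (norm_nonneg _) hξ hη)
  rw [inner_flux]
  refine (abs_add_le _ _).trans (add_le_add (h p hp) ?_)
  rw [abs_mul, abs_of_nonneg hα]
  exact mul_le_mul_of_nonneg_left (h q (hp.trans_le hpq)) hα

theorem aestronglyMeasurable_phase {p q : ℝ} {a : 𝔼 → ℝ} {G : 𝔼 → 𝔼} {μ : Measure 𝔼}
    (ha : AEMeasurable a μ) (hG : AEStronglyMeasurable G μ) :
    AEStronglyMeasurable (fun x => phase p q (a x) (G x)) μ := by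
  have h := hG.norm.aemeasurable
  exact ((h.pow_const p).add
    ((ha.const_mul (p / q)).mul (h.pow_const q))).aestronglyMeasurable

theorem aestronglyMeasurable_inner_flux {p q : ℝ} {a : 𝔼 → ℝ} {G ψ : 𝔼 → 𝔼} {μ : Measure 𝔼}
    (ha : AEMeasurable a μ) (hG : AEStronglyMeasurable G μ) (hψ : AEStronglyMeasurable ψ μ) :
    AEStronglyMeasurable (fun x => inner ℝ (flux p q (a x) (G x)) (ψ x)) μ := by
  have h := hG.norm.aemeasurable
  exact (((h.pow_const (p - 2)).aestronglyMeasurable.smul hG).add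
    ((ha.mul (h.pow_const (q - 2))).aestronglyMeasurable.smul hG)).inner hψ

theorem integrable_norm_rpow {F : Type*} [NormedAddCommGroup F] {p : ℝ} (hp : 1 < p)
    {G : 𝔼 → F} {μ : Measure 𝔼} (hG : MemLp G (ENNReal.ofReal p) μ) :
    Integrable (fun x => ‖G x‖ ^ p) μ := by
  have h := hG.integrable_norm_rpow (by simp; linarith) ENNReal.ofReal_ne_top
  rwa [ENNReal.toReal_ofReal (by linarith)] at h

theorem integrable_phase {p q : ℝ} (hp : 1 < p) {a : 𝔼 → ℝ} {G : 𝔼 → 𝔼} {μ : Measure 𝔼}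
    (hG : MemLp G (ENNReal.ofReal p) μ) (hGa : Integrable (fun x => a x * ‖G x‖ ^ q) μ) :
    Integrable (fun x => phase p q (a x) (G x)) μ := by
  refine ((integrable_norm_rpow hp hG).add (hGa.const_mul (p / q))).congr (.of_forall fun x => ?_)
  simp [phase, mul_assoc]

theorem gradEnergy_eq_ofReal_integral {p q : ℝ} (hp : 1 < p) (hpq : p ≤ q) {a : 𝔼 → ℝ} {G : 𝔼 → 𝔼}
    (ha0 : ∀ᵐ x ∂(volume.restrict Ω), 0 ≤ a x)
    (hG : Integrable (fun x => phase p q (a x) (G x)) (volume.restrict Ω)) :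
    gradEnergy p q a Ω G = ENNReal.ofReal (∫ x in Ω, phase p q (a x) (G x)) :=
  (ofReal_integral_eq_lintegral_ofReal hG
    (ha0.mono fun _ hx => phase_nonneg hp hpq hx _)).symm

theorem integrable_weight_of_gradEnergy_ne_top {p q : ℝ} (hp : 1 < p) (hpq : p ≤ q) {a : 𝔼 → ℝ}
    {G : 𝔼 → 𝔼} (ha : AEMeasurable a (volume.restrict Ω))
    (ha0 : ∀ᵐ x ∂(volume.restrict Ω), 0 ≤ a x) (hG : AEStronglyMeasurable G (volume.restrict Ω))
    (hE : gradEnergy p q a Ω G ≠ ⊤) :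
    Integrable (fun x => a x * ‖G x‖ ^ q) (volume.restrict Ω) := by
  have h1 : Integrable (fun x => phase p q (a x) (G x)) (volume.restrict Ω) :=
    lintegral_ofReal_ne_top_iff_integrable (aestronglyMeasurable_phase ha hG)
      (ha0.mono fun _ hx => phase_nonneg hp hpq hx _) |>.1 hE
  refine (h1.const_mul (q / p)).mono'
    (ha.mul (hG.norm.aemeasurable.pow_const q)).aestronglyMeasurable (ha0.mono fun x hx => ?_)
  have hq : 1 < q := hp.trans_le hpq
  rw [Real.norm_of_nonneg (by positivity), phase]
  have e : q / p * (‖G x‖ ^ p + p / q * a x * ‖G x‖ ^ q) =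
      q / p * ‖G x‖ ^ p + a x * ‖G x‖ ^ q := by field_simp
  rw [e]
  have : 0 ≤ q / p * ‖G x‖ ^ p := by positivity
  linarith

theorem integrable_add_rpow {p q : ℝ} (hp : 1 < p) (hpq : p ≤ q) {a : 𝔼 → ℝ} {G ψ : 𝔼 → 𝔼}
    {μ : Measure 𝔼} (ha : AEMeasurable a μ) (ha0 : ∀ᵐ x ∂μ, 0 ≤ a x)
    (hG : MemLp G (ENNReal.ofReal p) μ) (hψ : MemLp ψ (ENNReal.ofReal p) μ)
    (hGa : Integrable (fun x => a x * ‖G x‖ ^ q) μ)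
    (hψa : Integrable (fun x => a x * ‖ψ x‖ ^ q) μ) :
    Integrable (fun x => (‖G x‖ + ‖ψ x‖) ^ p + a x * (‖G x‖ + ‖ψ x‖) ^ q) μ := by
  have hq : 1 < q := hp.trans_le hpq
  have hm := (hG.aestronglyMeasurable.norm.add hψ.aestronglyMeasurable.norm).aemeasurable
  refine Integrable.add ?_ ?_
  · refine (integrable_norm_rpow hp (hG.norm.add hψ.norm)).congr (.of_forall fun x => ?_)
    have : 0 ≤ ‖G x‖ + ‖ψ x‖ := by positivity
    simp only [Pi.add_apply, Real.norm_of_nonneg this]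
  · refine ((hGa.add hψa).const_mul (2 ^ q)).mono'
      (ha.mul (hm.pow_const q)).aestronglyMeasurable (ha0.mono fun x hx => ?_)
    rw [Real.norm_of_nonneg (by positivity)]
    have h := mul_le_mul_of_nonneg_left
      (add_rpow_le_two_rpow_mul hq.le (norm_nonneg (G x)) (norm_nonneg (ψ x))) hx
    simp only [Pi.add_apply]
    linarith

theorem norm_add_smul_le {t : ℝ} (ht : |t| ≤ 1) (ξ η : 𝔼) : ‖ξ + t • η‖ ≤ ‖ξ‖ + ‖η‖ := by
  refine (norm_add_le _ _).trans (add_le_add le_rfl ?_)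
  rw [norm_smul]
  exact mul_le_of_le_one_left (norm_nonneg _) ht

theorem integrable_phase_add_smul {p q : ℝ} (hp : 1 < p) (hpq : p ≤ q) {a : 𝔼 → ℝ}
    {G ψ : 𝔼 → 𝔼} {μ : Measure 𝔼} (ha : AEMeasurable a μ) (ha0 : ∀ᵐ x ∂μ, 0 ≤ a x)
    (hG : MemLp G (ENNReal.ofReal p) μ) (hψ : MemLp ψ (ENNReal.ofReal p) μ)
    (hGa : Integrable (fun x => a x * ‖G x‖ ^ q) μ)
    (hψa : Integrable (fun x => a x * ‖ψ x‖ ^ q) μ) {t : ℝ} (ht : |t| ≤ 1) :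
    Integrable (fun x => phase p q (a x) (G x + t • ψ x)) μ := by
  have hq : 1 < q := hp.trans_le hpq
  refine (integrable_add_rpow hp hpq ha ha0 hG hψ hGa hψa).mono' (aestronglyMeasurable_phase ha
    (hG.aestronglyMeasurable.add (hψ.aestronglyMeasurable.const_smul t)))
    (ha0.mono fun x hx => ?_)
  rw [Real.norm_of_nonneg (phase_nonneg hp hpq hx _), phase]
  have h1 := Real.rpow_le_rpow (norm_nonneg _) (norm_add_smul_le ht (G x) (ψ x))
    (by linarith : 0 ≤ p)
  have h2 := Real.rpow_le_rpow (norm_nonneg _) (norm_add_smul_le ht (G x) (ψ x))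
    (by linarith : 0 ≤ q)
  have h3 : p / q * a x ≤ a x := mul_le_of_le_one_left hx ((div_le_one (by linarith)).2 hpq)
  exact add_le_add h1 (mul_le_mul h3 h2 (by positivity) hx)

/-- Differentiation of the energy under the integral sign. -/
theorem hasDerivAt_integral_phase {p q : ℝ} (hp : 1 < p) (hpq : p ≤ q) {a : 𝔼 → ℝ}
    {G ψ : 𝔼 → 𝔼} {μ : Measure 𝔼} (ha : AEMeasurable a μ) (ha0 : ∀ᵐ x ∂μ, 0 ≤ a x)
    (hG : MemLp G (ENNReal.ofReal p) μ) (hψ : MemLp ψ (ENNReal.ofReal p) μ)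
    (hGa : Integrable (fun x => a x * ‖G x‖ ^ q) μ)
    (hψa : Integrable (fun x => a x * ‖ψ x‖ ^ q) μ) :
    HasDerivAt (fun t : ℝ => ∫ x, phase p q (a x) (G x + t • ψ x) ∂μ)
      (∫ x, p * inner ℝ (flux p q (a x) (G x)) (ψ x) ∂μ) 0 := by
  have hGm := hG.aestronglyMeasurable
  have hψm := hψ.aestronglyMeasurable
  have hbound := (integrable_add_rpow hp hpq ha ha0 hG hψ hGa hψa).const_mul p
  set F' : ℝ → 𝔼 → ℝ := fun t x => p * inner ℝ (flux p q (a x) (G x + t • ψ x)) (ψ x) with hF'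
  have hF'm : AEStronglyMeasurable (F' 0) μ :=
    (aestronglyMeasurable_inner_flux ha (hGm.add (hψm.const_smul (0 : ℝ))) hψm).const_mul p
  have hle : ∀ᵐ x ∂μ, ∀ t ∈ Metric.ball (0 : ℝ) 1,
      ‖F' t x‖ ≤ p * ((‖G x‖ + ‖ψ x‖) ^ p + a x * (‖G x‖ + ‖ψ x‖) ^ q) := by
    refine ha0.mono fun x hx t ht => ?_
    rw [hF', norm_mul, Real.norm_of_nonneg (by linarith), Real.norm_eq_abs]
    exact mul_le_mul_of_nonneg_left (abs_inner_flux_le hp hpq hx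
      (norm_add_smul_le (mem_ball_zero_iff.1 ht).le (G x) (ψ x))
      (le_add_of_nonneg_left (norm_nonneg _))) (by linarith)
  have hd : ∀ᵐ x ∂μ, ∀ t ∈ Metric.ball (0 : ℝ) 1,
      HasDerivAt (fun t : ℝ => phase p q (a x) (G x + t • ψ x)) (F' t x) t :=
    .of_forall fun x t _ => hasDerivAt_phase hp hpq (a x) (G x) (ψ x) t
  have hm : ∀ᶠ t : ℝ in 𝓝 0, AEStronglyMeasurable (fun x => phase p q (a x) (G x + t • ψ x)) μ :=
    .of_forall fun t => aestronglyMeasurable_phase ha (hGm.add (hψm.const_smul t))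
  have hi : Integrable (fun x => phase p q (a x) (G x + (0 : ℝ) • ψ x)) μ :=
    integrable_phase_add_smul hp hpq ha ha0 hG hψ hGa hψa (by simp)
  have h := (hasDerivAt_integral_of_dominated_loc_of_deriv_le (Metric.ball_mem_nhds 0 one_pos) hm
    hi hF'm hle hbound hd).2
  refine h.congr_deriv (integral_congr_ae (.of_forall fun x => ?_))
  simp only [hF', zero_smul, add_zero]

/-- Minimality of `𝓕` at `G` along the line `G + tψ` yields the Euler–Lagrange equation tested
with `ψ`. -/
theorem integral_inner_flux_eq_zero {p q : ℝ} (hp : 1 < p) (hpq : p ≤ q) {a : 𝔼 → ℝ}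
    {G ψ : 𝔼 → 𝔼} (ha : AEMeasurable a (volume.restrict Ω))
    (ha0 : ∀ᵐ x ∂(volume.restrict Ω), 0 ≤ a x)
    (hG : MemLp G (ENNReal.ofReal p) (volume.restrict Ω))
    (hψ : MemLp ψ (ENNReal.ofReal p) (volume.restrict Ω))
    (hGa : Integrable (fun x => a x * ‖G x‖ ^ q) (volume.restrict Ω))
    (hψa : Integrable (fun x => a x * ‖ψ x‖ ^ q) (volume.restrict Ω))
    (hmin : ∀ t : ℝ, gradEnergy p q a Ω G ≤ gradEnergy p q a Ω (fun x => G x + t • ψ x)) :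
    ∫ x in Ω, inner ℝ (flux p q (a x) (G x)) (ψ x) = 0 := by
  have hloc : IsLocalMin (fun t : ℝ => ∫ x in Ω, phase p q (a x) (G x + t • ψ x)) 0 := by
    filter_upwards [Metric.ball_mem_nhds (0 : ℝ) one_pos] with t ht
    have h := hmin t
    rw [gradEnergy_eq_ofReal_integral hp hpq ha0 (integrable_phase_add_smul hp hpq ha ha0 hG hψ
        hGa hψa (mem_ball_zero_iff.1 ht).le),
      gradEnergy_eq_ofReal_integral hp hpq ha0 (integrable_phase hp hG hGa),
      ENNReal.ofReal_le_ofReal_iff (integral_nonneg_of_ae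
        (ha0.mono fun _ hx => phase_nonneg hp hpq hx _))] at h
    simpa only [zero_smul, add_zero] using h
  have h0 := hloc.hasDerivAt_eq_zero
    (hasDerivAt_integral_phase hp hpq ha ha0 hG hψ hGa hψa)
  rw [integral_const_mul] at h0
  exact (mul_eq_zero.1 h0).resolve_left (by linarith)

/-- Conversely, the Euler–Lagrange equation tested with `H - G` implies `𝓕(G) ≤ 𝓕(H)`, by
convexity. -/
theorem gradEnergy_le_of_integral_inner_flux_eq_zero {p q : ℝ} (hp : 1 < p) (hpq : p ≤ q)
    {a : 𝔼 → ℝ} {G H : 𝔼 → 𝔼} (ha : AEMeasurable a (volume.restrict Ω))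
    (ha0 : ∀ᵐ x ∂(volume.restrict Ω), 0 ≤ a x)
    (hG : MemLp G (ENNReal.ofReal p) (volume.restrict Ω))
    (hH : MemLp H (ENNReal.ofReal p) (volume.restrict Ω))
    (hGa : Integrable (fun x => a x * ‖G x‖ ^ q) (volume.restrict Ω))
    (hHa : Integrable (fun x => a x * ‖H x‖ ^ q) (volume.restrict Ω))
    (h0 : ∫ x in Ω, inner ℝ (flux p q (a x) (G x)) (H x - G x) = 0) :
    gradEnergy p q a Ω G ≤ gradEnergy p q a Ω H := by
  have hIG := integrable_phase hp hG hGa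
  have hIH := integrable_phase hp hH hHa
  rw [gradEnergy_eq_ofReal_integral hp hpq ha0 hIG, gradEnergy_eq_ofReal_integral hp hpq ha0 hIH]
  refine ENNReal.ofReal_le_ofReal ?_
  have hI : Integrable (fun x => inner ℝ (flux p q (a x) (G x)) (H x - G x))
      (volume.restrict Ω) := by
    refine (integrable_add_rpow hp hpq ha ha0 hH hG hHa hGa).mono'
      (aestronglyMeasurable_inner_flux ha hG.aestronglyMeasurable
        (hH.aestronglyMeasurable.sub hG.aestronglyMeasurable)) (ha0.mono fun x hx => ?_)
    exact abs_inner_flux_le hp hpq hx (le_add_of_nonneg_left (norm_nonneg _)) (norm_sub_le _ _)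
  have hle := integral_mono_ae (hIG.add (hI.const_mul p)) hIH
    (ha0.mono fun x hx => phase_add_inner_le hp hpq hx (G x) (H x))
  simp only [Pi.add_apply] at hle
  rw [integral_add hIG (hI.const_mul p), integral_const_mul, h0] at hle
  linarith

/-! ### Weak solutions and energy estimates -/

theorem IsMinimizer.energy_ne_top (hΩ : IsOpen Ω) (hb : Bornology.IsBounded Ω) {p q : ℝ}
    (hp : 1 < p) (hpq : p ≤ q) {a : 𝔼 → ℝ} (ha : MemLp a ⊤ (volume.restrict Ω))
    (ha0 : ∀ᵐ x ∂(volume.restrict Ω), 0 ≤ a x) {f u : 𝔼 → ℝ} (hf : MemW1 q Ω f)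
    (hu : IsMinimizer p q a Ω f u) : energy p q a Ω u ≠ ⊤ :=
  ((hu.2 (self_mem_admissible hΩ hb hp.le f)).trans_lt
    (DoublePhase.energy_ne_top hb hp hpq ha ha0 hf).lt_top).ne

theorem HasTrace.of_mem_admissible (hΩ : IsOpen Ω) {p : ℝ} (hp : 1 ≤ p) {f u g : 𝔼 → ℝ}
    (hf : HasTrace p Ω f g) (hu : u ∈ admissible p Ω f) : HasTrace p Ω u g := by
  have hu' : MemW10 p Ω (fun x => u x - f x) := hu
  simpa using (hu'.hasTrace_zero hΩ).add hΩ hp hf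

/-- Minimizers satisfy the Euler–Lagrange equation. They have the trace of `f` because `f` has a
trace and functions in `W^{1,p}_0` have trace zero. -/
theorem IsMinimizer.isWeakSolution (hn : 2 ≤ n) (hΩ : IsBoundedLipschitzDomain Ω) {p q : ℝ}
    (hp : 1 < p) (hpq : p ≤ q) {a : 𝔼 → ℝ} (ha : MemLp a ⊤ (volume.restrict Ω))
    (ha0 : ∀ᵐ x ∂(volume.restrict Ω), 0 ≤ a x) {f u : 𝔼 → ℝ} (hf : MemW1 q Ω f)
    (hu : IsMinimizer p q a Ω f u) : IsWeakSolution p q a Ω f u := by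
  have hO := hΩ.isOpen
  have hb := hΩ.isBounded
  have ham := ha.aestronglyMeasurable.aemeasurable
  have hu1 := (hf.mono_exponent hb hpq).of_mem_admissible hO hu.1
  have huE := hu.energy_ne_top hO hb hp hpq ha ha0 hf
  have hua : Integrable (fun x => a x * ‖weakGrad Ω u x‖ ^ q) (volume.restrict Ω) :=
    integrable_weight_of_gradEnergy_ne_top hp hpq ham ha0 hu1.memLp_grad.aestronglyMeasurable huE
  refine ⟨⟨hu1, hua⟩, fun φ hφ => ?_, ?_⟩
  · refine integral_inner_flux_eq_zero hp hpq ham ha0 hu1.memLp_grad hφ.2.1.memLp_grad hua hφ.2.2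
      fun t => ?_
    rw [← gradEnergy_congr (weakGrad_add_const_mul_ae_eq hO hu1 hφ.2.1 t)]
    exact hu.2 (add_const_mul_mem_admissible hO hp.le hu.1 hφ.1 t)
  · obtain ⟨g, hg⟩ := hf.exists_hasTrace hn hΩ (hp.le.trans hpq)
    exact ⟨g, hg, (hg.mono_exponent hΩ hp.le hpq).of_mem_admissible hO hp.le hu.1⟩

/-- Weak solutions minimize, by convexity. They are admissible because functions with vanishing
trace belong to `W^{1,p}_0`, and the difference to a competitor `v` of finite energy is a legitimate
test function. -/
theorem IsWeakSolution.isMinimizer (hn : 2 ≤ n) (hΩ : IsBoundedLipschitzDomain Ω) {p q : ℝ}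
    (hp : 1 < p) (hpq : p ≤ q) {a : 𝔼 → ℝ} (ha : MemLp a ⊤ (volume.restrict Ω))
    (ha0 : ∀ᵐ x ∂(volume.restrict Ω), 0 ≤ a x) {f u : 𝔼 → ℝ} (hf : MemW1 q Ω f)
    (hu : IsWeakSolution p q a Ω f u) : IsMinimizer p q a Ω f u := by
  have hO := hΩ.isOpen
  have hb := hΩ.isBounded
  have ham := ha.aestronglyMeasurable.aemeasurable
  obtain ⟨⟨hu1, hua⟩, hweak, g, hfg, hug⟩ := hu
  have huM : u ∈ admissible p Ω f := by
    have h := hug.sub hO hp.le (hfg.mono_exponent hΩ hp.le hpq)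
    simp only [sub_self] at h
    exact h.memW10 hn hΩ hp.le
  refine ⟨huM, fun v hv => ?_⟩
  by_cases hE : energy p q a Ω v = ⊤
  · exact le_top.trans hE.ge
  have hv1 := (hf.mono_exponent hb hpq).of_mem_admissible hO hv
  have hva : Integrable (fun x => a x * ‖weakGrad Ω v x‖ ^ q) (volume.restrict Ω) :=
    integrable_weight_of_gradEnergy_ne_top hp hpq ham ha0 hv1.memLp_grad.aestronglyMeasurable hE
  have hφ := MemW10.sub_of_mem_admissible hO hp.le hv huM
  have hgrad := weakGrad_sub_ae_eq hO hv1 hu1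
  have hφa : Integrable (fun x => a x * ‖weakGrad Ω (fun x => v x - u x) x‖ ^ q)
      (volume.restrict Ω) := by
    refine (integrable_add_rpow hp hpq ham ha0 hv1.memLp_grad hu1.memLp_grad hva hua).mono'
      (ham.mul (hφ.1.memLp_grad.aestronglyMeasurable.norm.aemeasurable.pow_const
        q)).aestronglyMeasurable ?_
    filter_upwards [ha0, hgrad] with x hx h
    rw [h, Real.norm_of_nonneg (by positivity)]
    have h1 := mul_le_mul_of_nonneg_left (Real.rpow_le_rpow (norm_nonneg _)
      (norm_sub_le (weakGrad Ω v x) (weakGrad Ω u x)) (by linarith : 0 ≤ q)) hx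
    have h2 : 0 ≤ (‖weakGrad Ω v x‖ + ‖weakGrad Ω u x‖) ^ p := by positivity
    linarith
  refine gradEnergy_le_of_integral_inner_flux_eq_zero hp hpq ham ha0 hu1.memLp_grad
    hv1.memLp_grad hua hva ?_
  refine Eq.trans (integral_congr_ae ?_) (hweak _ ⟨hφ, hφ.1, hφa⟩)
  filter_upwards [hgrad] with x h
  rw [h, flux]

theorem exists_eLpNorm_le_of_exponent_le {X : Type*} [MeasurableSpace X] (μ : Measure X)
    [IsFiniteMeasure μ] {P Q : ℝ≥0∞} (hP : 1 ≤ P) (hPQ : P ≤ Q) (hQ : Q ≠ ⊤) :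
    ∃ K : ℝ≥0, ∀ {F : Type} [NormedAddCommGroup F] (G : X → F), AEStronglyMeasurable G μ →
      eLpNorm G P μ ≤ K * eLpNorm G Q μ := by
  have hP' : 0 < P.toReal :=
    ENNReal.toReal_pos (one_pos.trans_le hP).ne' (hPQ.trans_lt hQ.lt_top).ne
  have he : 0 ≤ 1 / P.toReal - 1 / Q.toReal :=
    sub_nonneg.2 (one_div_le_one_div_of_le hP' (ENNReal.toReal_mono hQ hPQ))
  have hK : μ Set.univ ^ (1 / P.toReal - 1 / Q.toReal) ≠ ⊤ :=
    ENNReal.rpow_ne_top_of_nonneg he (measure_ne_top μ _)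
  refine ⟨(μ Set.univ ^ (1 / P.toReal - 1 / Q.toReal)).toNNReal, fun G hG => ?_⟩
  rw [ENNReal.coe_toNNReal hK, mul_comm]
  exact eLpNorm_le_eLpNorm_mul_rpow_measure_univ hPQ hG

/-- This keeps the constants below affine in `‖a‖_∞`, hence strictly increasing. -/
theorem rpow_le_one_add {x : ℝ≥0∞} {s : ℝ} (h0 : 0 ≤ s) (h1 : s ≤ 1) : x ^ s ≤ 1 + x := by
  rcases le_total x 1 with h | h
  · exact (ENNReal.rpow_le_one h h0).trans le_self_add
  · calc x ^ s ≤ x ^ (1 : ℝ) := ENNReal.rpow_le_rpow_of_exponent_le h h1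
      _ = x := ENNReal.rpow_one x
      _ ≤ 1 + x := le_add_self

theorem rpow_div_rpow_one_div (x : ℝ≥0∞) {r : ℝ} (hr : r ≠ 0) : (x ^ r) ^ (1 / r) = x := by
  rw [← ENNReal.rpow_mul, mul_one_div_cancel hr, ENNReal.rpow_one]

theorem rpow_one_div_le_of_le {E X Y : ℝ≥0∞} {s : ℝ} (hs : 1 ≤ s) (h : E ≤ X + Y) :
    E ^ (1 / s) ≤ X ^ (1 / s) + Y ^ (1 / s) :=
  (ENNReal.rpow_le_rpow h (by positivity)).trans
    (ENNReal.rpow_add_le_add_rpow _ _ (by positivity) ((div_le_one (by linarith)).2 hs))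

/-- The gradient bound that follows from an energy bound. In the application `A = ‖a‖_∞`,
`D = ‖∇f‖_q`, and `X` is a multiple of `D` that bounds `‖∇f‖_p`. -/
theorem lpNorm_weakGrad_le_of_energy_le {p q : ℝ} (hp : 1 < p) (hpq : p ≤ q) {a : 𝔼 → ℝ}
    (ha0 : ∀ᵐ x ∂(volume.restrict Ω), 0 ≤ a x) {u : 𝔼 → ℝ} {A D X : ℝ≥0∞}
    (hE : energy p q a Ω u ≤ X ^ p + A * D ^ q) :
    lpNorm p Ω (weakGrad Ω u) ≤ X + (1 + A) * D ^ (q / p) := by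
  have hp0 : p ≠ 0 := by linarith
  have h1 := rpow_one_div_le_of_le hp.le ((lpNorm_rpow_le_gradEnergy hp hpq ha0 _).trans hE)
  rw [rpow_div_rpow_one_div _ hp0, rpow_div_rpow_one_div _ hp0,
    ENNReal.mul_rpow_of_nonneg _ _ (by positivity), ← ENNReal.rpow_mul, mul_one_div] at h1
  exact h1.trans (add_le_add le_rfl (mul_le_mul'
    (rpow_le_one_add (by positivity) ((div_le_one (by linarith)).2 hp.le)) le_rfl))

/-- The companion of `lpNorm_weakGrad_le_of_energy_le` for the weighted seminorm. -/
theorem weightedNorm_weakGrad_le_of_energy_le {p q : ℝ} (hp : 1 < p) (hpq : p ≤ q) {a : 𝔼 → ℝ}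
    (ha0 : ∀ᵐ x ∂(volume.restrict Ω), 0 ≤ a x) {u : 𝔼 → ℝ} {A D X : ℝ≥0∞}
    (hE : energy p q a Ω u ≤ X ^ p + A * D ^ q) :
    weightedNorm q a Ω (weakGrad Ω u) ≤
      ENNReal.ofReal (q / p) * (X ^ (p / q) + (1 + A) * D) := by
  have hp0 : 0 < p := by linarith
  have hq0 : 0 < q := by linarith
  have hq1 : 1 ≤ q := by linarith
  have hr : 1 ≤ q / p := (one_le_div hp0).2 hpq
  have h1 : ∫⁻ x in Ω, ENNReal.ofReal (a x * ‖weakGrad Ω u x‖ ^ q) ≤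
      ENNReal.ofReal (q / p) * energy p q a Ω u := by
    rw [energy, ← lintegral_const_mul' _ _ ENNReal.ofReal_ne_top]
    refine lintegral_mono_ae (ha0.mono fun x hx => ?_)
    rw [← ENNReal.ofReal_mul (by positivity)]
    refine ENNReal.ofReal_le_ofReal ?_
    have e : q / p * (‖weakGrad Ω u x‖ ^ p + p / q * a x * ‖weakGrad Ω u x‖ ^ q) =
        q / p * ‖weakGrad Ω u x‖ ^ p + a x * ‖weakGrad Ω u x‖ ^ q := by field_simp
    rw [e]
    have : 0 ≤ q / p * ‖weakGrad Ω u x‖ ^ p := by positivity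
    linarith
  have hs0 : 0 ≤ 1 / q := by positivity
  have hs1 : 1 / q ≤ 1 := (div_le_one hq0).2 hq1
  have h2 := rpow_one_div_le_of_le hq1 hE
  rw [ENNReal.mul_rpow_of_nonneg _ _ hs0, rpow_div_rpow_one_div _ hq0.ne', ← ENNReal.rpow_mul,
    mul_one_div] at h2
  calc weightedNorm q a Ω (weakGrad Ω u)
      ≤ (ENNReal.ofReal (q / p) * energy p q a Ω u) ^ (1 / q) := ENNReal.rpow_le_rpow h1 hs0
    _ = ENNReal.ofReal (q / p) ^ (1 / q) * energy p q a Ω u ^ (1 / q) :=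
        ENNReal.mul_rpow_of_nonneg _ _ hs0
    _ ≤ ENNReal.ofReal (q / p) * (X ^ (p / q) + (1 + A) * D) := by
        refine mul_le_mul' ?_ (h2.trans (add_le_add le_rfl (mul_le_mul'
          (rpow_le_one_add hs0 hs1) le_rfl)))
        exact (ENNReal.rpow_le_rpow_of_exponent_le (ENNReal.one_le_ofReal.2 hr) hs1).trans_eq
          (ENNReal.rpow_one _)

end DoublePhase

theorem mainTheorem5 (n : ℕ) (hn : 2 ≤ n) (Ω : Set (EuclideanSpace ℝ (Fin n)))
    (hΩ : DoublePhase.IsBoundedLipschitzDomain Ω) (p q : ℝ) (hp : 1 < p) (hpq : p ≤ q) :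
    ∃ C : ℝ≥0 → ℝ≥0, StrictMono C ∧ (∀ M, 0 < C M) ∧
      ∀ a : EuclideanSpace ℝ (Fin n) → ℝ,
        MemLp a ∞ (volume.restrict Ω) → (∀ᵐ x ∂(volume.restrict Ω), 0 ≤ a x) →
      ∀ f : EuclideanSpace ℝ (Fin n) → ℝ, DoublePhase.MemW1 q Ω f →
        ∃ u : EuclideanSpace ℝ (Fin n) → ℝ,
          -- existence and uniqueness of the weak solution
          DoublePhase.IsWeakSolution p q a Ω f u ∧
          (∀ w, DoublePhase.IsWeakSolution p q a Ω f w → w =ᵐ[volume.restrict Ω] u) ∧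
          -- `u` is the unique minimizer
          DoublePhase.IsMinimizer p q a Ω f u ∧
          (∀ w, DoublePhase.IsMinimizer p q a Ω f w → w =ᵐ[volume.restrict Ω] u) ∧
          -- energy estimates, with `g` the trace of `f`
          ∀ g, DoublePhase.HasTrace q Ω f g →
            DoublePhase.w1Norm p Ω u ≤
                C (eLpNorm a ∞ (volume.restrict Ω)).toNNReal *
                  (DoublePhase.lpNorm q Ω (DoublePhase.weakGrad Ω f) +
                    DoublePhase.lpNorm q Ω (DoublePhase.weakGrad Ω f) ^ (q / p) +
                    DoublePhase.boundaryNorm p Ω g) ∧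
            DoublePhase.w1aNorm p q a Ω u ≤
                C (eLpNorm a ∞ (volume.restrict Ω)).toNNReal *
                  (DoublePhase.lpNorm q Ω (DoublePhase.weakGrad Ω f) +
                    DoublePhase.lpNorm q Ω (DoublePhase.weakGrad Ω f) ^ (p / q) +
                    DoublePhase.lpNorm q Ω (DoublePhase.weakGrad Ω f) ^ (q / p) +
                    DoublePhase.boundaryNorm q Ω g) := by
  open DoublePhase in
  have hO := hΩ.isOpen
  have hb := hΩ.isBounded
  have hp0 : 0 < p := by linarith
  have hq0 : 0 < q := by linarith
  have := isFiniteMeasure_restrict_of_isBounded hb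
  have : IsFiniteMeasure (surfaceMeasure Ω) := ⟨surfaceMeasure_lt_top hΩ⟩
  have hPQ : ENNReal.ofReal p ≤ ENNReal.ofReal q := ENNReal.ofReal_le_ofReal hpq
  -- `C₁` is the constant in Friedrichs' inequality; `K` and `S` are those of the embeddings of
  -- `L^q` into `L^p` on `Ω` and on its boundary
  obtain ⟨C₁, hC₁⟩ := exists_lpNorm_le_of_hasTrace hn hO hb hp.le
  obtain ⟨K, hK⟩ := exists_eLpNorm_le_of_exponent_le (volume.restrict Ω) (one_le_ofReal hp.le)
    hPQ ENNReal.ofReal_ne_top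
  obtain ⟨S, hS⟩ := exists_eLpNorm_le_of_exponent_le (surfaceMeasure Ω) (one_le_ofReal hp.le)
    hPQ ENNReal.ofReal_ne_top
  -- `c₁ (1 + M)` serves for the `W^{1,p}` norm, and `c₂ (1 + M)` for the weighted seminorm
  set c₁ : ℝ≥0 := (C₁ + 1) * (K + 1) with hc₁
  set c₂ : ℝ≥0 := (q / p).toNNReal * (K ^ (p / q) + 1) with hc₂
  have hc₁0 : 0 < c₁ := by positivity
  refine ⟨fun M => (c₁ * (S + 1) + c₂) * (1 + M), fun M M' h => ?_, fun M => by positivity,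
    fun a ha ha0 f hf => ?_⟩
  · exact mul_lt_mul_of_pos_left (by gcongr) (by positivity)
  obtain ⟨u, hu⟩ := exists_isMinimizer hn hO hb hp hpq ha ha0 hf
  refine ⟨u, hu.isWeakSolution hn hΩ hp hpq ha ha0 hf, fun w hw =>
    hu.ae_eq hn hO hb hp hpq ha ha0 hf (hw.isMinimizer hn hΩ hp hpq ha ha0 hf), hu,
    fun w hw => hu.ae_eq hn hO hb hp hpq ha ha0 hf hw, fun g hg => ?_⟩
  have hug := (hg.mono_exponent hΩ hp.le hpq).of_mem_admissible hO hp.le hu.1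
  set A : ℝ≥0∞ := eLpNorm a ∞ (volume.restrict Ω) with hA
  have hAtop : A ≠ ⊤ := ha.eLpNorm_ne_top
  set D := lpNorm q Ω (weakGrad Ω f)
  have hDp : lpNorm p Ω (weakGrad Ω f) ≤ K * D := hK _ hf.memLp_grad.aestronglyMeasurable
  have hgS : boundaryNorm p Ω g ≤ S * boundaryNorm q Ω g := hS _ hg.2.1.aestronglyMeasurable
  -- compare the energy of `u` with that of `f`
  have hE : energy p q a Ω u ≤ (K * D) ^ p + A * D ^ q :=
    ((hu.2 (self_mem_admissible hO hb hp.le f)).trans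
      (gradEnergy_le hp hpq ha0 hf.memLp_grad.aestronglyMeasurable)).trans
      (add_le_add (ENNReal.rpow_le_rpow hDp hp0.le) le_rfl)
  have hgrad := lpNorm_weakGrad_le_of_energy_le hp hpq ha0 hE
  have hweight := weightedNorm_weakGrad_le_of_energy_le hp hpq ha0 hE
  have hcoe : ((A.toNNReal : ℝ≥0) : ℝ≥0∞) = A := ENNReal.coe_toNNReal hAtop
  have hone : (1 : ℝ≥0∞) ≤ (K : ℝ≥0∞) + 1 := le_add_self
  have honeA : (1 : ℝ≥0∞) ≤ 1 + A := le_self_add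
  have hP1 : (1 : ℝ≥0∞) ≤ (K + 1) * (1 + A) := one_le_mul hone honeA
  have hPK : (K : ℝ≥0∞) ≤ (K + 1) * (1 + A) :=
    le_self_add.trans (le_mul_of_one_le_right' honeA)
  have hPA : 1 + A ≤ (K + 1) * (1 + A) := le_mul_of_one_le_left' hone
  have hW : w1Norm p Ω u ≤ c₁ * (1 + A) * (D + D ^ (q / p) + boundaryNorm p Ω g) := by
    calc w1Norm p Ω u ≤ lpNorm p Ω u + lpNorm p Ω (weakGrad Ω u) := w1Norm_le_add hp.le u
      _ ≤ C₁ * (boundaryNorm p Ω g + lpNorm p Ω (weakGrad Ω u)) +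
          (boundaryNorm p Ω g + lpNorm p Ω (weakGrad Ω u)) :=
          add_le_add (hC₁ u g hug) le_add_self
      _ = (C₁ + 1) * (boundaryNorm p Ω g + lpNorm p Ω (weakGrad Ω u)) := by ring
      _ ≤ (C₁ + 1) * ((K + 1) * (1 + A) * boundaryNorm p Ω g + ((K + 1) * (1 + A) * D +
          (K + 1) * (1 + A) * D ^ (q / p))) := by
          refine mul_le_mul' le_rfl (add_le_add (le_mul_of_one_le_left' hP1) (hgrad.trans
            (add_le_add (mul_le_mul' hPK le_rfl) (mul_le_mul' hPA le_rfl))))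
      _ = c₁ * (1 + A) * (D + D ^ (q / p) + boundaryNorm p Ω g) := by
          rw [hc₁]
          push_cast
          ring
  have hV : weightedNorm q a Ω (weakGrad Ω u) ≤ c₂ * (1 + A) * (D + D ^ (p / q)) := by
    refine hweight.trans ?_
    have hd : 0 ≤ p / q := by positivity
    rw [hc₂, ENNReal.mul_rpow_of_nonneg _ _ hd, ENNReal.coe_mul, mul_assoc, mul_assoc]
    refine mul_le_mul' le_rfl ?_
    push_cast
    rw [ENNReal.coe_rpow_of_nonneg _ hd]
    calc (K : ℝ≥0∞) ^ (p / q) * D ^ (p / q) + (1 + A) * D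
        ≤ (K ^ (p / q) + 1) * (1 + A) * D ^ (p / q) + (K ^ (p / q) + 1) * (1 + A) * D :=
          add_le_add (mul_le_mul' (le_self_add.trans (le_mul_of_one_le_right' honeA)) le_rfl)
            (mul_le_mul' (le_mul_of_one_le_left' le_add_self) le_rfl)
      _ = _ := by ring
  refine ⟨hW.trans ?_, (add_le_add hW hV).trans ?_⟩
  · push_cast
    rw [hcoe]
    refine mul_le_mul' (mul_le_mul' (le_trans ?_ le_self_add) le_rfl) le_rfl
    exact le_mul_of_one_le_right' le_add_self
  · push_cast
    rw [hcoe]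
    set B := boundaryNorm q Ω g
    have hS1 : (1 : ℝ≥0∞) ≤ S + 1 := le_add_self
    calc c₁ * (1 + A) * (D + D ^ (q / p) + boundaryNorm p Ω g) +
          c₂ * (1 + A) * (D + D ^ (p / q))
        ≤ c₁ * (1 + A) * ((S + 1) * (D + D ^ (p / q) + D ^ (q / p) + B)) +
          c₂ * (1 + A) * (D + D ^ (p / q) + D ^ (q / p) + B) := by
          refine add_le_add (mul_le_mul' le_rfl ?_) (mul_le_mul' le_rfl ?_)
          · calc D + D ^ (q / p) + boundaryNorm p Ω g
                ≤ (S + 1) * (D + D ^ (q / p)) + (S + 1) * B :=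
                  add_le_add (le_mul_of_one_le_left' hS1)
                    (hgS.trans (mul_le_mul' le_self_add le_rfl))
              _ = (S + 1) * (D + D ^ (q / p) + B) := by ring
              _ ≤ (S + 1) * (D + D ^ (p / q) + D ^ (q / p) + B) :=
                  mul_le_mul' le_rfl (add_le_add (add_le_add le_self_add le_rfl) le_rfl)
          · exact le_self_add.trans le_self_add
      _ = (c₁ * (S + 1) + c₂) * (1 + A) * (D + D ^ (p / q) + D ^ (q / p) + B) := by ring
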